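/- **Model.** Fix integers $L\ge 1$, $k>1$, $n\ge L+k-1$ and $\mu>0$. Requests $i=0,1,2,\dots$ arrive at random times $0\le A_0\le A_1\le\cdots\to\infty$ (simultaneous arrivals allowed); the process has rate $\lambda>0$ if $i/A_i\to\lambda$ almost surely. A file has $n$ coded chunks, any $k$ of which suffice. A dispatcher has $L$ threads; a thread downloads one chunk at a time. The downloading times of the chunks are i.i.d. exponential with rate $\mu$, independent of the arrivals. A request departs when $k$ of its chunks have been downloaded (its *effective* chunks), and its other running downloads are then terminated. An *on-line scheme* decides, possibly using an independent random seed, at which times which chunks of requests that have arrived are started, with at most $L$ active threads at any time and no other terminations; what is started at time $t$ depends only on the seed, the arrivals and chunk completions up to time $t$, and the downloads started before $t$. It is *work-conserving* if all $L$ threads are active whenever some request has arrived and not departed. With $D_i$ the time from arrival to departure of request $i$, the queue is *stable* if $\limsup_m \frac1m\sum_{i<m}\mathbb E[D_i]<\infty$, and *stable given the arrivals* if $\limsup_m\frac1m\sum_{i<m}\mathbb E[D_i\mid A]<\infty$ for almost every realization of $A=(A_i)_i$ (the two agree for deterministic arrival times). For an arrival process $A$ of rate $1$, the process $A/\lambda$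 has rate $\lambda$; the *capacity region* of $A$ is the set of $\lambda>0$ such that the queue with arrivals $A/\lambda$ is stable under some on-line scheme, and a scheme is *throughput optimal* for $A$ if it stabilizes the queue with arrivals $A/\lambda$ for each $\lambda>0$ such that $\lambda+\varepsilon$ is in the capacity region for some $\varepsilon>0$. **Theorem.** Every work-conserving on-line scheme has the following properties. 1. It is throughput optimal among all on-line schemes for any arrival process, stability being understood given the arrivals (in particular for any deterministic arrival sequence). 2. It is throughput optimal among all on-line schemes for any renewal arrival process (i.i.d. nonnegative interarrival times with finite positive mean), stability being understood in the sense of unconditional expectations. 3. It delivers effective chunks at rate $L\mu$: for any arrival process, if $t_m$ denotes the time of the $m$-th delivery of an effective chunk ($m\ge 0$, $t_{-1}=0$), the service durations $t_m-\max\{t_{m-1},A_{\lfloor m/k\rfloor}\}$ are i.i.d. exponential with rate $L\mu$ and independent of the arrivals. For any arrival process of rate $\lambda$, the number of effective chunks delivered up to time $t$, divided by $t$, tends almost surely to $\min\{k\lambda,L\mu\}$ as $t\to\infty$. 4. Hence requests can depart at rates up to the maximal rate $L\mu/k$: for any arrival process of rate $\lambda\le L\mu/k$, the number of departures up to time $t$,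 divided by $t$, tends almost surely to $\lambda$; and for any arrival process and any on-line scheme, the upper limit of this ratio is almost surely at most $L\mu/k$. 5. Under any renewal arrival process of rate $\lambda$, the queue is stable if and only if $\lambda<L\mu/k$. Moreover, under any arrival process of rate $\lambda$ and any on-line scheme, the queue can be stable, or stable given the arrivals, only if $\lambda<L\mu/k$. -/

import Mathlib

open MeasureTheory ProbabilityTheory Filter Topology
open scoped ENNReal

namespace CloudQueue

/-! ### Sample paths

A request is numbered by `i : ℕ`, its coded chunks by `j : Fin n`; `p = (i, j)` is the `j`-th chunk
of request `i`.  For a fixed sample path, `s p` is the time at which a thread starts downloading the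
chunk `p` (`⊤` if this never happens) and `x p` is the downloading time of that chunk. -/

section Path

variable {n : ℕ}

/-- The time at which the download of the chunk `p` would finish if it is not terminated. -/
noncomputable def finishTime (s : ℕ × Fin n → ℝ≥0∞) (x : ℕ × Fin n → ℝ) (p : ℕ × Fin n) : ℝ≥0∞ :=
  s p + ENNReal.ofReal (x p)

/-- The departure time of request `i`: the first time at which `k` of its downloads have finished
(`⊤` if this never happens). -/
noncomputable def departureTime (k : ℕ) (s : ℕ × Fin n → ℝ≥0∞) (x : ℕ × Fin n → ℝ) (i : ℕ) :
    ℝ≥0∞ :=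
  sInf {t | (k : ℕ∞) ≤ {j : Fin n | finishTime s x (i, j) ≤ t}.encard}

/-- The time at which the chunk `p` is delivered as an effective chunk, i.e. as one of the first `k`
finished chunks of its request; `⊤` if it is never started or gets terminated because the request
has departed. -/
noncomputable def deliveryTime (k : ℕ) (s : ℕ × Fin n → ℝ≥0∞) (x : ℕ × Fin n → ℝ)
    (p : ℕ × Fin n) : ℝ≥0∞ :=
  open Classical in
  if finishTime s x p ≤ departureTime k s x p.1 then finishTime s x p else ⊤

/-- The chunks that are being downloaded at time `t`, one per active thread: started, not yet
finished, and not terminated by the departure of the request. -/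
def activeChunks (k : ℕ) (s : ℕ × Fin n → ℝ≥0∞) (x : ℕ × Fin n → ℝ) (t : ℝ≥0∞) :
    Set (ℕ × Fin n) :=
  {p | s p ≤ t ∧ t < finishTime s x p ∧ t < departureTime k s x p.1}

/-- Request number `i` is in the system at time `t`: it has arrived and not departed. -/
def InSystem (k : ℕ) (a : ℕ → ℝ) (s : ℕ × Fin n → ℝ≥0∞) (x : ℕ × Fin n → ℝ) (t : ℝ≥0∞) (i : ℕ) :
    Prop :=
  ENNReal.ofReal (a i) ≤ t ∧ t < departureTime k s x i

/-- The number of effective chunks delivered up to time `t`. -/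
noncomputable def numDelivered (k : ℕ) (s : ℕ × Fin n → ℝ≥0∞) (x : ℕ × Fin n → ℝ) (t : ℝ≥0∞) : ℕ :=
  {p | deliveryTime k s x p ≤ t}.ncard

/-- The number of requests departed up to time `t`. -/
noncomputable def numDeparted (k : ℕ) (s : ℕ × Fin n → ℝ≥0∞) (x : ℕ × Fin n → ℝ) (t : ℝ≥0∞) : ℕ :=
  {i | departureTime k s x i ≤ t}.ncard

/-- The time of the `m`-th delivery of an effective chunk (`m = 0, 1, …`), over all requests. -/
noncomputable def nthDelivery (k : ℕ) (s : ℕ × Fin n → ℝ≥0∞) (x : ℕ × Fin n → ℝ) (m : ℕ) : ℝ≥0∞ :=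
  sInf {t | ((m + 1 : ℕ) : ℕ∞) ≤ {p | deliveryTime k s x p ≤ t}.encard}

/-- The service duration of the `m`-th delivered effective chunk.  It is counted from the previous
delivery, or from the arrival of the `m`-th effective chunk to be served (every request brings `k` of
them, so this is the arrival of request `m / k`), whichever is later. -/
noncomputable def serviceDuration (k : ℕ) (a : ℕ → ℝ) (s : ℕ × Fin n → ℝ≥0∞)
    (x : ℕ × Fin n → ℝ) : ℕ → ℝ
  | 0 => (nthDelivery k s x 0 - ENNReal.ofReal (a 0)).toReal
  | m + 1 => (nthDelivery k s x (m + 1) -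
      max (nthDelivery k s x m) (ENNReal.ofReal (a ((m + 1) / k)))).toReal

end Path

/-! ### On-line schemes -/

/-- A sequence of arrival times: nonnegative, nondecreasing, with finitely many arrivals in bounded
time.  Simultaneous arrivals are allowed. -/
def ValidArrivals (a : ℕ → ℝ) : Prop :=
  (∀ i, 0 ≤ a i) ∧ Monotone a ∧ Tendsto a atTop atTop

/-- All the randomness of the system: the arrival times, the downloading times of the chunks, and
an additional random seed that the dispatcher may use. -/
abbrev Input (n : ℕ) : Type := (ℕ → ℝ) × (ℕ × Fin n → ℝ) × unitInterval

/-- The inputs that have probability one: valid arrival times and positive downloading times. -/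
def ValidInput {n : ℕ} (w : Input n) : Prop :=
  ValidArrivals w.1 ∧ ∀ p, 0 < w.2.1 p

/-- Under the rule `start`, the inputs `w` and `w'` look the same to the dispatcher when it decides
at time `t`: same seed, same arrivals up to time `t`, same starts of downloads before time `t`, same
deliveries of chunks up to time `t`. -/
def SameHistory {n : ℕ} (k : ℕ) (start : Input n → ℕ × Fin n → ℝ≥0∞) (t : ℝ≥0∞)
    (w w' : Input n) : Prop :=
  w.2.2 = w'.2.2 ∧
  (∀ i, ENNReal.ofReal (w.1 i) ≤ t ∨ ENNReal.ofReal (w'.1 i) ≤ t → w.1 i = w'.1 i) ∧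
  (∀ p, start w p < t ∨ start w' p < t → start w p = start w' p) ∧
  (∀ p, deliveryTime k (start w) w.2.1 p ≤ t ∨ deliveryTime k (start w') w'.2.1 p ≤ t →
    deliveryTime k (start w) w.2.1 p = deliveryTime k (start w') w'.2.1 p)

/-- An on-line scheme for `L` threads and an `(n, k)` code: a rule that says when the download of
each chunk is started.  Requests are served after their arrival, at most `L` threads are active at
any time, each chunk is downloaded by at most one thread, downloads are only terminated by the
departure of the request, and what is started at time `t` depends only on the history. -/
structure OnlineScheme (L k n : ℕ) where
  /-- The starting time of the download of each chunk. -/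
  start : Input n → ℕ × Fin n → ℝ≥0∞
  measurable_start : ∀ p, Measurable fun w => start w p
  arrival_le_start : ∀ w, ValidInput w → ∀ p, ENNReal.ofReal (w.1 p.1) ≤ start w p
  card_active_le : ∀ w, ValidInput w → ∀ t, (activeChunks k (start w) w.2.1 t).encard ≤ L
  online : ∀ w w', ValidInput w → ValidInput w' → ∀ t, SameHistory k start t w w' →
    ∀ p, start w p = t ↔ start w' p = t

/-- A scheme is work-conserving if all `L` threads are active whenever there is a request in the
system. -/
def OnlineScheme.WorkConserving {L k n : ℕ} (S : OnlineScheme L k n) : Prop :=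
  ∀ w, ValidInput w → ∀ t, (∃ i, InSystem k w.1 (S.start w) w.2.1 t i) →
    (activeChunks k (S.start w) w.2.1 t).encard = L

/-! ### Arrival processes and the probability law of the system -/

/-- `ν` is the law of the arrival times of an arrival process. -/
structure IsArrivalProcess (ν : Measure (ℕ → ℝ)) : Prop where
  isProbabilityMeasure : IsProbabilityMeasure ν
  ae_valid : ∀ᵐ a ∂ν, ValidArrivals a

/-- The arrival process has long-run rate `r`. -/
def HasRate (ν : Measure (ℕ → ℝ)) (r : ℝ) : Prop :=
  ∀ᵐ a ∂ν, Tendsto (fun i : ℕ => (i : ℝ) / a i) atTop (𝓝 r)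

/-- The arrival process `ν` accelerated by the factor `r`; it has rate `r` if `ν` has rate `1`. -/
noncomputable def accelerate (r : ℝ) (ν : Measure (ℕ → ℝ)) : Measure (ℕ → ℝ) :=
  ν.map fun a i => a i / r

/-- `ρ` is the law of a nonnegative interarrival time with mean `1`. -/
structure IsUnitInterarrival (ρ : Measure ℝ) : Prop where
  isProbabilityMeasure : IsProbabilityMeasure ρ
  ae_nonneg : ∀ᵐ y ∂ρ, 0 ≤ y
  integrable : Integrable (fun y => y) ρ
  mean_eq : ∫ y, y ∂ρ = 1

/-- The renewal arrival process whose interarrival times are i.i.d. with law `ρ`. -/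
noncomputable def renewal (ρ : Measure ℝ) : Measure (ℕ → ℝ) :=
  (Measure.infinitePi fun _ : ℕ => ρ).map fun y i => ∑ j ∈ Finset.range (i + 1), y j

/-- The law of the downloading times, i.i.d. exponential with rate `μ`, and of an independent
uniform seed. -/
noncomputable def serviceLaw (n : ℕ) (μ : ℝ) : Measure ((ℕ × Fin n → ℝ) × unitInterval) :=
  (Measure.infinitePi fun _ : ℕ × Fin n => expMeasure μ).prod volume

/-- The law of the whole input: the arrivals are independent of downloading times and seed. -/
noncomputable def inputLaw (n : ℕ) (μ : ℝ) (ν : Measure (ℕ → ℝ)) : Measure (Input n) :=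
  ν.prod (serviceLaw n μ)

namespace OnlineScheme

variable {L k n : ℕ} (S : OnlineScheme L k n)

/-- The system delay of request `i`. -/
noncomputable def delay (w : Input n) (i : ℕ) : ℝ≥0∞ :=
  departureTime k (S.start w) w.2.1 i - ENNReal.ofReal (w.1 i)

/-- The number of effective chunks delivered up to time `t`. -/
noncomputable def delivered (w : Input n) (t : ℝ) : ℕ :=
  numDelivered k (S.start w) w.2.1 (ENNReal.ofReal t)

/-- The number of requests departed up to time `t`. -/
noncomputable def departed (w : Input n) (t : ℝ) : ℕ :=
  numDeparted k (S.start w) w.2.1 (ENNReal.ofReal t)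

/-- The queue is stable: the long-run average of the expected delays of the requests is finite. -/
def Stable (μ : ℝ) (S : OnlineScheme L k n) (ν : Measure (ℕ → ℝ)) : Prop :=
  limsup (fun m : ℕ => (∑ i ∈ Finset.range m, ∫⁻ w, S.delay w i ∂inputLaw n μ ν) / (m : ℝ≥0∞))
    atTop < ⊤

/-- The queue is stable given the arrivals: for almost every realization `a` of the arrival process,
the long-run average of the conditional expected delays given `a` is finite. -/
def StableGivenArrivals (μ : ℝ) (S : OnlineScheme L k n) (ν : Measure (ℕ → ℝ)) : Prop :=
  ∀ᵐ a ∂ν, limsup (fun m : ℕ =>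
    (∑ i ∈ Finset.range m, ∫⁻ z, S.delay (a, z) i ∂serviceLaw n μ) / (m : ℝ≥0∞)) atTop < ⊤

end OnlineScheme

/-- The capacity region for a given notion of stability and a given shape `ν` of the arrival process
(an arrival process of rate `1`): the arrival rates under which the queue can be stabilized by some
on-line scheme. -/
def capacityRegion {L k n : ℕ} (stable : OnlineScheme L k n → Measure (ℕ → ℝ) → Prop)
    (ν : Measure (ℕ → ℝ)) : Set ℝ :=
  {r | 0 < r ∧ ∃ S : OnlineScheme L k n, stable S (accelerate r ν)}

/-- A scheme is throughput optimal if it stabilizes the queue at every arrival rate `r` for which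
some larger rate `r + ε` is in the capacity region. -/
def ThroughputOptimal {L k n : ℕ} (stable : OnlineScheme L k n → Measure (ℕ → ℝ) → Prop)
    (ν : Measure (ℕ → ℝ)) (S : OnlineScheme L k n) : Prop :=
  ∀ r : ℝ, 0 < r → (∃ ε : ℝ, 0 < ε ∧ r + ε ∈ capacityRegion stable ν) → stable S (accelerate r ν)

end CloudQueue

/-! Everything rests on one identity. Change only the downloading time of a chunk `p`: by causality
the two runs agree before the earlier of the two finish times of `p` (`agree_of_eq_off`). So, with
everything else frozen, `p` carries an exponential clock that starts at a time not depending on it.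
Integrating over this clock gives E Z(delivery of p) = E ∫ μ 1{p is being downloaded} Z(t) dt for
every predictable Z (`lintegral_delivery_eq_of_chunk`). Summed over the chunks, the m-th delivery of
the whole system has intensity μ times the number of active threads (`lintegral_nthDelivery`).

Let T be the time of the m-th delivery and R the time from which it is waited for (previous delivery
or arrival of request m / k). Testing the formula with exp(-Lμ(c - t)) bounds the probability that T
exceeds c from below by the exponential survival probability from R to c, because at most L threads
are active. Under work conservation this is an equality, because some request is in the system
throughout [R, T) (`lintegral_survival_aux`). The equality, with c allowed to depend on the past,
makes the durations T - R i.i.d. exponential with rate Lμ whatever the arrivals and the seed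
(`map_svc`). The inequality, iterated, makes the delivery times of any scheme stochastically larger
than the Lindley recursion driven by such durations (`measure_lt_lindley_le`).

Delays are compared with waiting times of chunks. The total delay is the time integral of the number
of requests in the system. That number is at most the number of missing effective chunks, which in
turn is at most k times it (`sum_delay_le`, `le_sum_delay`). The upper bound for the first M
requests must also count missing chunks of later requests, since a scheme may serve those first. It
therefore uses `lindleyCut`, where the server no longer waits for arrivals from request M on.

What remains is a single-server queue, whose waiting time is a maximum over the possible starts of
the busy period. Rates follow from the strong law (`tendsto_lindley_div`). At or above the critical
rate, looking back over a long window of requests shows that mean waits exceed every bound, since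
the fluctuations of sums of exponentials are unbounded in mean (`tendsto_average_delay_top`). Below
it, renewal arrivals are handled by a Chernoff bound summed over busy-period starts
(`stable_renewal`).

For arbitrary arrivals no rate condition implies stability, so the queue is compared with a stable
one having arrivals faster by a factor ρ > 1 (`limsup_lt_top`). The wait splits into an excess of
the random work over κ times its mean, 1 < κ < ρ, which is geometrically small, and a deterministic
fluid backlog. By Jensen the latter is at most ρ times the mean wait in the faster queue. It
vanishes at late chunks, because a backlog proportional to the length of a long stretch forces a
quadratic total wait, against stability (`exists_fluid_le`). -/

namespace CloudQueue

/-! ### The successive points of a family of times -/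

section NthTime

variable {ι : Type*}

/-- The `m`-th smallest (`m = 0, 1, …`) of a family of times. -/
noncomputable def nthTime (d : ι → ℝ≥0∞) (m : ℕ) : ℝ≥0∞ :=
  sInf {t | ((m + 1 : ℕ) : ℕ∞) ≤ {p | d p ≤ t}.encard}

/-- Only finitely many of the times `d p` lie in a bounded interval. -/
def LocFinite (d : ι → ℝ≥0∞) : Prop := ∀ t < ⊤, {p | d p ≤ t}.Finite

/-- No two finite times coincide. -/
def NoTies (d : ι → ℝ≥0∞) : Prop := ∀ p q, d p = d q → d p ≠ ⊤ → p = q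

/-- The number of times up to `t`. -/
noncomputable def countUpTo (d : ι → ℝ≥0∞) (t : ℝ≥0∞) : ℕ := {p | d p ≤ t}.ncard

theorem nthTime_lt_iff {d : ι → ℝ≥0∞} {m : ℕ} {t : ℝ≥0∞} :
    nthTime d m < t ↔ ∃ u < t, ((m + 1 : ℕ) : ℕ∞) ≤ {p | d p ≤ u}.encard := by
  unfold nthTime
  rw [sInf_lt_iff]
  simp only [Set.mem_ofPred_eq]
  exact ⟨fun ⟨u, h1, h2⟩ => ⟨u, h2, h1⟩, fun ⟨u, h1, h2⟩ => ⟨u, h2, h1⟩⟩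

theorem nthTime_mono (d : ι → ℝ≥0∞) : Monotone (nthTime d) := by
  intro m m' h
  apply sInf_le_sInf
  intro t ht
  have ht' : ((m' + 1 : ℕ) : ℕ∞) ≤ {p | d p ≤ t}.encard := ht
  have : ((m + 1 : ℕ) : ℕ∞) ≤ {p | d p ≤ t}.encard := le_trans (by gcongr) ht'
  exact this

/-- Only the times before `t` enter the event that the `m`-th one is before `t`. This is what makes
the successive deliveries predictable. -/
theorem nthTime_lt_congr {d d' : ι → ℝ≥0∞} {t : ℝ≥0∞} (h : ∀ p, min (d p) t = min (d' p) t)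
    (m : ℕ) : nthTime d m < t ↔ nthTime d' m < t := by
  have key : ∀ u < t, {p | d p ≤ u} = {p | d' p ≤ u} := by
    intro u hu
    ext p
    have := h p
    simp only [Set.mem_ofPred_eq]
    constructor
    · intro hp
      rw [min_eq_left (hp.trans hu.le)] at this
      rcases min_choice (d' p) t with h' | h'
      · rw [h'] at this; rwa [← this]
      · rw [h'] at this; rw [this] at hp; exact absurd hp (not_le.2 hu)
    · intro hp
      rw [min_eq_left (hp.trans hu.le)] at this
      rcases min_choice (d p) t with h' | h'
      · rw [h'] at this; rwa [this]
      · rw [h'] at this; rw [← this] at hp; exact absurd hp (not_le.2 hu)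
  rw [nthTime_lt_iff, nthTime_lt_iff]
  refine exists_congr fun u => and_congr_right fun hu => ?_
  rw [key u hu]

theorem min_congr_of_le {d d' : ι → ℝ≥0∞} {t u : ℝ≥0∞} (h : ∀ p, min (d p) t = min (d' p) t)
    (hu : u ≤ t) (p : ι) : min (d p) u = min (d' p) u := by
  rw [← min_eq_right hu, ← min_assoc, h p, min_assoc]

theorem nthTime_eq_of_lt {d d' : ι → ℝ≥0∞} {t : ℝ≥0∞} (h : ∀ p, min (d p) t = min (d' p) t)
    {m : ℕ} (hm : nthTime d m < t) : nthTime d m = nthTime d' m := by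
  have hm' := (nthTime_lt_congr h m).1 hm
  apply le_antisymm
  · by_contra! hlt
    exact lt_irrefl _ ((nthTime_lt_congr (min_congr_of_le h hm.le) m).2 hlt)
  · by_contra! hlt
    exact lt_irrefl _ ((nthTime_lt_congr (min_congr_of_le h hm'.le) m).1 hlt)

/-- The strict inequality leaves room for a rational level, and `m + 1` small times can be exhibited
on a finite index set, so the event is a countable union. -/
theorem measurable_nthTime [Countable ι] (m : ℕ) :
    Measurable fun d : ι → ℝ≥0∞ => nthTime d m := by
  apply measurable_of_Iio
  intro t
  have : (fun d : ι → ℝ≥0∞ => nthTime d m) ⁻¹' Set.Iio t =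
      ⋃ s ∈ {s : Finset ι | s.card = m + 1}, ⋃ q ∈ {q : ℚ | ENNReal.ofReal q < t},
        ⋂ p ∈ s, {d : ι → ℝ≥0∞ | d p ≤ ENNReal.ofReal q} := by
    ext d
    simp only [Set.mem_preimage, Set.mem_Iio, Set.mem_iUnion, Set.mem_iInter, Set.mem_ofPred_eq,
      exists_prop]
    rw [nthTime_lt_iff]
    constructor
    · rintro ⟨u, hu, hc⟩
      obtain ⟨s, hs, hs'⟩ := Set.exists_subset_encard_eq hc
      have hfin : s.Finite := Set.finite_of_encard_eq_coe hs'
      refine ⟨hfin.toFinset, ?_, ?_⟩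
      · rw [hfin.encard_eq_coe_toFinset_card] at hs'
        exact_mod_cast hs'
      · obtain ⟨q, hq, hq1, hq2⟩ := ENNReal.lt_iff_exists_rat_btwn.1 hu
        refine ⟨q, hq2, fun p hp => ?_⟩
        have : d p ≤ u := hs (by simpa using hp)
        exact this.trans hq1.le
    · rintro ⟨s, hs, q, hq, h⟩
      refine ⟨_, hq, ?_⟩
      have : (s : Set ι) ⊆ {p | d p ≤ ENNReal.ofReal q} := fun p hp => h p hp
      refine le_trans ?_ (Set.encard_le_encard this)
      rw [Set.encard_coe_eq_coe_finsetCard, hs]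
  rw [this]
  refine MeasurableSet.biUnion (Set.to_countable _) fun s _ => ?_
  refine MeasurableSet.biUnion (Set.to_countable _) fun q _ => ?_
  refine MeasurableSet.biInter (Set.to_countable _) fun p _ => ?_
  exact measurableSet_le (measurable_pi_apply p) measurable_const

theorem LocFinite.finite_lt {d : ι → ℝ≥0∞} (h : LocFinite d) {t : ℝ≥0∞} (ht : t < ⊤) :
    {p | d p < t}.Finite :=
  (h t ht).subset fun _ hp => le_of_lt (a := d _) (b := t) hp

/-- Local finiteness leaves a gap free of times just after `t`, so the infimum defining `nthTime` is
attained. -/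
theorem LocFinite.lt_nthTime_iff {d : ι → ℝ≥0∞} (h : LocFinite d) {m : ℕ} {t : ℝ≥0∞}
    (ht : t < ⊤) : nthTime d m ≤ t ↔ m < countUpTo d t := by
  have hcard : ((m + 1 : ℕ) : ℕ∞) ≤ {p | d p ≤ t}.encard ↔ m < countUpTo d t := by
    rw [countUpTo, ← (h t ht).cast_ncard_eq, Nat.cast_le]
    rfl
  rw [← hcard]
  constructor
  · intro hle
    obtain ⟨u, htu, hu⟩ : ∃ u, t < u ∧ ∀ p, d p < u → d p ≤ t := by
      have ht1 : t + 1 < ⊤ := ENNReal.add_lt_top.2 ⟨ht, ENNReal.one_lt_top⟩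
      have hlt : t < t + 1 := ENNReal.lt_add_right ht.ne one_ne_zero
      have hfin : {p | t < d p ∧ d p ≤ t + 1}.Finite := (h _ ht1).subset fun p hp => hp.2
      rcases Set.eq_empty_or_nonempty {p | t < d p ∧ d p ≤ t + 1} with he | hne
      · refine ⟨t + 1, hlt, fun p hp => ?_⟩
        by_contra! hc
        exact (Set.eq_empty_iff_forall_notMem.1 he p) ⟨hc, hp.le⟩
      · obtain ⟨p0, hp0, hmin⟩ := Set.exists_min_image _ d hfin hne
        refine ⟨d p0, hp0.1, fun p hp => ?_⟩
        by_contra! hc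
        exact absurd (hmin p ⟨hc, (hp.trans_le hp0.2).le⟩) (not_le.2 hp)
    obtain ⟨v, hv, hc⟩ := nthTime_lt_iff.1 (hle.trans_lt htu)
    refine hc.trans (Set.encard_le_encard fun p hp => ?_)
    exact hu p (lt_of_le_of_lt hp hv)
  · intro hc
    exact sInf_le hc

/-- If more than `m` times were smaller, the largest of them would already bound the `m`-th one from
above. -/
theorem LocFinite.ncard_lt_le {d : ι → ℝ≥0∞} (h : LocFinite d) {m : ℕ} (hm : nthTime d m < ⊤) :
    {p | d p < nthTime d m}.ncard ≤ m := by
  by_contra! hc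
  have hfin := h.finite_lt hm
  have hne : {p | d p < nthTime d m}.Nonempty := by
    rw [← Set.ncard_pos hfin]; omega
  obtain ⟨p0, hp0, hmax⟩ := Set.exists_max_image _ d hfin hne
  have : nthTime d m ≤ d p0 := by
    rw [h.lt_nthTime_iff (hp0.trans hm)]
    refine hc.trans_le (Set.ncard_le_ncard (fun p hp => hmax p hp) (h _ (hp0.trans hm)))
  exact absurd this (not_le.2 hp0)

theorem NoTies.countUpTo_le {d : ι → ℝ≥0∞} (hd : NoTies d) (t : ℝ≥0∞) (ht : t < ⊤) :
    countUpTo d t ≤ {p | d p < t}.ncard + 1 := by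
  have hsplit : {p | d p ≤ t} = {p | d p < t} ∪ {p | d p = t} := by
    ext p; exact le_iff_lt_or_eq (a := d p)
  have hss : {p | d p = t}.Subsingleton := by
    intro p hp q hq
    simp only [Set.mem_ofPred_eq] at hp hq
    exact hd p q (hp.trans hq.symm) (hp ▸ ht.ne)
  have hsub : {p | d p = t}.ncard ≤ 1 := (Set.ncard_le_one hss.finite).2 fun a ha b hb => hss ha hb
  unfold countUpTo
  rw [hsplit]
  exact (Set.ncard_union_le _ _).trans (by omega)

theorem NoTies.countUpTo_nthTime {d : ι → ℝ≥0∞} (hd : NoTies d) (h : LocFinite d) {m : ℕ}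
    (hm : nthTime d m < ⊤) : countUpTo d (nthTime d m) = m + 1 := by
  apply le_antisymm
  · exact (hd.countUpTo_le _ hm).trans (Nat.succ_le_succ (h.ncard_lt_le hm))
  · exact (h.lt_nthTime_iff hm).1 le_rfl

theorem NoTies.nthTime_lt_succ {d : ι → ℝ≥0∞} (hd : NoTies d) (h : LocFinite d) {m : ℕ}
    (hm : nthTime d m < ⊤) : nthTime d m < nthTime d (m + 1) := by
  by_contra! hc
  have := (h.lt_nthTime_iff hm).1 hc
  rw [hd.countUpTo_nthTime h hm] at this
  exact lt_irrefl _ this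

/-- Without ties, the times in `(r, nthTime d m]`, where `r` is at least the time before, consist of
the `m`-th one. -/
theorem NoTies.existsUnique_eq_nthTime {d : ι → ℝ≥0∞} (hd : NoTies d) (h : LocFinite d) {m : ℕ}
    (hm : nthTime d m < ⊤) : ∃ p, d p = nthTime d m ∧ ∀ q, d q = nthTime d m → q = p := by
  have h1 := hd.countUpTo_nthTime h hm
  have h2 := h.ncard_lt_le hm
  have : ∃ p, d p = nthTime d m := by
    by_contra! hc
    have : {p | d p ≤ nthTime d m} = {p | d p < nthTime d m} := by
      ext p
      exact ⟨fun hp => lt_of_le_of_ne hp (hc p), fun hp => le_of_lt (a := d p) (b := nthTime d m) hp⟩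
    unfold countUpTo at h1
    rw [this] at h1
    omega
  obtain ⟨p, hp⟩ := this
  exact ⟨p, hp, fun q hq => hd q p (hq.trans hp.symm) (hq ▸ hm.ne)⟩

/-- The index is one less than the rank of the time, that is, the number of times up to it. -/
theorem LocFinite.exists_nthTime_eq {d : ι → ℝ≥0∞} (hd : NoTies d) (h : LocFinite d) {p : ι}
    (hp : d p < ⊤) : ∃ m, d p = nthTime d m ∧ countUpTo d (d p) = m + 1 := by
  have hpos : 0 < countUpTo d (d p) := by
    unfold countUpTo
    rw [Set.ncard_pos (h _ hp)]
    exact ⟨p, le_refl (d p)⟩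
  obtain ⟨m, hm⟩ : ∃ m, countUpTo d (d p) = m + 1 := ⟨_, (Nat.succ_pred_eq_of_pos hpos).symm⟩
  have hle : nthTime d m ≤ d p := (h.lt_nthTime_iff hp).2 (by omega)
  refine ⟨m, le_antisymm ?_ hle, hm⟩
  by_contra! hlt
  have h1 := hd.countUpTo_nthTime h (hlt.trans hp)
  have h2 : countUpTo d (nthTime d m) < countUpTo d (d p) := by
    refine Set.ncard_lt_ncard ?_ (h _ hp)
    refine ⟨fun q hq => le_trans hq hlt.le, fun hsub => ?_⟩
    exact absurd (hsub (le_refl (d p))) (not_le.2 hlt)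
  omega

end NthTime

/-! ### Deliveries and departures on a sample path -/

section Path

variable {n k : ℕ} {s : ℕ × Fin n → ℝ≥0∞} {x : ℕ × Fin n → ℝ} {a : ℕ → ℝ}

theorem numDelivered_eq (k : ℕ) (s : ℕ × Fin n → ℝ≥0∞) (x : ℕ × Fin n → ℝ) (t : ℝ≥0∞) :
    numDelivered k s x t = countUpTo (deliveryTime k s x) t := rfl

/-- The number of effective chunks of request `i` delivered up to time `t`. -/
noncomputable def reqCount (d : ℕ × Fin n → ℝ≥0∞) (t : ℝ≥0∞) (i : ℕ) : ℕ :=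
  {j : Fin n | d (i, j) ≤ t}.ncard

theorem le_deliveryTime (p : ℕ × Fin n) : finishTime s x p ≤ deliveryTime k s x p := by
  unfold deliveryTime
  split_ifs
  · exact le_rfl
  · exact le_top

theorem deliveryTime_eq_of_lt_top {p : ℕ × Fin n} (h : deliveryTime k s x p < ⊤) :
    deliveryTime k s x p = finishTime s x p ∧ finishTime s x p ≤ departureTime k s x p.1 := by
  unfold deliveryTime at h ⊢
  split_ifs at h ⊢ with h'
  · exact ⟨rfl, h'⟩
  · exact absurd h (lt_irrefl _)

theorem deliveryTime_eq_of_le {p : ℕ × Fin n} (h : finishTime s x p ≤ departureTime k s x p.1) :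
    deliveryTime k s x p = finishTime s x p := by
  unfold deliveryTime
  rw [if_pos h]

theorem locFinite_fin (d : Fin n → ℝ≥0∞) : LocFinite d := fun _ _ => Set.toFinite _

theorem departureTime_eq_nthTime (hk : 0 < k) (i : ℕ) :
    departureTime k s x i = nthTime (fun j : Fin n => finishTime s x (i, j)) (k - 1) := by
  unfold departureTime nthTime
  rw [Nat.sub_add_cancel hk]

/-- Up to the departure of the request, downloads and deliveries are the same. -/
theorem finishTime_le_iff {i : ℕ} {t : ℝ≥0∞} (ht : t ≤ departureTime k s x i)
    (j : Fin n) :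
    finishTime s x (i, j) ≤ t ↔ deliveryTime k s x (i, j) ≤ t := by
  constructor
  · intro h
    rw [deliveryTime_eq_of_le (p := (i, j)) (h.trans ht)]
    exact h
  · intro h
    exact (le_deliveryTime _).trans h

theorem le_reqCount_iff (hk : 0 < k) {i : ℕ} {t : ℝ≥0∞} (ht : t < ⊤) :
    k ≤ reqCount (deliveryTime k s x) t i ↔ departureTime k s x i ≤ t := by
  have key : ∀ u < ⊤, departureTime k s x i ≤ u ↔
      k ≤ {j : Fin n | finishTime s x (i, j) ≤ u}.ncard := by
    intro u hu
    rw [departureTime_eq_nthTime hk, (locFinite_fin _).lt_nthTime_iff hu]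
    unfold countUpTo
    beta_reduce
    omega
  constructor
  · intro h
    rw [key t ht]
    exact h.trans (Set.ncard_le_ncard fun j hj => (le_deliveryTime _).trans hj)
  · intro h
    have h1 := (key _ (h.trans_lt ht)).1 le_rfl
    refine h1.trans (Set.ncard_le_ncard fun j hj => ?_)
    exact ((finishTime_le_iff le_rfl j).1 hj).trans h

/-- Departures are a function of the delivery times alone. The dispatcher sees deliveries and not
potential finish times, so causality arguments need departures in this form. -/
theorem departureTime_eq_nthTime_deliveryTime (hk : 0 < k) (i : ℕ) :
    departureTime k s x i = nthTime (fun j : Fin n => deliveryTime k s x (i, j)) (k - 1) := by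
  have : ∀ t < ⊤, departureTime k s x i ≤ t ↔
      nthTime (fun j : Fin n => deliveryTime k s x (i, j)) (k - 1) ≤ t := by
    intro t ht
    rw [← le_reqCount_iff hk ht, (locFinite_fin _).lt_nthTime_iff ht]
    unfold countUpTo reqCount
    beta_reduce
    omega
  apply le_antisymm
  · rcases eq_or_ne (nthTime (fun j : Fin n => deliveryTime k s x (i, j)) (k - 1)) ⊤ with h | h
    · rw [h]; exact le_top
    · exact (this _ h.lt_top).2 le_rfl
  · rcases eq_or_ne (departureTime k s x i) ⊤ with h | h
    · rw [h]; exact le_top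
    · exact (this _ h.lt_top).1 le_rfl

theorem deliveryTime_le_departureTime {p : ℕ × Fin n} (h : deliveryTime k s x p < ⊤) :
    deliveryTime k s x p ≤ departureTime k s x p.1 := by
  obtain ⟨h1, h2⟩ := deliveryTime_eq_of_lt_top h
  rw [h1]; exact h2

theorem NoTies.fiber {d : ℕ × Fin n → ℝ≥0∞} (h : NoTies d) (i : ℕ) :
    NoTies fun j : Fin n => d (i, j) := fun _ _ h1 h2 => (Prod.ext_iff.1 (h _ _ h1 h2)).2

/-- Deliveries stop at the departure, and without ties a further delivery would come strictly after
the `k`-th one, which is the departure. -/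
theorem reqCount_le (hk : 0 < k) (hd : NoTies (deliveryTime k s x)) {t : ℝ≥0∞} (ht : t < ⊤)
    (i : ℕ) : reqCount (deliveryTime k s x) t i ≤ k := by
  by_contra! hc
  have h1 : nthTime (fun j : Fin n => deliveryTime k s x (i, j)) k ≤ t :=
    ((locFinite_fin _).lt_nthTime_iff ht).2 hc
  obtain ⟨j, hj, -⟩ := (hd.fiber i).existsUnique_eq_nthTime (locFinite_fin _) (h1.trans_lt ht)
  have h2 : deliveryTime k s x (i, j) < ⊤ := hj.trans_lt (h1.trans_lt ht)
  have h3 := deliveryTime_le_departureTime h2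
  have h4 : departureTime k s x i < nthTime (fun j : Fin n => deliveryTime k s x (i, j)) k := by
    rw [departureTime_eq_nthTime_deliveryTime hk]
    have h5 := (hd.fiber i).nthTime_lt_succ (locFinite_fin _) (m := k - 1)
      ((nthTime_mono _ (Nat.sub_le k 1)).trans_lt (h1.trans_lt ht))
    rwa [Nat.sub_add_cancel hk] at h5
  exact absurd (hj ▸ h3) (not_le.2 h4)

/-- What the analysis uses of a sample path: valid arrivals, positive downloading times, and
requests are served after their arrival. -/
structure IsPath (a : ℕ → ℝ) (s : ℕ × Fin n → ℝ≥0∞) (x : ℕ × Fin n → ℝ) : Prop where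
  valid : ValidArrivals a
  pos : ∀ p, 0 < x p
  le_start : ∀ p, ENNReal.ofReal (a p.1) ≤ s p

theorem ValidArrivals.finite (ha : ValidArrivals a) {t : ℝ≥0∞} (ht : t < ⊤) :
    {i | ENNReal.ofReal (a i) ≤ t}.Finite := by
  obtain ⟨N, hN⟩ := eventually_atTop.1 (ha.2.2.eventually_gt_atTop t.toReal)
  refine (Set.finite_lt_nat N).subset fun i hi => ?_
  by_contra! hc
  have h1 := hN i (not_lt.1 hc)
  have h2 : ENNReal.ofReal (a i) ≤ t := hi
  rw [ENNReal.ofReal_le_iff_le_toReal ht.ne] at h2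
  linarith

/-- The number of arrivals up to time `t`. -/
noncomputable def arrivalCount (a : ℕ → ℝ) (t : ℝ≥0∞) : ℕ :=
  {i | ENNReal.ofReal (a i) ≤ t}.ncard

theorem ValidArrivals.lt_arrivalCount_iff (ha : ValidArrivals a) {t : ℝ≥0∞} (ht : t < ⊤) (i : ℕ) :
    i < arrivalCount a t ↔ ENNReal.ofReal (a i) ≤ t := by
  have hfin := ha.finite ht
  unfold arrivalCount
  constructor
  · intro h
    by_contra! hc
    have : {i | ENNReal.ofReal (a i) ≤ t} ⊆ Set.Iio i := by
      intro j hj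
      by_contra! hij
      have h1 : ENNReal.ofReal (a i) ≤ ENNReal.ofReal (a j) :=
        ENNReal.ofReal_le_ofReal (ha.2.1 (not_lt.1 hij))
      exact absurd (h1.trans hj) (not_le.2 hc)
    have h3 := Set.ncard_le_ncard this (Set.finite_Iio i)
    rw [Set.ncard_eq_toFinset_card' (Set.Iio i)] at h3
    simp at h3
    omega
  · intro h
    have : Set.Iic i ⊆ {i | ENNReal.ofReal (a i) ≤ t} := fun j hj =>
      (ENNReal.ofReal_le_ofReal (ha.2.1 hj)).trans h
    have h3 := Set.ncard_le_ncard this hfin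
    rw [Set.ncard_eq_toFinset_card' (Set.Iic i)] at h3
    simp at h3
    omega

theorem IsPath.lt_finishTime (h : IsPath a s x) {p : ℕ × Fin n} (hp : s p < ⊤) :
    s p < finishTime s x p := by
  unfold finishTime
  exact ENNReal.lt_add_right hp.ne (by simp [h.pos p])

theorem IsPath.start_lt_of_finishTime_le (h : IsPath a s x) {p : ℕ × Fin n} {t : ℝ≥0∞}
    (hp : finishTime s x p ≤ t) (ht : t < ⊤) : s p < t := by
  refine (h.lt_finishTime ?_).trans_le hp
  exact lt_of_le_of_lt (by unfold finishTime; exact le_self_add) (hp.trans_lt ht)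

theorem IsPath.start_lt_deliveryTime (h : IsPath a s x) {p : ℕ × Fin n}
    (hp : deliveryTime k s x p < ⊤) : s p < deliveryTime k s x p :=
  h.start_lt_of_finishTime_le (le_deliveryTime p) hp

theorem IsPath.arrival_lt_deliveryTime (h : IsPath a s x) {p : ℕ × Fin n}
    (hp : deliveryTime k s x p < ⊤) : ENNReal.ofReal (a p.1) < deliveryTime k s x p :=
  (h.le_start p).trans_lt (h.start_lt_deliveryTime hp)

theorem finite_of_fst {t : ℝ≥0∞} (ha : ValidArrivals a) (ht : t < ⊤) :
    {p : ℕ × Fin n | ENNReal.ofReal (a p.1) ≤ t}.Finite := by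
  refine ((ha.finite ht).prod (Set.finite_univ (α := Fin n))).subset ?_
  intro p hp
  exact ⟨hp, Set.mem_univ _⟩

/-- A delivery comes after the arrival of its request; finitely many requests with `n` chunks each
have arrived by a finite time. -/
theorem IsPath.locFinite (h : IsPath a s x) : LocFinite (deliveryTime k s x) := by
  intro t ht
  refine (finite_of_fst h.valid ht).subset fun p hp => ?_
  have hp' : deliveryTime k s x p ≤ t := hp
  exact (h.arrival_lt_deliveryTime (hp'.trans_lt ht)).le.trans hp'

theorem IsPath.reqCount_eq_zero (h : IsPath a s x) {t : ℝ≥0∞} (ht : t < ⊤) {i : ℕ}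
    (hi : arrivalCount a t ≤ i) : reqCount (deliveryTime k s x) t i = 0 := by
  unfold reqCount
  rw [Set.ncard_eq_zero]
  rw [Set.eq_empty_iff_forall_notMem]
  intro j hj
  have hj' : deliveryTime k s x (i, j) ≤ t := hj
  have h1 := h.arrival_lt_deliveryTime (hj'.trans_lt ht)
  have h2 := (h.valid.lt_arrivalCount_iff ht i).2 (h1.le.trans hj')
  omega

theorem IsPath.countUpTo_eq_sum (h : IsPath a s x) {t : ℝ≥0∞} (ht : t < ⊤) :
    countUpTo (deliveryTime k s x) t =
      ∑ i ∈ Finset.range (arrivalCount a t), reqCount (deliveryTime k s x) t i := by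
  classical
  have hfin := h.locFinite (k := k) t ht
  unfold countUpTo
  rw [Set.ncard_eq_toFinset_card _ hfin]
  rw [Finset.card_eq_sum_card_fiberwise (f := Prod.fst) (t := Finset.range (arrivalCount a t))]
  · refine Finset.sum_congr rfl fun i _ => ?_
    unfold reqCount
    rw [Set.ncard_eq_toFinset_card', ← Finset.card_map ⟨fun j : Fin n => (i, j), fun _ _ h => by
      simpa using h⟩]
    congr 1
    ext ⟨i', j⟩
    simp only [Finset.mem_filter, Set.Finite.mem_toFinset, Set.mem_ofPred_eq, Finset.mem_map,
      Set.mem_toFinset]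
    constructor
    · rintro ⟨h1, rfl⟩; exact ⟨j, h1, rfl⟩
    · rintro ⟨j', h1, h2⟩
      obtain ⟨rfl, rfl⟩ := Prod.ext_iff.1 h2
      exact ⟨h1, rfl⟩
  · intro p hp
    have hp' : deliveryTime k s x p ≤ t := by simpa using hp
    simp only [Finset.coe_range, Set.mem_Iio]
    rw [h.valid.lt_arrivalCount_iff ht]
    exact (h.arrival_lt_deliveryTime (hp'.trans_lt ht)).le.trans hp'

theorem IsPath.departure_iff (h : IsPath a s x) {t : ℝ≥0∞} (ht : t < ⊤) (hk : 0 < k) {i : ℕ}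
    (hi : departureTime k s x i ≤ t) : i < arrivalCount a t := by
  by_contra! hc
  have := h.reqCount_eq_zero (k := k) ht hc
  have := (le_reqCount_iff hk ht).2 hi
  omega

theorem IsPath.mul_numDeparted_le (h : IsPath a s x) (hk : 0 < k) {t : ℝ≥0∞} (ht : t < ⊤) :
    k * numDeparted k s x t ≤ countUpTo (deliveryTime k s x) t := by
  classical
  rw [h.countUpTo_eq_sum ht]
  have : {i | departureTime k s x i ≤ t} =
      ↑((Finset.range (arrivalCount a t)).filter fun i => departureTime k s x i ≤ t) := by
    ext i
    simp only [Set.mem_ofPred_eq, Finset.coe_filter, Finset.mem_range]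
    exact ⟨fun hi => ⟨h.departure_iff ht hk hi, hi⟩, fun hi => hi.2⟩
  unfold numDeparted
  rw [this, Set.ncard_coe_finset, mul_comm, ← smul_eq_mul]
  refine (Finset.card_nsmul_le_sum _ _ k ?_).trans
    (Finset.sum_le_sum_of_subset (Finset.filter_subset _ _))
  intro i hi
  exact (le_reqCount_iff hk ht).2 (Finset.mem_filter.1 hi).2

/-- The requests in the system number at most the missing effective chunks. -/
theorem IsPath.card_inSystem_add_le (h : IsPath a s x) (hk : 0 < k)
    (hd : NoTies (deliveryTime k s x)) {t : ℝ≥0∞} (ht : t < ⊤) :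
    {i | InSystem k a s x t i}.ncard + countUpTo (deliveryTime k s x) t ≤
      k * arrivalCount a t := by
  classical
  have : {i | InSystem k a s x t i} =
      ↑((Finset.range (arrivalCount a t)).filter fun i => t < departureTime k s x i) := by
    ext i
    simp only [Set.mem_ofPred_eq, Finset.coe_filter, Finset.mem_range, InSystem,
      h.valid.lt_arrivalCount_iff ht]
  rw [this, Set.ncard_coe_finset, h.countUpTo_eq_sum ht, Finset.card_filter,
    ← Finset.sum_add_distrib]
  refine (Finset.sum_le_card_nsmul _ _ k fun i _ => ?_).trans (by simp [mul_comm])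
  have h1 := reqCount_le hk hd ht i
  have h2 := le_reqCount_iff (s := s) (x := x) (i := i) hk ht
  split_ifs with h3
  · rw [← not_le, ← h2] at h3; omega
  · omega

theorem IsPath.finite_inSystem (h : IsPath a s x) {t : ℝ≥0∞} (ht : t < ⊤) :
    {i | InSystem k a s x t i}.Finite := (h.valid.finite ht).subset fun _ hi => hi.1

/-- If fewer than `k` chunks per arrived request are delivered, some request is in the system. -/
theorem IsPath.exists_inSystem (h : IsPath a s x) (hk : 0 < k) {t : ℝ≥0∞} (ht : t < ⊤)
    {i : ℕ} (hi : ENNReal.ofReal (a i) ≤ t)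
    (hc : countUpTo (deliveryTime k s x) t < k * (i + 1)) :
    ∃ j ≤ i, InSystem k a s x t j := by
  by_contra! hno
  have hA : i < arrivalCount a t := (h.valid.lt_arrivalCount_iff ht i).2 hi
  rw [h.countUpTo_eq_sum ht] at hc
  have h1 : ∑ j ∈ Finset.range (i + 1), k ≤
      ∑ j ∈ Finset.range (i + 1), reqCount (deliveryTime k s x) t j := by
    refine Finset.sum_le_sum fun j hj => ?_
    rw [le_reqCount_iff hk ht]
    by_contra! hlt
    have hji : j ≤ i := Nat.lt_succ_iff.1 (Finset.mem_range.1 hj)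
    exact hno j hji ⟨(ENNReal.ofReal_le_ofReal (h.valid.2.1 hji)).trans hi, hlt⟩
  have h2 : ∑ j ∈ Finset.range (i + 1), reqCount (deliveryTime k s x) t j ≤
      ∑ j ∈ Finset.range (arrivalCount a t), reqCount (deliveryTime k s x) t j :=
    Finset.sum_le_sum_of_subset (Finset.range_mono hA)
  simp only [Finset.sum_const, Finset.card_range, smul_eq_mul] at h1
  rw [mul_comm] at h1
  omega

/-- Without ties, the `m`-th delivery takes place after the arrival of request `m / k`. -/
theorem IsPath.arrival_lt_nthTime (h : IsPath a s x) (hk : 0 < k)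
    (hd : NoTies (deliveryTime k s x)) (m : ℕ) :
    ENNReal.ofReal (a (m / k)) < nthTime (deliveryTime k s x) m ∨
      nthTime (deliveryTime k s x) m = ⊤ := by
  rcases eq_or_ne (nthTime (deliveryTime k s x) m) ⊤ with ht | ht
  · exact Or.inr ht
  left
  have ht' := ht.lt_top
  by_contra! hc
  have h1 := (h.locFinite (k := k)).lt_nthTime_iff ht' |>.1 le_rfl
  -- If the `m`-th delivery came no later than the arrival of request `m / k`, then up to that time
  -- only earlier requests, with at most `k` deliveries each, could contribute: at most `k * (m / k)
  -- ≤ m` deliveries instead of `m + 1`.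
  have h2 : ∀ i, reqCount (deliveryTime k s x) (nthTime (deliveryTime k s x) m) i ≠ 0 →
      i < m / k := by
    intro i hi
    by_contra! hmi
    apply hi
    unfold reqCount
    rw [Set.ncard_eq_zero, Set.eq_empty_iff_forall_notMem]
    intro j hj
    have hj' : deliveryTime k s x (i, j) ≤ nthTime (deliveryTime k s x) m := hj
    have h3 := h.arrival_lt_deliveryTime (hj'.trans_lt ht')
    exact absurd ((ENNReal.ofReal_le_ofReal (h.valid.2.1 hmi)).trans_lt (h3.trans_le hj'))
      (not_lt.2 hc)
  rw [h.countUpTo_eq_sum ht'] at h1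
  have h4 : ∑ i ∈ Finset.range (arrivalCount a (nthTime (deliveryTime k s x) m)),
      reqCount (deliveryTime k s x) (nthTime (deliveryTime k s x) m) i ≤
      ∑ i ∈ Finset.range (m / k), k := by
    rw [← Finset.sum_filter_ne_zero]
    refine (Finset.sum_le_sum fun i _ => reqCount_le hk hd ht' i).trans ?_
    refine Finset.sum_le_sum_of_subset fun i hi => ?_
    exact Finset.mem_range.2 (h2 i (Finset.mem_filter.1 hi).2)
  simp only [Finset.sum_const, Finset.card_range, smul_eq_mul] at h4
  have := Nat.div_mul_le_self m k
  omega

end Path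

/-! ### Causality -/

theorem min_eq_min_of_forall_lt {ι : Type*} {d d' : ι → ℝ≥0∞} {v : ℝ≥0∞}
    (h : ∀ u < v, ∀ q, d q = u ↔ d' q = u) (q : ι) : min (d q) v = min (d' q) v := by
  rcases lt_or_ge (d q) v with h1 | h1
  · rw [(h _ h1 q).1 rfl]
  · rcases lt_or_ge (d' q) v with h2 | h2
    · exact absurd ((h _ h2 q).2 rfl ▸ h2) (not_lt.2 h1)
    · rw [min_eq_right h1, min_eq_right h2]

theorem departureTime_lt_congr {n k : ℕ} (hk : 0 < k) {s s' : ℕ × Fin n → ℝ≥0∞}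
    {x x' : ℕ × Fin n → ℝ} {t : ℝ≥0∞}
    (h : ∀ q, min (deliveryTime k s x q) t = min (deliveryTime k s' x' q) t) (i : ℕ) :
    departureTime k s x i < t ↔ departureTime k s' x' i < t := by
  rw [departureTime_eq_nthTime_deliveryTime hk, departureTime_eq_nthTime_deliveryTime hk]
  exact nthTime_lt_congr (fun j => h (i, j)) _

namespace OnlineScheme

variable {L k n : ℕ} (S : OnlineScheme L k n)

/-- The delivery times of the chunks. -/
noncomputable def del (w : Input n) : ℕ × Fin n → ℝ≥0∞ := deliveryTime k (S.start w) w.2.1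

theorem isPath {w : Input n} (hw : ValidInput w) : IsPath w.1 (S.start w) w.2.1 :=
  ⟨hw.1, hw.2, S.arrival_le_start w hw⟩

/-- A chunk delivered at `v` is not `p`, which finishes later. It was started before `v`, so it has
the same start and downloading time in both runs. Its request has not departed before `v` in either,
as earlier departures are read off from earlier deliveries. -/
theorem del_transfer (hk : 0 < k) {w w' : Input n} (hw : ValidInput w)
    {p : ℕ × Fin n} (hx : ∀ q ≠ p, w.2.1 q = w'.2.1 q) {v : ℝ≥0∞}
    (hv : v < finishTime (S.start w) w.2.1 p)
    (hs : ∀ u < v, ∀ q, S.start w q = u ↔ S.start w' q = u)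
    (hd : ∀ u < v, ∀ q, S.del w q = u ↔ S.del w' q = u) {q : ℕ × Fin n} (hq : S.del w q = v) :
    S.del w' q = v := by
  have hvt : v < ⊤ := hv.trans_le le_top
  have hq' : deliveryTime k (S.start w) w.2.1 q < ⊤ := hq.trans_lt hvt
  obtain ⟨h1, h2⟩ := deliveryTime_eq_of_lt_top hq'
  have h3 : finishTime (S.start w) w.2.1 q = v := h1.symm.trans hq
  have hqp : q ≠ p := by
    rintro rfl
    exact lt_irrefl _ (h3 ▸ hv)
  have h4 : S.start w q < v := (S.isPath hw).start_lt_of_finishTime_le h3.le hvt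
  have h5 : S.start w' q = S.start w q := (hs _ h4 q).1 rfl
  have h6 : finishTime (S.start w') w'.2.1 q = v := by
    rw [← h3]; unfold finishTime; rw [h5, hx q hqp]
  have h7 : ¬ departureTime k (S.start w') w'.2.1 q.1 < v := by
    rw [← departureTime_lt_congr hk (fun r => min_eq_min_of_forall_lt hd r), ← h3]
    exact not_lt.2 h2
  have h8 : S.del w' q = finishTime (S.start w') w'.2.1 q :=
    deliveryTime_eq_of_le (h6 ▸ not_lt.1 h7)
  rw [h8, h6]

/-- Two inputs that differ only in the downloading time of the chunk `p` lead to the same starts and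
deliveries until the earlier of the two possible deliveries of `p`. -/
theorem agree_of_eq_off (hk : 0 < k) {w w' : Input n} (hw : ValidInput w) (hw' : ValidInput w')
    (ha : w.1 = w'.1) (hu : w.2.2 = w'.2.2) {p : ℕ × Fin n}
    (hx : ∀ q ≠ p, w.2.1 q = w'.2.1 q) {v : ℝ≥0∞}
    (hv : v < finishTime (S.start w) w.2.1 p) (hv' : v < finishTime (S.start w') w'.2.1 p)
    (q : ℕ × Fin n) :
    (S.start w q = v ↔ S.start w' q = v) ∧ (S.del w q = v ↔ S.del w' q = v) := by
  by_contra hbad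
  -- The times up to `v` at which the two runs differ. They are event times of requests that have
  -- arrived by `v`, hence finitely many, and the earliest one can be refuted.
  set B : Set ℝ≥0∞ := {u | u ≤ v ∧ ∃ q,
    ¬((S.start w q = u ↔ S.start w' q = u) ∧ (S.del w q = u ↔ S.del w' q = u))} with hB
  have hvB : v ∈ B := ⟨le_rfl, q, hbad⟩
  have hvt : v < ⊤ := hv.trans_le le_top
  have hP := S.isPath hw
  have hP' := S.isPath hw'
  have hAfin := finite_of_fst (n := n) hw.1 hvt
  have hBfin : B.Finite := by
    refine ((((hAfin.image (S.start w)).union (hAfin.image (S.start w'))).union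
      (hAfin.image (S.del w))).union (hAfin.image (S.del w'))).subset ?_
    rintro u ⟨huv, q, hq⟩
    have hut : u < ⊤ := huv.trans_lt hvt
    by_cases h1 : S.start w q = u
    · exact Or.inl (Or.inl (Or.inl ⟨q, (hP.le_start q).trans (h1.trans_le huv), h1⟩))
    by_cases h2 : S.start w' q = u
    · refine Or.inl (Or.inl (Or.inr ⟨q, ?_, h2⟩))
      have := (hP'.le_start q).trans (h2.trans_le huv)
      rwa [← ha] at this
    by_cases h3 : S.del w q = u
    · refine Or.inl (Or.inr ⟨q, ?_, h3⟩)
      exact (hP.arrival_lt_deliveryTime (k := k) (p := q) (h3.trans_lt hut)).le.trans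
        (h3.trans_le huv)
    by_cases h4 : S.del w' q = u
    · refine Or.inr ⟨q, ?_, h4⟩
      have := (hP'.arrival_lt_deliveryTime (k := k) (p := q) (h4.trans_lt hut)).le.trans
        (h4.trans_le huv)
      rwa [← ha] at this
    exact absurd ⟨⟨fun h => absurd h h1, fun h => absurd h h2⟩,
      ⟨fun h => absurd h h3, fun h => absurd h h4⟩⟩ hq
  obtain ⟨u, ⟨huv, q0, hq0⟩, hmin⟩ := Set.exists_min_image B id hBfin ⟨v, hvB⟩
  have hlt : ∀ u' < u, ∀ q, (S.start w q = u' ↔ S.start w' q = u') ∧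
      (S.del w q = u' ↔ S.del w' q = u') := by
    intro u' hu' q
    by_contra hc
    exact absurd (hmin u' ⟨hu'.le.trans huv, q, hc⟩) (not_le.2 hu')
  have hs := fun u' hu' q => (hlt u' hu' q).1
  have hd := fun u' hu' q => (hlt u' hu' q).2
  -- Deliveries at `u` come before starts at `u`: the dispatcher deciding at `u` already sees them,
  -- so they must agree before `S.online` can be applied.
  have hdu : ∀ q, S.del w q = u ↔ S.del w' q = u := fun q =>
    ⟨fun h => S.del_transfer hk hw hx (huv.trans_lt hv) hs hd h,
     fun h => S.del_transfer hk hw' (fun r hr => (hx r hr).symm) (huv.trans_lt hv')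
      (fun u' hu' r => (hs u' hu' r).symm) (fun u' hu' r => (hd u' hu' r).symm) h⟩
  have hsame : SameHistory k S.start u w w' := by
    refine ⟨hu, fun i _ => by rw [ha], ?_, ?_⟩
    · rintro r (h | h)
      · exact ((hs _ h r).1 rfl).symm
      · exact (hs _ h r).2 rfl
    · have hle : ∀ u' ≤ u, ∀ r, S.del w r = u' ↔ S.del w' r = u' := by
        intro u' hu' r
        rcases hu'.lt_or_eq with h | rfl
        · exact hd u' h r
        · exact hdu r
      rintro r (h | h)
      · exact ((hle _ h r).1 rfl).symm
      · exact (hle _ h r).2 rfl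
  exact hq0 ⟨S.online w w' hw hw' u hsame q0, hdu q0⟩

/-- The input with the downloading time of the chunk `p` replaced by `y`. -/
def upd (a : ℕ → ℝ) (x : ℕ × Fin n → ℝ) (u : unitInterval) (p : ℕ × Fin n) (y : ℝ) : Input n :=
  (a, Function.update x p y, u)

theorem validInput_upd {a : ℕ → ℝ} (ha : ValidArrivals a) {x : ℕ × Fin n → ℝ} (hx : ∀ q, 0 < x q)
    (u : unitInterval) (p : ℕ × Fin n) {y : ℝ} (hy : 0 < y) : ValidInput (upd a x u p y) := by
  refine ⟨ha, fun q => ?_⟩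
  by_cases hq : q = p
  · subst hq; simpa [upd] using hy
  · simpa [upd, hq] using hx q

section Upd

variable {a : ℕ → ℝ} {x : ℕ × Fin n → ℝ} {u : unitInterval} {p : ℕ × Fin n}

theorem finishTime_upd (y : ℝ) : finishTime (S.start (upd a x u p y)) (upd a x u p y).2.1 p =
    S.start (upd a x u p y) p + ENNReal.ofReal y := by
  simp [finishTime, upd]

/-- If the starts differed, the smaller one would precede both finish times of the chunk, where the
two runs still agree. -/
theorem start_upd (hk : 0 < k) (ha : ValidArrivals a) (hx : ∀ q, 0 < x q) {y y' : ℝ} (hy : 0 < y)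
    (hy' : 0 < y') : S.start (upd a x u p y) p = S.start (upd a x u p y') p := by
  have aux : ∀ {y y' : ℝ}, 0 < y → 0 < y' →
      ¬ S.start (upd a x u p y) p < S.start (upd a x u p y') p := by
    intro y y' hy hy' hlt
    have hf : S.start (upd a x u p y) p < finishTime (S.start (upd a x u p y))
        (upd a x u p y).2.1 p := by
      rw [finishTime_upd]
      exact ENNReal.lt_add_right (hlt.trans_le le_top).ne (by simpa using hy)
    have hf' : S.start (upd a x u p y) p < finishTime (S.start (upd a x u p y'))
        (upd a x u p y').2.1 p := by
      rw [finishTime_upd]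
      exact hlt.trans_le le_self_add
    have := ((S.agree_of_eq_off hk (validInput_upd ha hx u p hy) (validInput_upd ha hx u p hy')
      rfl rfl (p := p) (fun q hq => by simp [upd, hq]) hf hf' p).1).1 rfl
    exact absurd this hlt.ne'
  exact le_antisymm (not_lt.1 (aux hy' hy)) (not_lt.1 (aux hy hy'))

/-- As long as chunk `p` is running, the system cannot tell how much longer it will run. So whatever
is predictable at age `v` of the download is a function of `v`, not of the actual downloading time
`y`. -/
theorem min_del_upd (hk : 0 < k) (ha : ValidArrivals a) (hx : ∀ q, 0 < x q) {v y : ℝ} (hv : 0 < v)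
    (hvy : v ≤ y) (q : ℕ × Fin n) :
    min (S.del (upd a x u p y) q) (S.start (upd a x u p v) p + ENNReal.ofReal v) =
      min (S.del (upd a x u p v) q) (S.start (upd a x u p v) p + ENNReal.ofReal v) := by
  refine min_eq_min_of_forall_lt (fun t ht r => ?_) q
  have hy : 0 < y := hv.trans_le hvy
  refine (S.agree_of_eq_off hk (validInput_upd ha hx u p hy) (validInput_upd ha hx u p hv)
      rfl rfl (p := p) (fun q hq => by simp [upd, hq]) ?_ ?_ r).2
  · rw [finishTime_upd, S.start_upd hk ha hx hy hv]
    exact ht.trans_le (by gcongr)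
  · rw [finishTime_upd]; exact ht

end Upd

end OnlineScheme

/-! ### Exponential distributions and product measures -/

section Exp

variable {r : ℝ}

theorem lintegral_expMeasure {f : ℝ → ℝ≥0∞} (hf : Measurable f) :
    ∫⁻ y, f y ∂expMeasure r =
      ∫⁻ y in Set.Ioi 0, ENNReal.ofReal (r * Real.exp (-(r * y))) * f y := by
  have h1 : ∫⁻ y, f y ∂expMeasure r = ∫⁻ y, exponentialPDF r y * f y := by
    rw [show expMeasure r = volume.withDensity (exponentialPDF r) from rfl,
      lintegral_withDensity_eq_lintegral_mul _ (by
        exact (measurable_exponentialPDFReal r).ennreal_ofReal) hf]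
    rfl
  rw [h1, ← lintegral_indicator measurableSet_Ioi]
  refine lintegral_congr_ae ?_
  filter_upwards [Measure.ae_ne volume (0 : ℝ)] with y hy
  rcases lt_or_gt_of_ne hy with h | h
  · rw [exponentialPDF_of_neg h, Set.indicator_of_notMem (by simpa using h.le), zero_mul]
  · rw [exponentialPDF_of_nonneg h.le, Set.indicator_of_mem (by simpa using h)]

theorem expMeasure_Iic (hr : 0 < r) (x : ℝ) :
    expMeasure r (Set.Iic x) = ENNReal.ofReal (if 0 ≤ x then 1 - Real.exp (-(r * x)) else 0) := by
  have := isProbabilityMeasure_expMeasure hr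
  rw [← ofReal_cdf, cdf_expMeasure_eq hr]

theorem expMeasure_Ioi (hr : 0 < r) {x : ℝ} (hx : 0 ≤ x) :
    expMeasure r (Set.Ioi x) = ENNReal.ofReal (Real.exp (-(r * x))) := by
  have := isProbabilityMeasure_expMeasure hr
  rw [← Set.compl_Iic, prob_compl_eq_one_sub measurableSet_Iic, expMeasure_Iic hr, if_pos hx,
    ← ENNReal.ofReal_one, ← ENNReal.ofReal_sub _ (by
      have : Real.exp (-(r * x)) ≤ 1 := Real.exp_le_one_iff.2 (by nlinarith)
      linarith)]
  congr 1
  ring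

instance nullSingletonClass_expMeasure : NullSingletonClass (expMeasure r) := by
  rw [show expMeasure r = volume.withDensity (exponentialPDF r) from rfl]
  infer_instance

theorem expMeasure_Ici (hr : 0 < r) {x : ℝ} (hx : 0 ≤ x) :
    expMeasure r (Set.Ici x) = ENNReal.ofReal (Real.exp (-(r * x))) := by
  rw [← expMeasure_Ioi hr hx]
  exact measure_congr Ioi_ae_eq_Ici.symm

theorem ae_pos_expMeasure (hr : 0 < r) : ∀ᵐ y ∂expMeasure r, 0 < y := by
  rw [ae_iff]
  have : {y : ℝ | ¬ 0 < y} = Set.Iic 0 := by ext; simp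
  rw [this, expMeasure_Iic hr]
  simp

theorem ae_pos_infinitePi {ι : Type*} [Countable ι] (hr : 0 < r) :
    ∀ᵐ y ∂Measure.infinitePi fun _ : ι => expMeasure r, ∀ p, 0 < y p := by
  have := isProbabilityMeasure_expMeasure hr
  rw [ae_all_iff]
  intro p
  exact (measurePreserving_eval_infinitePi (fun _ : ι => expMeasure r) p).quasiMeasurePreserving.ae
    (ae_pos_expMeasure hr)

/-- Resampling one coordinate does not change a product measure. -/
theorem lintegral_infinitePi_update {ι : Type*} [DecidableEq ι] {ρ : Measure ℝ}
    [IsProbabilityMeasure ρ] (p : ι) {f : (ι → ℝ) → ℝ≥0∞} (hf : Measurable f) :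
    ∫⁻ x, f x ∂Measure.infinitePi (fun _ : ι => ρ) =
      ∫⁻ x, ∫⁻ y, f (Function.update x p y) ∂ρ ∂Measure.infinitePi (fun _ : ι => ρ) := by
  set P := Measure.infinitePi (fun _ : ι => ρ) with hP
  have hmeas : Measurable fun z : (ι → ℝ) × ℝ => Function.update z.1 p z.2 := by
    refine measurable_pi_lambda _ fun q => ?_
    by_cases hq : q = p
    · subst hq; simpa using measurable_snd
    · simp only [Function.update_apply, if_neg hq]
      exact (measurable_pi_apply q).comp measurable_fst
  have hmap : (P.prod ρ).map (fun z => Function.update z.1 p z.2) = P := by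
    refine Measure.eq_infinitePi _ fun s t ht => ?_
    have hms : MeasurableSet (Set.pi (s : Set ι) t) :=
      MeasurableSet.pi s.countable_toSet fun i _ => ht i
    rw [Measure.map_apply hmeas hms]
    have hpre : (fun z : (ι → ℝ) × ℝ => Function.update z.1 p z.2) ⁻¹' (Set.pi (s : Set ι) t) =
        Set.pi ((s.erase p : Finset ι) : Set ι) t ×ˢ (if p ∈ s then t p else Set.univ) := by
      ext ⟨x, y⟩
      simp only [Set.mem_preimage, Set.mem_pi, Finset.mem_coe, Set.mem_prod, Finset.mem_erase]
      constructor
      · intro h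
        refine ⟨fun i hi => by simpa [hi.1] using h i hi.2, ?_⟩
        split_ifs with hp
        · simpa using h p hp
        · exact Set.mem_univ _
      · rintro ⟨h1, h2⟩ i hi
        by_cases hip : i = p
        · subst hip; simpa [hi] using h2
        · simpa [hip] using h1 i ⟨hip, hi⟩
    rw [hpre, Measure.prod_prod, hP, Measure.infinitePi_pi _ fun i _ => ht i]
    split_ifs with hp
    · rw [Finset.prod_erase_mul _ _ hp]
    · rw [Finset.erase_eq_of_notMem hp, measure_univ, mul_one]
  calc ∫⁻ x, f x ∂P = ∫⁻ x, f x ∂((P.prod ρ).map fun z => Function.update z.1 p z.2) := by rw [hmap]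
    _ = ∫⁻ z, f (Function.update z.1 p z.2) ∂(P.prod ρ) := lintegral_map hf hmeas
    _ = _ := lintegral_prod _ (hf.comp hmeas).aemeasurable

end Exp

/-! ### Measurability of finish, departure and delivery times -/

theorem measurable_finishTime {n : ℕ} {Ω : Type*} [MeasurableSpace Ω]
    {s : Ω → ℕ × Fin n → ℝ≥0∞} {x : Ω → ℕ × Fin n → ℝ} (hs : Measurable s) (hx : Measurable x)
    (p : ℕ × Fin n) : Measurable fun ω => finishTime (s ω) (x ω) p := by
  unfold finishTime
  exact ((measurable_pi_apply p).comp hs).add ((measurable_pi_apply p).comp hx).ennreal_ofReal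

theorem measurable_departureTime {n k : ℕ} (hk : 0 < k) {Ω : Type*} [MeasurableSpace Ω]
    {s : Ω → ℕ × Fin n → ℝ≥0∞} {x : Ω → ℕ × Fin n → ℝ} (hs : Measurable s) (hx : Measurable x)
    (i : ℕ) : Measurable fun ω => departureTime k (s ω) (x ω) i := by
  simp only [departureTime_eq_nthTime hk]
  exact (measurable_nthTime _).comp
    (measurable_pi_lambda _ fun j => measurable_finishTime hs hx (i, j))

theorem measurable_deliveryTime {n k : ℕ} (hk : 0 < k) {Ω : Type*} [MeasurableSpace Ω]
    {s : Ω → ℕ × Fin n → ℝ≥0∞} {x : Ω → ℕ × Fin n → ℝ} (hs : Measurable s) (hx : Measurable x) :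
    Measurable fun ω => deliveryTime k (s ω) (x ω) := by
  refine measurable_pi_lambda _ fun p => ?_
  unfold deliveryTime
  exact Measurable.ite (measurableSet_le (measurable_finishTime hs hx p)
    (measurable_departureTime hk hs hx p.1)) (measurable_finishTime hs hx p) measurable_const

/-- A quantity that at time `t` depends only on the times before `t`. -/
def Predictable {ι : Type*} (Z : (ι → ℝ≥0∞) → ℝ≥0∞ → ℝ≥0∞) : Prop :=
  ∀ d d' t, (∀ q, min (d q) t = min (d' q) t) → Z d t = Z d' t

/-- The law of the downloading times. -/
noncomputable abbrev expLaw (n : ℕ) (μ : ℝ) : Measure (ℕ × Fin n → ℝ) :=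
  Measure.infinitePi fun _ : ℕ × Fin n => expMeasure μ

/-! ### Intensity of the delivery of a single chunk -/

namespace OnlineScheme

variable {L k n : ℕ} (S : OnlineScheme L k n)

theorem measurable_start' : Measurable S.start := measurable_pi_lambda _ S.measurable_start

theorem measurable_del (hk : 0 < k) : Measurable S.del :=
  measurable_deliveryTime hk S.measurable_start' (measurable_fst.comp measurable_snd)

theorem measurable_dep (hk : 0 < k) (i : ℕ) :
    Measurable fun w : Input n => departureTime k (S.start w) w.2.1 i :=
  measurable_departureTime hk S.measurable_start' (measurable_fst.comp measurable_snd) i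

/-- The chunk `p` is being downloaded just before time `t`. -/
def busyBefore (w : Input n) (p : ℕ × Fin n) (t : ℝ≥0∞) : Prop :=
  S.start w p < t ∧ t ≤ finishTime (S.start w) w.2.1 p ∧
    t ≤ departureTime k (S.start w) w.2.1 p.1

theorem measurableSet_busyBefore (hk : 0 < k) (p : ℕ × Fin n) :
    MeasurableSet {z : Input n × ℝ≥0∞ | S.busyBefore z.1 p z.2} := by
  have h1 : Measurable fun z : Input n × ℝ≥0∞ => S.start z.1 p :=
    (S.measurable_start p).comp measurable_fst
  have h2 : Measurable fun z : Input n × ℝ≥0∞ => finishTime (S.start z.1) z.1.2.1 p :=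
    (measurable_finishTime S.measurable_start' (measurable_fst.comp measurable_snd) p).comp
      measurable_fst
  have h3 : Measurable fun z : Input n × ℝ≥0∞ => departureTime k (S.start z.1) z.1.2.1 p.1 :=
    (S.measurable_dep hk p.1).comp measurable_fst
  exact (measurableSet_lt h1 measurable_snd).inter
    ((measurableSet_le measurable_snd h2).inter (measurableSet_le measurable_snd h3))

open Classical in
/-- Each chunk is delivered at rate `μ` while it is downloaded. -/
theorem lintegral_delivery_eq_of_chunk (hk : 0 < k) {μ : ℝ} (hμ : 0 < μ) {a : ℕ → ℝ}
    (ha : ValidArrivals a) (u : unitInterval) {Z : (ℕ × Fin n → ℝ≥0∞) → ℝ≥0∞ → ℝ≥0∞}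
    (hZ : Measurable (Function.uncurry Z)) (hpred : Predictable Z) (p : ℕ × Fin n) :
    ∫⁻ x, (if S.del (a, x, u) p = ⊤ then 0 else Z (S.del (a, x, u)) (S.del (a, x, u) p))
        ∂expLaw n μ =
      ∫⁻ x, (∫⁻ t : ℝ, ENNReal.ofReal μ * (if S.busyBefore (a, x, u) p (ENNReal.ofReal t) then
        Z (S.del (a, x, u)) (ENNReal.ofReal t) else 0)) ∂expLaw n μ := by
  have := isProbabilityMeasure_expMeasure hμ
  have hin : Measurable fun x : ℕ × Fin n → ℝ => ((a, x, u) : Input n) :=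
    measurable_const.prodMk (measurable_id.prodMk measurable_const)
  have hdel : Measurable fun x : ℕ × Fin n → ℝ => S.del (a, x, u) := (S.measurable_del hk).comp hin
  have hdelp : Measurable fun x : ℕ × Fin n → ℝ => S.del (a, x, u) p :=
    (measurable_pi_apply p).comp hdel
  have hL : Measurable fun x : ℕ × Fin n → ℝ =>
      (if S.del (a, x, u) p = ⊤ then 0 else Z (S.del (a, x, u)) (S.del (a, x, u) p)) :=
    Measurable.ite (hdelp (measurableSet_singleton ⊤)) measurable_const
      (hZ.comp (hdel.prodMk hdelp))
  have hR2 : Measurable fun z : (ℕ × Fin n → ℝ) × ℝ =>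
      ENNReal.ofReal μ * (if S.busyBefore (a, z.1, u) p (ENNReal.ofReal z.2) then
        Z (S.del (a, z.1, u)) (ENNReal.ofReal z.2) else 0) := by
    refine Measurable.const_mul (Measurable.ite ?_ ?_ measurable_const) _
    · exact ((hin.comp measurable_fst).prodMk measurable_snd.ennreal_ofReal)
        (S.measurableSet_busyBefore hk p)
    · exact hZ.comp ((hdel.comp measurable_fst).prodMk measurable_snd.ennreal_ofReal)
  have hR : Measurable fun x : ℕ × Fin n → ℝ => ∫⁻ t : ℝ,
      ENNReal.ofReal μ * (if S.busyBefore (a, x, u) p (ENNReal.ofReal t) then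
        Z (S.del (a, x, u)) (ENNReal.ofReal t) else 0) := hR2.lintegral_prod_right'
  -- All downloading times but that of `p` are frozen, and the identity is proved for the integral
  -- over the single exponential variable of `p`.
  rw [lintegral_infinitePi_update p hL, lintegral_infinitePi_update p hR]
  refine lintegral_congr_ae ?_
  filter_upwards [ae_pos_infinitePi (ι := ℕ × Fin n) hμ] with x hx
  change ∫⁻ y, (if S.del (upd a x u p y) p = ⊤ then 0 else
      Z (S.del (upd a x u p y)) (S.del (upd a x u p y) p)) ∂expMeasure μ =
    ∫⁻ y, (∫⁻ t : ℝ, ENNReal.ofReal μ * (if S.busyBefore (upd a x u p y) p (ENNReal.ofReal t) then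
      Z (S.del (upd a x u p y)) (ENNReal.ofReal t) else 0)) ∂expMeasure μ
  set s := S.start (upd a x u p 1) p with hs
  have hstart : ∀ y, 0 < y → S.start (upd a x u p y) p = s := fun y hy =>
    S.start_upd hk ha hx hy one_pos
  have hfin : ∀ y, 0 < y → finishTime (S.start (upd a x u p y)) (upd a x u p y).2.1 p =
      s + ENNReal.ofReal y := fun y hy => by rw [S.finishTime_upd, hstart y hy]
  -- A chunk that is never started contributes zero on both sides.
  rcases eq_or_ne s ⊤ with hst | hst
  · refine lintegral_congr_ae ?_
    filter_upwards [ae_pos_expMeasure hμ] with y hy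
    have h1 : S.del (upd a x u p y) p = ⊤ := by
      refine top_unique ((le_of_eq ?_).trans (le_deliveryTime p))
      rw [hfin y hy, hst, top_add]
    rw [if_pos h1]
    symm
    rw [lintegral_eq_zero_iff' (by
      exact ((hR2.comp ((measurable_const (a := Function.update x p y)).prodMk
        measurable_id)).aemeasurable))]
    refine Eventually.of_forall fun t => ?_
    have : ¬ S.busyBefore (upd a x u p y) p (ENNReal.ofReal t) := by
      rintro ⟨h, -⟩
      rw [hstart y hy, hst] at h
      exact not_top_lt h
    simp [this]
  obtain ⟨s0, hs0, hss⟩ : ∃ s0 : ℝ, 0 ≤ s0 ∧ s = ENNReal.ofReal s0 :=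
    ⟨s.toReal, ENNReal.toReal_nonneg, (ENNReal.ofReal_toReal hst).symm⟩
  have hupdm : Measurable fun v : ℝ => Function.update x p v := measurable_update x
  have hin' : Measurable fun v : ℝ => upd a x u p v := hin.comp hupdm
  -- The value of `Z` at age `v` of the download, in the run where the downloading time is exactly
  -- `v`, and zero if the request has departed before that age.
  set h : ℝ → ℝ≥0∞ := fun v =>
    if ENNReal.ofReal (s0 + v) ≤ departureTime k (S.start (upd a x u p v)) (upd a x u p v).2.1 p.1
    then Z (S.del (upd a x u p v)) (ENNReal.ofReal (s0 + v)) else 0 with hh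
  have hhm : Measurable h := by
    have h1 : Measurable fun v : ℝ => ENNReal.ofReal (s0 + v) :=
      (measurable_const.add measurable_id).ennreal_ofReal
    refine Measurable.ite (measurableSet_le h1 ((S.measurable_dep hk p.1).comp hin')) ?_
      measurable_const
    exact hZ.comp (((S.measurable_del hk).comp hin').prodMk h1)
  have hadd : ∀ v, 0 < v → s + ENNReal.ofReal v = ENNReal.ofReal (s0 + v) := fun v hv => by
    rw [hss, ENNReal.ofReal_add hs0 hv.le]
  have hLeq : ∀ y, 0 < y → (if S.del (upd a x u p y) p = ⊤ then 0 else
      Z (S.del (upd a x u p y)) (S.del (upd a x u p y) p)) = h y := by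
    intro y hy
    simp only [hh]
    by_cases hc : ENNReal.ofReal (s0 + y) ≤
        departureTime k (S.start (upd a x u p y)) (upd a x u p y).2.1 p.1
    · have h1 : S.del (upd a x u p y) p = ENNReal.ofReal (s0 + y) := by
        rw [← hadd y hy, ← hfin y hy]
        refine deliveryTime_eq_of_le ?_
        rw [hfin y hy, hadd y hy]; exact hc
      rw [if_pos hc, h1, if_neg ENNReal.ofReal_ne_top]
    · have h1 : S.del (upd a x u p y) p = ⊤ := by
        unfold del deliveryTime
        rw [if_neg]
        rw [hfin y hy, hadd y hy]; exact hc
      rw [if_pos h1, if_neg hc]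
  -- With `t = s0 + v`, the chunk is busy at age `v` exactly if `v ≤ y` and the request is still
  -- present; both this and `Z` are the same for all downloading times `y ≥ v`.
  have hReq : ∀ y, 0 < y → ∫⁻ t : ℝ, ENNReal.ofReal μ *
      (if S.busyBefore (upd a x u p y) p (ENNReal.ofReal t) then
        Z (S.del (upd a x u p y)) (ENNReal.ofReal t) else 0) =
      ∫⁻ v in Set.Ioi 0, (if v ≤ y then ENNReal.ofReal μ * h v else 0) := by
    intro y hy
    rw [← lintegral_add_left_eq_self _ s0, ← lintegral_indicator measurableSet_Ioi]
    refine lintegral_congr fun v => ?_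
    by_cases hv : 0 < v
    · rw [Set.indicator_of_mem (by simpa using hv)]
      by_cases hvy : v ≤ y
      · have hmin := fun q => S.min_del_upd hk ha hx (u := u) (p := p) hv hvy q
        rw [hstart v hv, hadd v hv] at hmin
        have hdep := not_congr (departureTime_lt_congr hk hmin p.1)
        rw [not_lt, not_lt] at hdep
        have hb : S.busyBefore (upd a x u p y) p (ENNReal.ofReal (s0 + v)) ↔
            ENNReal.ofReal (s0 + v) ≤
              departureTime k (S.start (upd a x u p v)) (upd a x u p v).2.1 p.1 := by
          unfold busyBefore
          rw [hstart y hy, hfin y hy, hdep, ← hadd v hv]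
          refine ⟨fun h => h.2.2, fun h => ⟨?_, by gcongr, h⟩⟩
          exact ENNReal.lt_add_right hst (by simpa using hv)
        rw [if_pos hvy]
        simp only [hb, hh, hpred _ _ _ hmin]
      · have hb : ¬ S.busyBefore (upd a x u p y) p (ENNReal.ofReal (s0 + v)) := by
          rintro ⟨-, h2, -⟩
          rw [hfin y hy, hadd y hy, ENNReal.ofReal_le_ofReal_iff (by linarith)] at h2
          linarith
        rw [if_neg hvy, if_neg hb, mul_zero]
    · rw [Set.indicator_of_notMem (by simpa using hv)]
      have hb : ¬ S.busyBefore (upd a x u p y) p (ENNReal.ofReal (s0 + v)) := by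
        rintro ⟨h2, -⟩
        rw [hstart y hy, hss] at h2
        exact absurd (ENNReal.ofReal_le_ofReal (by linarith : s0 + v ≤ s0)) (not_le.2 h2)
      rw [if_neg hb, mul_zero]
  calc ∫⁻ y, (if S.del (upd a x u p y) p = ⊤ then 0 else
        Z (S.del (upd a x u p y)) (S.del (upd a x u p y) p)) ∂expMeasure μ
      = ∫⁻ y, h y ∂expMeasure μ := by
        refine lintegral_congr_ae ?_
        filter_upwards [ae_pos_expMeasure hμ] with y hy using hLeq y hy
    _ = ∫⁻ v in Set.Ioi 0, ENNReal.ofReal (μ * Real.exp (-(μ * v))) * h v :=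
        lintegral_expMeasure hhm
    -- The density of the exponential law at `v` is `μ` times the probability of exceeding `v`; this
    -- constancy of the hazard rate is the only property of the law used here.
    _ = ∫⁻ v in Set.Ioi (0 : ℝ), ∫⁻ y, (if v ≤ y then ENNReal.ofReal μ * h v else 0) ∂expMeasure μ := by
        refine setLIntegral_congr_fun measurableSet_Ioi fun v hv => ?_
        have hv' : (0 : ℝ) < v := hv
        have : (fun y : ℝ => if v ≤ y then ENNReal.ofReal μ * h v else 0) =
            (Set.Ici v).indicator fun _ => ENNReal.ofReal μ * h v := by
          ext y; simp [Set.indicator_apply]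
        rw [this, lintegral_indicator measurableSet_Ici, setLIntegral_const,
          expMeasure_Ici hμ hv'.le, ENNReal.ofReal_mul hμ.le]
        ring
    _ = ∫⁻ y, (∫⁻ v in Set.Ioi (0 : ℝ), (if v ≤ y then ENNReal.ofReal μ * h v else 0))
        ∂expMeasure μ := by
        refine lintegral_lintegral_swap (Measurable.aemeasurable ?_)
        exact Measurable.ite (measurableSet_le measurable_fst measurable_snd)
          ((hhm.comp measurable_fst).const_mul _) measurable_const
    _ = _ := by
        refine lintegral_congr_ae ?_
        filter_upwards [ae_pos_expMeasure hμ] with y hy using (hReq y hy).symm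

end OnlineScheme

/-! ### The successive deliveries -/

/-- The time from which the server works on the `m`-th delivery: the previous delivery or the
arrival of request `m / k`, whichever is later. -/
noncomputable def readyTime {ι : Type*} (k : ℕ) (a : ℕ → ℝ) (d : ι → ℝ≥0∞) : ℕ → ℝ≥0∞
  | 0 => ENNReal.ofReal (a 0)
  | m + 1 => max (nthTime d m) (ENNReal.ofReal (a ((m + 1) / k)))

theorem arrival_le_readyTime {ι : Type*} (k : ℕ) (a : ℕ → ℝ) (d : ι → ℝ≥0∞) (m : ℕ) :
    ENNReal.ofReal (a (m / k)) ≤ readyTime k a d m := by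
  cases m with
  | zero => simp [readyTime]
  | succ m => exact le_max_right _ _

theorem nthTime_le_readyTime {ι : Type*} (k : ℕ) (a : ℕ → ℝ) (d : ι → ℝ≥0∞) {l m : ℕ}
    (h : l < m) : nthTime d l ≤ readyTime k a d m := by
  cases m with
  | zero => omega
  | succ m => exact (nthTime_mono d (by omega)).trans (le_max_left _ _)

/-- Arrivals are fixed, so before `t` the ready time is determined by the deliveries before `t`.
With `history_eq_of_lt` this makes test functions of the past predictable. -/
theorem readyTime_lt_congr {ι : Type*} {k : ℕ} {a : ℕ → ℝ} {d d' : ι → ℝ≥0∞} {t : ℝ≥0∞}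
    (h : ∀ p, min (d p) t = min (d' p) t) (m : ℕ) :
    readyTime k a d m < t ↔ readyTime k a d' m < t := by
  cases m with
  | zero => rfl
  | succ m => simp only [readyTime, max_lt_iff, nthTime_lt_congr h m]

theorem readyTime_eq_of_lt {ι : Type*} {k : ℕ} {a : ℕ → ℝ} {d d' : ι → ℝ≥0∞} {t : ℝ≥0∞}
    (h : ∀ p, min (d p) t = min (d' p) t) {m : ℕ} (hm : readyTime k a d m < t) :
    readyTime k a d m = readyTime k a d' m := by
  cases m with
  | zero => rfl
  | succ m =>
    simp only [readyTime]
    rw [nthTime_eq_of_lt h ((le_max_left _ _).trans_lt hm)]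

/-- The times before the `m`-th one. -/
noncomputable def history {ι : Type*} (d : ι → ℝ≥0∞) (m : ℕ) : ℕ → ℝ≥0∞ :=
  fun l => if l < m then nthTime d l else 0

theorem history_eq_of_lt {ι : Type*} {k : ℕ} {a : ℕ → ℝ} {d d' : ι → ℝ≥0∞} {t : ℝ≥0∞}
    (h : ∀ p, min (d p) t = min (d' p) t) {m : ℕ} (hm : readyTime k a d m < t) :
    history d m = history d' m := by
  ext l
  unfold history
  split_ifs with hl
  · exact nthTime_eq_of_lt h ((nthTime_le_readyTime k a d hl).trans_lt hm)
  · rfl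

theorem measurable_history {ι : Type*} [Countable ι] (m : ℕ) :
    Measurable fun d : ι → ℝ≥0∞ => history d m := by
  refine measurable_pi_lambda _ fun l => ?_
  unfold history
  split_ifs
  · exact measurable_nthTime l
  · exact measurable_const

theorem measurable_readyTime {ι : Type*} [Countable ι] (k m : ℕ) :
    Measurable fun z : (ℕ → ℝ) × (ι → ℝ≥0∞) => readyTime k z.1 z.2 m := by
  cases m with
  | zero => exact ((measurable_pi_apply 0).comp measurable_fst).ennreal_ofReal
  | succ m =>
    exact ((measurable_nthTime m).comp measurable_snd).max
      ((measurable_pi_apply _).comp measurable_fst).ennreal_ofReal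

theorem IsPath.readyTime_lt {n k : ℕ} {a : ℕ → ℝ} {s : ℕ × Fin n → ℝ≥0∞} {x : ℕ × Fin n → ℝ}
    (h : IsPath a s x) (hk : 0 < k) (hd : NoTies (deliveryTime k s x)) {m : ℕ}
    (hm : nthTime (deliveryTime k s x) m < ⊤) :
    readyTime k a (deliveryTime k s x) m < nthTime (deliveryTime k s x) m := by
  have h1 := (h.arrival_lt_nthTime hk hd m).resolve_right hm.ne
  cases m with
  | zero => simpa [readyTime] using h1
  | succ m =>
    exact max_lt (hd.nthTime_lt_succ h.locFinite
      ((nthTime_mono _ (Nat.le_succ m)).trans_lt hm)) h1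

/-- All earlier deliveries occur by the ready time, so the window from there to the `m`-th delivery
contains only that delivery. -/
theorem eq_nthTime_of_readyTime_lt {ι : Type*} {k : ℕ} {a : ℕ → ℝ} {d : ι → ℝ≥0∞}
    (hd : NoTies d) (h : LocFinite d) {m : ℕ} {p : ι} (hp : d p < ⊤)
    (h1 : readyTime k a d m < d p) (h2 : d p ≤ nthTime d m) : d p = nthTime d m := by
  obtain ⟨m', hm', -⟩ := h.exists_nthTime_eq hd hp
  refine le_antisymm h2 ?_
  rw [hm']
  refine nthTime_mono d ?_
  by_contra! hlt
  exact absurd (hm'.trans_le (nthTime_le_readyTime k a d hlt)) (not_le.2 h1)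

theorem tsum_ite_mem_of_finite {ι : Type*} {A : Set ι} (hA : A.Finite) (c : ℝ≥0∞)
    [DecidablePred (· ∈ A)] : ∑' p, (if p ∈ A then c else 0) = A.ncard * c := by
  rw [tsum_eq_sum (s := hA.toFinset) (fun p hp => if_neg (by simpa using hp))]
  rw [Finset.sum_congr rfl (fun p hp => if_pos (by simpa using hp)), Finset.sum_const,
    nsmul_eq_mul, Set.ncard_eq_toFinset_card _ hA]

/-! ### Absence of ties, active threads and the intensity of the `m`-th delivery -/

namespace OnlineScheme

variable {L k n : ℕ} (S : OnlineScheme L k n)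

/-- With all other downloading times frozen, a tie of `p` with `q` occurs for at most one
downloading time of `p`. Indeed `q` was started before the tie, so it starts and finishes at the
same time for any larger value, while the finish of `p` moves. Single values are null for the
exponential law. -/
theorem ae_noTies (hk : 0 < k) {μ : ℝ} (hμ : 0 < μ) {a : ℕ → ℝ} (ha : ValidArrivals a)
    (u : unitInterval) : ∀ᵐ x ∂expLaw n μ, NoTies (S.del (a, x, u)) := by
  have := isProbabilityMeasure_expMeasure hμ
  have hin : Measurable fun x : ℕ × Fin n → ℝ => ((a, x, u) : Input n) :=
    measurable_const.prodMk (measurable_id.prodMk measurable_const)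
  have hdelp : ∀ p, Measurable fun x : ℕ × Fin n → ℝ => S.del (a, x, u) p := fun p =>
    (measurable_pi_apply p).comp ((S.measurable_del hk).comp hin)
  suffices h : ∀ p q, p ≠ q → ∀ᵐ x ∂expLaw n μ,
      ¬(S.del (a, x, u) p = S.del (a, x, u) q ∧ S.del (a, x, u) p ≠ ⊤) by
    have h' : ∀ᵐ x ∂expLaw n μ, ∀ p q, p ≠ q →
        ¬(S.del (a, x, u) p = S.del (a, x, u) q ∧ S.del (a, x, u) p ≠ ⊤) := by
      rw [ae_all_iff]; intro p
      rw [ae_all_iff]; intro q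
      by_cases hpq : p = q
      · simp [hpq]
      · filter_upwards [h p q hpq] with x hx _ using hx
    filter_upwards [h'] with x hx p q h1 h2
    by_contra hne
    exact hx p q hne ⟨h1, h2⟩
  intro p q hpq
  set B : Set (ℕ × Fin n → ℝ) :=
    {x | S.del (a, x, u) p = S.del (a, x, u) q ∧ S.del (a, x, u) p ≠ ⊤} with hB
  have hBm : MeasurableSet B := (measurableSet_eq_fun (hdelp p) (hdelp q)).inter
    ((hdelp p) (measurableSet_singleton ⊤).compl)
  rw [ae_iff]
  simp only [not_not]
  change (expLaw n μ) B = 0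
  rw [← lintegral_indicator_one hBm, lintegral_infinitePi_update p (measurable_one.indicator hBm)]
  rw [lintegral_eq_zero_iff' (by
    refine Measurable.aemeasurable (Measurable.lintegral_prod_right' (f := fun z :
      (ℕ × Fin n → ℝ) × ℝ => B.indicator 1 (Function.update z.1 p z.2)) ?_)
    refine (measurable_one.indicator hBm).comp (measurable_pi_lambda _ fun r => ?_)
    by_cases hr : r = p
    · subst hr; simpa using measurable_snd
    · simp only [Function.update_apply, if_neg hr]
      exact (measurable_pi_apply r).comp measurable_fst)]
  filter_upwards [ae_pos_infinitePi (ι := ℕ × Fin n) hμ] with x hx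
  set C : Set ℝ := {y | 0 < y ∧ Function.update x p y ∈ B} with hC
  have haux : ∀ y y', 0 < y → y < y' → Function.update x p y ∈ B →
      Function.update x p y' ∈ B → False := by
    intro y y' hy hyy h1 h2
    have hy' := hy.trans hyy
    obtain ⟨h1a, h1b⟩ : S.del (upd a x u p y) p = S.del (upd a x u p y) q ∧
      S.del (upd a x u p y) p ≠ ⊤ := h1
    obtain ⟨h2a, h2b⟩ : S.del (upd a x u p y') p = S.del (upd a x u p y') q ∧
      S.del (upd a x u p y') p ≠ ⊤ := h2
    have hs := S.start_upd hk ha hx (u := u) (p := p) hy hy'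
    have e1 := (deliveryTime_eq_of_lt_top h1b.lt_top).1
    rw [S.finishTime_upd] at e1
    have e2 := (deliveryTime_eq_of_lt_top h2b.lt_top).1
    rw [S.finishTime_upd, ← hs] at e2
    have f1 := (deliveryTime_eq_of_lt_top (h1a.symm.trans_lt h1b.lt_top)).1
    have f2 := (deliveryTime_eq_of_lt_top (h2a.symm.trans_lt h2b.lt_top)).1
    have hv1 := validInput_upd ha hx u p hy
    have hv2 := validInput_upd ha hx u p hy'
    have hlt : S.start (upd a x u p y) q < S.del (upd a x u p y) q :=
      (S.isPath hv1).start_lt_deliveryTime (h1a.symm.trans_lt h1b.lt_top)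
    have hlt' : S.start (upd a x u p y) q < S.start (upd a x u p y) p + ENNReal.ofReal y := by
      rw [← e1]; exact hlt.trans_le h1a.ge
    have hagree := ((S.agree_of_eq_off hk hv1 hv2 rfl rfl (p := p)
      (fun r hr => by simp [upd, hr]) (v := S.start (upd a x u p y) q)
      (by rw [S.finishTime_upd]; exact hlt')
      (by rw [S.finishTime_upd, ← hs]; exact hlt'.trans_le (by gcongr)) q).1).1 rfl
    have hfin : finishTime (S.start (upd a x u p y')) (upd a x u p y').2.1 q =
        finishTime (S.start (upd a x u p y)) (upd a x u p y).2.1 q := by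
      unfold finishTime
      rw [hagree]
      simp [upd, hpq.symm]
    have h3 : S.del (upd a x u p y') p = S.del (upd a x u p y) p := by
      rw [h1a, h2a]
      unfold del
      rw [f1, f2, hfin]
    have h4 : S.start (upd a x u p y) p ≠ ⊤ := by
      intro h
      apply h1b
      unfold del
      rw [e1, h, top_add]
    unfold del at h3
    rw [e1, e2, ENNReal.add_right_inj h4, ENNReal.ofReal_eq_ofReal_iff hy'.le hy.le] at h3
    linarith
  have hsub : C.Subsingleton := by
    rintro y ⟨hy, hyB⟩ y' ⟨hy', hyB'⟩
    rcases lt_trichotomy y y' with h | h | h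
    · exact (haux y y' hy h hyB hyB').elim
    · exact h
    · exact (haux y' y hy' h hyB' hyB).elim
  have hnull : expMeasure μ C = 0 := hsub.measure_zero _
  simp only [Pi.zero_apply]
  rw [← lintegral_zero (μ := expMeasure μ)]
  refine lintegral_congr_ae ?_
  filter_upwards [ae_pos_expMeasure hμ, measure_eq_zero_iff_ae_notMem.1 hnull] with y hy hyC
  have : Function.update x p y ∉ B := fun h => hyC ⟨hy, h⟩
  simp [this]

theorem ae_validInput {μ : ℝ} (hμ : 0 < μ) {a : ℕ → ℝ} (ha : ValidArrivals a)
    (u : unitInterval) : ∀ᵐ x ∂expLaw n μ, ValidInput (a, x, u) := by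
  filter_upwards [ae_pos_infinitePi (ι := ℕ × Fin n) hμ] with x hx using ⟨ha, hx⟩

/-- Predictability forces the left-continuous notion `busyBefore`, whereas schemes are constrained
through the right-continuous `activeChunks`. They differ only at starts, finishes and departures, a
countable set of times. -/
theorem ae_busyBefore_iff (w : Input n) : ∀ᵐ t : ℝ, 0 < t → ∀ p,
    (S.busyBefore w p (ENNReal.ofReal t) ↔
      p ∈ activeChunks k (S.start w) w.2.1 (ENNReal.ofReal t)) := by
  have hne : ∀ c : ℝ≥0∞, ∀ᵐ t : ℝ, 0 < t → ENNReal.ofReal t ≠ c := by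
    intro c
    filter_upwards [Measure.ae_ne volume c.toReal] with t ht h0 hc
    exact ht (by rw [← hc, ENNReal.toReal_ofReal h0.le])
  have h1 : ∀ᵐ t : ℝ, ∀ p, 0 < t → ENNReal.ofReal t ≠ S.start w p :=
    ae_all_iff.2 fun p => hne _
  have h2 : ∀ᵐ t : ℝ, ∀ p, 0 < t → ENNReal.ofReal t ≠ finishTime (S.start w) w.2.1 p :=
    ae_all_iff.2 fun p => hne _
  have h3 : ∀ᵐ t : ℝ, ∀ p : ℕ × Fin n, 0 < t →
      ENNReal.ofReal t ≠ departureTime k (S.start w) w.2.1 p.1 := ae_all_iff.2 fun p => hne _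
  filter_upwards [h1, h2, h3] with t h1 h2 h3 h0 p
  unfold busyBefore activeChunks
  simp only [Set.mem_ofPred_eq]
  exact and_congr ⟨le_of_lt, fun h => lt_of_le_of_ne h (h1 p h0).symm⟩
    (and_congr ⟨fun h => lt_of_le_of_ne h (h2 p h0), le_of_lt⟩
      ⟨fun h => lt_of_le_of_ne h (h3 p h0), le_of_lt⟩)

/-- The number of active threads. -/
noncomputable def numActive (w : Input n) (t : ℝ≥0∞) : ℕ :=
  (activeChunks k (S.start w) w.2.1 t).ncard

theorem finite_active {w : Input n} (hw : ValidInput w) (t : ℝ≥0∞) :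
    (activeChunks k (S.start w) w.2.1 t).Finite :=
  Set.encard_lt_top_iff.1 ((S.card_active_le w hw t).trans_lt (ENat.natCast_lt_top L))

theorem numActive_le {w : Input n} (hw : ValidInput w) (t : ℝ≥0∞) : S.numActive w t ≤ L := by
  have h := S.card_active_le w hw t
  rw [← (S.finite_active hw t).cast_ncard_eq] at h
  exact_mod_cast h

/-- Before the `m`-th delivery at most `m < k * (m / k + 1)` effective chunks are out. Once request
`m / k` has arrived, one of the requests up to it must still be in the system. -/
theorem WorkConserving.numActive_eq {S : OnlineScheme L k n} (hS : S.WorkConserving) (hk : 0 < k)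
    {w : Input n} (hw : ValidInput w) {m : ℕ} {t : ℝ≥0∞} (ht : t < nthTime (S.del w) m)
    (hr : readyTime k w.1 (S.del w) m ≤ t) : S.numActive w t = L := by
  have hP := S.isPath hw
  have htt : t < ⊤ := ht.trans_le le_top
  have hc : countUpTo (deliveryTime k (S.start w) w.2.1) t ≤ m := by
    have := (hP.locFinite (k := k)).lt_nthTime_iff (m := m) htt
    by_contra! h
    exact absurd (this.2 h) (not_le.2 ht)
  have hc' : m < k * (m / k + 1) := Nat.lt_mul_div_succ m hk
  obtain ⟨j, -, hj⟩ := hP.exists_inSystem hk htt (i := m / k)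
    ((arrival_le_readyTime k w.1 _ m).trans hr) (hc.trans_lt hc')
  have h := hS w hw t ⟨j, hj⟩
  rw [← (S.finite_active hw t).cast_ncard_eq] at h
  exact_mod_cast h

open Classical in
/-- The law of the `m`-th delivery: it takes place at rate `μ` times the number of active threads. -/
theorem lintegral_nthDelivery (hk : 0 < k) {μ : ℝ} (hμ : 0 < μ) {a : ℕ → ℝ}
    (ha : ValidArrivals a) (u : unitInterval) (m : ℕ) {Z : (ℕ → ℝ≥0∞) → ℝ≥0∞ → ℝ≥0∞ → ℝ≥0∞}
    (hZ : Measurable fun z : (ℕ → ℝ≥0∞) × ℝ≥0∞ × ℝ≥0∞ => Z z.1 z.2.1 z.2.2) :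
    ∫⁻ x, (if nthTime (S.del (a, x, u)) m = ⊤ then 0 else
        Z (history (S.del (a, x, u)) m) (readyTime k a (S.del (a, x, u)) m) (nthTime (S.del (a, x, u)) m)) ∂expLaw n μ =
      ∫⁻ x, (∫⁻ t : ℝ, ENNReal.ofReal μ * (S.numActive (a, x, u) (ENNReal.ofReal t) *
        (if readyTime k a (S.del (a, x, u)) m < ENNReal.ofReal t ∧
          ENNReal.ofReal t ≤ nthTime (S.del (a, x, u)) m then
          Z (history (S.del (a, x, u)) m) (readyTime k a (S.del (a, x, u)) m) (ENNReal.ofReal t) else 0))) ∂expLaw n μ := by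
  have := isProbabilityMeasure_expMeasure hμ
  have hin : Measurable fun x : ℕ × Fin n → ℝ => ((a, x, u) : Input n) :=
    measurable_const.prodMk (measurable_id.prodMk measurable_const)
  have hdel : Measurable fun x : ℕ × Fin n → ℝ => S.del (a, x, u) := (S.measurable_del hk).comp hin
  have hdelp : ∀ p, Measurable fun x : ℕ × Fin n → ℝ => S.del (a, x, u) p := fun p =>
    (measurable_pi_apply p).comp hdel
  -- Cutting the test function off to the window from the ready time to the `m`-th delivery keeps it
  -- predictable, and in the sum over all chunks it singles out the `m`-th delivery.
  obtain ⟨Z', hZ'⟩ : ∃ Z' : (ℕ × Fin n → ℝ≥0∞) → ℝ≥0∞ → ℝ≥0∞, ∀ d t, Z' d t =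
      if readyTime k a d m < t ∧ t ≤ nthTime d m then Z (history d m) (readyTime k a d m) t else 0 :=
    ⟨_, fun _ _ => rfl⟩
  have hZ'm : Measurable (Function.uncurry Z') := by
    simp only [Function.uncurry_def, hZ']
    refine Measurable.ite ?_ ?_ measurable_const
    · refine (measurableSet_lt ?_ measurable_snd).inter (measurableSet_le measurable_snd ?_)
      · exact (measurable_readyTime k m).comp (measurable_const.prodMk measurable_fst)
      · exact (measurable_nthTime m).comp measurable_fst
    · exact hZ.comp (((measurable_history m).comp measurable_fst).prodMk
        (((measurable_readyTime k m).comp (measurable_const.prodMk measurable_fst)).prodMk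
          measurable_snd))
  have hpred : Predictable Z' := by
    intro d d' t h
    simp only [hZ']
    have h1 := readyTime_lt_congr (k := k) (a := a) h m
    have h2 := not_congr (nthTime_lt_congr h m)
    rw [not_lt, not_lt] at h2
    simp only [h1, h2]
    split_ifs with hc
    · rw [history_eq_of_lt h (h1.2 hc.1), readyTime_eq_of_lt h (h1.2 hc.1)]
    · rfl
  have key := fun p => S.lintegral_delivery_eq_of_chunk hk hμ ha u hZ'm hpred p
  have hm2 : ∀ p, Measurable fun z : (ℕ × Fin n → ℝ) × ℝ => ENNReal.ofReal μ *
      (if S.busyBefore (a, z.1, u) p (ENNReal.ofReal z.2)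
        then Z' (S.del (a, z.1, u)) (ENNReal.ofReal z.2) else 0) := by
    intro p
    refine Measurable.const_mul (Measurable.ite ?_ ?_ measurable_const) _
    · exact ((hin.comp measurable_fst).prodMk measurable_snd.ennreal_ofReal)
        (S.measurableSet_busyBefore hk p)
    · exact hZ'm.comp ((hdel.comp measurable_fst).prodMk measurable_snd.ennreal_ofReal)
  have hm3 : ∀ p, Measurable fun x : ℕ × Fin n → ℝ => ∫⁻ t : ℝ, ENNReal.ofReal μ *
      (if S.busyBefore (a, x, u) p (ENNReal.ofReal t)
        then Z' (S.del (a, x, u)) (ENNReal.ofReal t) else 0) :=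
    fun p => (hm2 p).lintegral_prod_right'
  have hm4 : ∀ p, Measurable fun x : ℕ × Fin n → ℝ => (if S.del (a, x, u) p = ⊤ then 0 else
      Z' (S.del (a, x, u)) (S.del (a, x, u) p)) := fun p =>
    Measurable.ite (hdelp p (measurableSet_singleton ⊤)) measurable_const
      (hZ'm.comp (hdel.prodMk (hdelp p)))
  have hsum : ∫⁻ x, ∑' p, (if S.del (a, x, u) p = ⊤ then 0 else
      Z' (S.del (a, x, u)) (S.del (a, x, u) p)) ∂expLaw n μ =
      ∫⁻ x, ∑' p, (∫⁻ t : ℝ, ENNReal.ofReal μ * (if S.busyBefore (a, x, u) p (ENNReal.ofReal t)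
        then Z' (S.del (a, x, u)) (ENNReal.ofReal t) else 0)) ∂expLaw n μ :=
    (lintegral_tsum fun p => (hm4 p).aemeasurable).trans
      ((tsum_congr key).trans (lintegral_tsum fun p => (hm3 p).aemeasurable).symm)
  refine Eq.trans (lintegral_congr_ae ?_) (hsum.trans (lintegral_congr_ae ?_))
  · filter_upwards [S.ae_noTies hk hμ ha u, ae_validInput (n := n) hμ ha u] with x hx hv
    have hP := S.isPath hv
    have hloc : LocFinite (S.del (a, x, u)) := hP.locFinite
    by_cases hm : nthTime (S.del (a, x, u)) m = ⊤
    · rw [if_pos hm]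
      symm
      rw [ENNReal.tsum_eq_zero]
      intro p
      split_ifs with hp
      · rfl
      · simp only [hZ']
        refine if_neg fun hc => ?_
        exact hp ((eq_nthTime_of_readyTime_lt hx hloc (lt_top_iff_ne_top.2 hp) hc.1 hc.2).trans hm)
    · rw [if_neg hm]
      obtain ⟨p0, hp0, huniq⟩ := hx.existsUnique_eq_nthTime hloc (lt_top_iff_ne_top.2 hm)
      rw [tsum_eq_single p0]
      · have hr : readyTime k a (S.del (a, x, u)) m < nthTime (S.del (a, x, u)) m :=
          hP.readyTime_lt hk hx (lt_top_iff_ne_top.2 hm)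
        rw [hp0, if_neg hm]
        simp only [hZ']
        rw [if_pos ⟨hr, le_rfl⟩]
      · intro q hq
        split_ifs with hqt
        · rfl
        · simp only [hZ']
          refine if_neg fun hc => hq (huniq q ?_)
          exact eq_nthTime_of_readyTime_lt hx hloc (lt_top_iff_ne_top.2 hqt) hc.1 hc.2
  · filter_upwards [ae_validInput (n := n) hμ ha u] with x hv
    refine (lintegral_tsum fun p => ((hm2 p).comp (measurable_const (a := x) |>.prodMk
      measurable_id)).aemeasurable).symm.trans (lintegral_congr_ae ?_)
    -- The sum of the busy indicators over the chunks is the number of active threads at almost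
    -- every time.
    filter_upwards [S.ae_busyBefore_iff (a, x, u)] with t ht
    simp only [Function.comp_apply, id, ENNReal.tsum_mul_left]
    congr 1
    by_cases h0 : 0 < t
    · simp only [ht h0]
      rw [tsum_ite_mem_of_finite (S.finite_active hv _), ← hZ']
      rfl
    · have : ∀ d, Z' d (ENNReal.ofReal t) = 0 := by
        intro d
        simp only [hZ']
        refine if_neg fun hc => ?_
        rw [ENNReal.ofReal_of_nonpos (not_lt.1 h0)] at hc
        exact not_lt_zero hc.1
      simp only [this, ite_self, tsum_zero]
      have h2 := this (S.del (a, x, u))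
      simp only [hZ'] at h2
      rw [h2, mul_zero]

end OnlineScheme

/-- The probability that an exponential time with rate `r` that starts at `t` lasts until `c`. -/
noncomputable def expSurvival (r : ℝ) (c t : ℝ≥0∞) : ℝ≥0∞ :=
  ENNReal.ofReal (Real.exp (-(r * (c - t).toReal)))

theorem expSurvival_self (r : ℝ) (c : ℝ≥0∞) : expSurvival r c c = 1 := by
  simp [expSurvival]

theorem expSurvival_le_one {r : ℝ} (hr : 0 ≤ r) (c t : ℝ≥0∞) : expSurvival r c t ≤ 1 := by
  rw [expSurvival, ← ENNReal.ofReal_one]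
  refine ENNReal.ofReal_le_ofReal (Real.exp_le_one_iff.2 ?_)
  have : 0 ≤ (c - t).toReal := ENNReal.toReal_nonneg
  nlinarith [mul_nonneg hr this]

theorem Measurable.expSurvival {Ω : Type*} [MeasurableSpace Ω] (r : ℝ) {f g : Ω → ℝ≥0∞}
    (hf : Measurable f) (hg : Measurable g) :
    Measurable fun ω => expSurvival r (f ω) (g ω) := by
  unfold CloudQueue.expSurvival
  exact (Real.measurable_exp.comp
    (((hf.sub hg).ennreal_toReal.const_mul r).neg)).ennreal_ofReal

/-- The function `t ↦ exp (-(r * (c - t)))` is `r⁻¹` times its derivative, so its integral against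
`r` is its increment. -/
theorem lintegral_expSurvival {r : ℝ} (hr : 0 < r) {s b c : ℝ≥0∞} (hsb : s ≤ b) (hbc : b ≤ c)
    (hc : c < ⊤) :
    (∫⁻ t : ℝ, ENNReal.ofReal r * (if s < ENNReal.ofReal t ∧ ENNReal.ofReal t ≤ b then
      expSurvival r c (ENNReal.ofReal t) else 0)) + expSurvival r c s = expSurvival r c b := by
  obtain ⟨s, hs0, rfl⟩ : ∃ s' : ℝ, 0 ≤ s' ∧ s = ENNReal.ofReal s' :=
    ⟨s.toReal, ENNReal.toReal_nonneg, (ENNReal.ofReal_toReal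
      ((hsb.trans hbc).trans_lt hc).ne).symm⟩
  obtain ⟨b, hb0, rfl⟩ : ∃ s' : ℝ, 0 ≤ s' ∧ b = ENNReal.ofReal s' :=
    ⟨b.toReal, ENNReal.toReal_nonneg, (ENNReal.ofReal_toReal (hbc.trans_lt hc).ne).symm⟩
  obtain ⟨c, hc0, rfl⟩ : ∃ s' : ℝ, 0 ≤ s' ∧ c = ENNReal.ofReal s' :=
    ⟨c.toReal, ENNReal.toReal_nonneg, (ENNReal.ofReal_toReal hc.ne).symm⟩
  rw [ENNReal.ofReal_le_ofReal_iff hb0] at hsb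
  rw [ENNReal.ofReal_le_ofReal_iff hc0] at hbc
  have hW : ∀ t, 0 ≤ t → t ≤ c → expSurvival r (ENNReal.ofReal c) (ENNReal.ofReal t) =
      ENNReal.ofReal (Real.exp (-(r * (c - t)))) := by
    intro t ht htc
    rw [expSurvival, ← ENNReal.ofReal_sub _ ht, ENNReal.toReal_ofReal (by linarith)]
  have h1 : (fun t : ℝ => ENNReal.ofReal r * (if ENNReal.ofReal s < ENNReal.ofReal t ∧
      ENNReal.ofReal t ≤ ENNReal.ofReal b then
      expSurvival r (ENNReal.ofReal c) (ENNReal.ofReal t) else 0)) =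
      (Set.Ioc s b).indicator fun t => ENNReal.ofReal (r * Real.exp (-(r * (c - t)))) := by
    ext t
    by_cases ht : t ∈ Set.Ioc s b
    · have h0 : 0 < t := hs0.trans_lt ht.1
      rw [Set.indicator_of_mem ht, if_pos, hW t h0.le (ht.2.trans hbc), ENNReal.ofReal_mul hr.le]
      exact ⟨(ENNReal.ofReal_lt_ofReal_iff h0).2 ht.1, ENNReal.ofReal_le_ofReal ht.2⟩
    · rw [Set.indicator_of_notMem ht, if_neg, mul_zero]
      rintro ⟨h2, h3⟩
      have h0 : 0 < t := ENNReal.ofReal_pos.1 (lt_of_le_of_lt bot_le h2)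
      exact ht ⟨(ENNReal.ofReal_lt_ofReal_iff h0).1 h2, (ENNReal.ofReal_le_ofReal_iff hb0).1 h3⟩
  have hderiv : ∀ t, HasDerivAt (fun t => Real.exp (-(r * (c - t))))
      (r * Real.exp (-(r * (c - t)))) t := by
    intro t
    have h2 : HasDerivAt (fun t : ℝ => -(r * (c - t))) r t := by
      have h3 : HasDerivAt (fun t : ℝ => -(r * (c - t))) (-(r * -1)) t :=
        (((hasDerivAt_id' t).const_sub c).const_mul r).neg
      simpa using h3
    have := h2.exp
    rwa [mul_comm] at this
  have hcont : Continuous fun t : ℝ => r * Real.exp (-(r * (c - t))) := by fun_prop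
  have h2 : ∫ t in s..b, r * Real.exp (-(r * (c - t))) =
      Real.exp (-(r * (c - b))) - Real.exp (-(r * (c - s))) :=
    intervalIntegral.integral_eq_sub_of_hasDerivAt (fun t _ => hderiv t)
      (hcont.intervalIntegrable _ _)
  have hmono : Real.exp (-(r * (c - s))) ≤ Real.exp (-(r * (c - b))) :=
    Real.exp_le_exp.2 (by nlinarith)
  rw [h1, lintegral_indicator measurableSet_Ioc, ← ofReal_integral_eq_lintegral_ofReal,
    ← intervalIntegral.integral_of_le hsb, h2, hW s hs0 (hsb.trans hbc), hW b hb0 hbc,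
    ← ENNReal.ofReal_add (by linarith) (Real.exp_pos _).le]
  · congr 1; ring
  · exact (hcont.integrableOn_Icc (a := s) (b := b)).mono_set Set.Ioc_subset_Icc_self
  · exact Eventually.of_forall fun t => by positivity

/-! ### Survival of the next delivery past a threshold known at the ready time -/

namespace OnlineScheme

variable {L k n : ℕ} (S : OnlineScheme L k n)

section Survival

variable {f c : (ℕ → ℝ≥0∞) → ℝ≥0∞ → ℝ≥0∞}

-- The intensity formula is applied to `f * expSurvival (L * μ) c t`, the conditional survival
-- probability when deliveries come at the full rate `L * μ`. As fewer threads only delay the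
-- delivery, the true survival probability is at least this one, with equality if all threads are
-- active. The threshold `c` and the weight `f` may depend on the past, which later yields
-- independence of the durations as well as their law.
open Classical in
theorem lintegral_survival_aux (hL : 0 < L) (hk : 0 < k) {μ : ℝ} (hμ : 0 < μ) {a : ℕ → ℝ}
    (ha : ValidArrivals a) (u : unitInterval) (m : ℕ)
    (hf : Measurable (Function.uncurry f)) (hc : Measurable (Function.uncurry c))
    (hf1 : ∀ h r, f h r ≤ 1) (hct : ∀ h r, r < c h r → c h r < ⊤) :
    let T := fun x => nthTime (S.del (a, x, u)) m
    let R := fun x => readyTime k a (S.del (a, x, u)) m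
    let H := fun x => history (S.del (a, x, u)) m
    (∫⁻ x, (if R x < c (H x) (R x) then
        f (H x) (R x) * expSurvival (L * μ) (c (H x) (R x)) (R x) else 0) ∂expLaw n μ ≤
      ∫⁻ x, (if R x < c (H x) (R x) ∧ c (H x) (R x) < T x then f (H x) (R x) else 0)
        ∂expLaw n μ) ∧
    (S.WorkConserving → ∫⁻ x, (if R x < c (H x) (R x) then
        f (H x) (R x) * expSurvival (L * μ) (c (H x) (R x)) (R x) else 0) ∂expLaw n μ =
      ∫⁻ x, (if R x < c (H x) (R x) ∧ c (H x) (R x) < T x then f (H x) (R x) else 0)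
        ∂expLaw n μ) := by
  intro T R H
  have := isProbabilityMeasure_expMeasure hμ
  have hlam : 0 < (L : ℝ) * μ := mul_pos (by exact_mod_cast hL) hμ
  have hin : Measurable fun x : ℕ × Fin n → ℝ => ((a, x, u) : Input n) :=
    measurable_const.prodMk (measurable_id.prodMk measurable_const)
  have hdel : Measurable fun x : ℕ × Fin n → ℝ => S.del (a, x, u) := (S.measurable_del hk).comp hin
  have hT : Measurable T := (measurable_nthTime m).comp hdel
  have hR : Measurable R := (measurable_readyTime k m).comp (measurable_const.prodMk hdel)
  have hH : Measurable H := (measurable_history m).comp hdel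
  have hgood : ∀ᵐ x ∂expLaw n μ, R x < T x ∨ T x = ⊤ := by
    filter_upwards [S.ae_noTies hk hμ ha u, ae_validInput (n := n) hμ ha u] with x hx hv
    by_cases h : T x = ⊤
    · exact Or.inr h
    · exact Or.inl ((S.isPath hv).readyTime_lt hk hx (lt_top_iff_ne_top.2 h))
  have hact : S.WorkConserving → ∀ᵐ x ∂expLaw n μ, ∀ t, t < T x → R x ≤ t →
      S.numActive (a, x, u) t = L := fun hS => by
    filter_upwards [ae_validInput (n := n) hμ ha u] with x hv t h1 h2
    exact hS.numActive_eq hk hv h1 h2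
  have key : ∀ {Z : (ℕ → ℝ≥0∞) → ℝ≥0∞ → ℝ≥0∞ → ℝ≥0∞},
      (Measurable fun z : (ℕ → ℝ≥0∞) × ℝ≥0∞ × ℝ≥0∞ => Z z.1 z.2.1 z.2.2) →
      ∫⁻ x, (if T x = ⊤ then 0 else Z (H x) (R x) (T x)) ∂expLaw n μ =
      ∫⁻ x, (∫⁻ t : ℝ, ENNReal.ofReal μ * (S.numActive (a, x, u) (ENNReal.ofReal t) *
        (if R x < ENNReal.ofReal t ∧ ENNReal.ofReal t ≤ T x then
          Z (H x) (R x) (ENNReal.ofReal t) else 0))) ∂expLaw n μ :=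
    fun hZ => S.lintegral_nthDelivery hk hμ ha u m hZ
  clear_value T R H
  have hcx : Measurable fun x => c (H x) (R x) := hc.comp (hH.prodMk hR)
  have hfx : Measurable fun x => f (H x) (R x) := hf.comp (hH.prodMk hR)
  obtain ⟨Z, hZ⟩ : ∃ Z : (ℕ → ℝ≥0∞) → ℝ≥0∞ → ℝ≥0∞ → ℝ≥0∞, ∀ h r t, Z h r t =
    if r < c h r ∧ t ≤ c h r then f h r * expSurvival (L * μ) (c h r) t else 0 :=
    ⟨_, fun _ _ _ => rfl⟩
  have hZm : Measurable fun z : (ℕ → ℝ≥0∞) × ℝ≥0∞ × ℝ≥0∞ => Z z.1 z.2.1 z.2.2 := by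
    simp only [hZ]
    have h1 : Measurable fun z : (ℕ → ℝ≥0∞) × ℝ≥0∞ × ℝ≥0∞ => c z.1 z.2.1 :=
      hc.comp (measurable_fst.prodMk (measurable_fst.comp measurable_snd))
    have h2 : Measurable fun z : (ℕ → ℝ≥0∞) × ℝ≥0∞ × ℝ≥0∞ => f z.1 z.2.1 :=
      hf.comp (measurable_fst.prodMk (measurable_fst.comp measurable_snd))
    have h3 : Measurable fun z : (ℕ → ℝ≥0∞) × ℝ≥0∞ × ℝ≥0∞ => z.2.2 :=
      measurable_snd.comp measurable_snd
    have h4 : Measurable fun z : (ℕ → ℝ≥0∞) × ℝ≥0∞ × ℝ≥0∞ =>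
        expSurvival (L * μ) (c z.1 z.2.1) z.2.2 :=
      Measurable.expSurvival (L * μ) h1 h3
    have h5 : Measurable fun z : (ℕ → ℝ≥0∞) × ℝ≥0∞ × ℝ≥0∞ => z.2.1 :=
      measurable_fst.comp measurable_snd
    exact Measurable.ite ((measurableSet_lt h5 h1).inter (measurableSet_le h3 h1))
      (h2.mul h4) measurable_const
  set X : (ℕ × Fin n → ℝ) → ℝ≥0∞ := fun x => if T x = ⊤ then 0 else Z (H x) (R x) (T x) with hX
  have hXm : Measurable X := Measurable.ite (hT (measurableSet_singleton ⊤)) measurable_const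
    (hZm.comp (hH.prodMk (hR.prodMk hT)))
  -- Needed because this term is cancelled at the end, which is only allowed for finite values.
  have hXfin : ∫⁻ x, X x ∂expLaw n μ ≠ ⊤ := by
    refine ne_top_of_le_ne_top ENNReal.one_ne_top ?_
    calc ∫⁻ x, X x ∂expLaw n μ ≤ ∫⁻ _, 1 ∂expLaw n μ := by
          refine lintegral_mono fun x => ?_
          simp only [hX, hZ]
          split_ifs
          · exact zero_le
          · exact mul_le_one' (hf1 _ _) (expSurvival_le_one hlam.le _ _)
          · exact zero_le
      _ = 1 := by simp
  set A : (ℕ × Fin n → ℝ) → ℝ≥0∞ := fun x => if R x < c (H x) (R x) then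
        f (H x) (R x) * expSurvival (L * μ) (c (H x) (R x)) (R x) else 0 with hA
  set D : (ℕ × Fin n → ℝ) → ℝ≥0∞ := fun x =>
    if R x < c (H x) (R x) ∧ c (H x) (R x) < T x then f (H x) (R x) else 0 with hD
  set Y : (ℕ × Fin n → ℝ) → ℝ≥0∞ := fun x => if R x < c (H x) (R x) then
      f (H x) (R x) * ∫⁻ t : ℝ, ENNReal.ofReal (L * μ) * (if R x < ENNReal.ofReal t ∧
        ENNReal.ofReal t ≤ min (T x) (c (H x) (R x)) then
        expSurvival (L * μ) (c (H x) (R x)) (ENNReal.ofReal t) else 0) else 0 with hY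
  have hcs : Measurable fun x => expSurvival (L * μ) (c (H x) (R x)) (R x) :=
    Measurable.expSurvival (L * μ) hcx hR
  have hAm : Measurable A := Measurable.ite (measurableSet_lt hR hcx) (hfx.mul hcs) measurable_const
  -- Pathwise balance: the initial value plus the growth at full rate up to `min T c` equals the
  -- value there, which is `X` if the delivery comes by `c` and `D` if it does not.
  have hbal : ∫⁻ x, A x ∂expLaw n μ + ∫⁻ x, Y x ∂expLaw n μ =
      ∫⁻ x, D x ∂expLaw n μ + ∫⁻ x, X x ∂expLaw n μ := by
    rw [← lintegral_add_left hAm, ← lintegral_add_right _ hXm]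
    refine lintegral_congr_ae ?_
    filter_upwards [hgood] with x hx
    simp only [hA, hY, hD, hX, hZ]
    by_cases hrc : R x < c (H x) (R x)
    · have hctx := hct _ _ hrc
      have hRT : R x < T x := by
        rcases hx with h | h
        · exact h
        · rw [h]; exact hrc.trans_le le_top
      have hint := lintegral_expSurvival hlam (le_min hRT.le hrc.le) (min_le_right (T x) _) hctx
      rw [if_pos hrc, if_pos hrc, ← mul_add, add_comm (expSurvival _ _ _), hint]
      by_cases hTc : T x ≤ c (H x) (R x)
      · have hTt : T x ≠ ⊤ := (hTc.trans_lt hctx).ne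
        rw [min_eq_left hTc, if_neg (fun h => absurd h.2 (not_lt.2 hTc)), if_neg hTt,
          if_pos ⟨hrc, hTc⟩, zero_add]
      · rw [min_eq_right (not_le.1 hTc).le, expSurvival_self, if_pos ⟨hrc, not_le.1 hTc⟩,
          mul_one]
        simp [hTc]
    · simp [hrc]
  have hinner : ∀ x t, ENNReal.ofReal μ * (S.numActive (a, x, u) (ENNReal.ofReal t) *
        (if R x < ENNReal.ofReal t ∧ ENNReal.ofReal t ≤ T x then
          Z (H x) (R x) (ENNReal.ofReal t) else 0)) =
      (if R x < c (H x) (R x) then f (H x) (R x) * (ENNReal.ofReal (S.numActive (a, x, u)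
        (ENNReal.ofReal t) * μ) * (if R x < ENNReal.ofReal t ∧
        ENNReal.ofReal t ≤ min (T x) (c (H x) (R x)) then
        expSurvival (L * μ) (c (H x) (R x)) (ENNReal.ofReal t) else 0)) else 0) := by
    intro x t
    rw [ENNReal.ofReal_mul (Nat.cast_nonneg _), ENNReal.ofReal_natCast, hZ]
    by_cases h1 : R x < c (H x) (R x)
    · by_cases h2 : R x < ENNReal.ofReal t
      · by_cases h3 : ENNReal.ofReal t ≤ T x
        · by_cases h4 : ENNReal.ofReal t ≤ c (H x) (R x)
          · simp only [h1, h2, h3, h4, le_min_iff, and_self, if_true]; ring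
          · simp [h4]
        · simp [h3]
      · simp [h2]
    · simp [h1]
  have hYeq : ∀ x, Y x = ∫⁻ t : ℝ, (if R x < c (H x) (R x) then f (H x) (R x) *
        (ENNReal.ofReal (L * μ) * (if R x < ENNReal.ofReal t ∧
        ENNReal.ofReal t ≤ min (T x) (c (H x) (R x)) then
        expSurvival (L * μ) (c (H x) (R x)) (ENNReal.ofReal t) else 0)) else 0) := by
    intro x
    simp only [hY]
    split_ifs with h
    · exact (lintegral_const_mul' _ _ ((hf1 _ _).trans_lt ENNReal.one_lt_top).ne).symm
    · simp
  -- The intensity formula has the actual number of active threads in place of `L`.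
  have hXY : ∫⁻ x, X x ∂expLaw n μ ≤ ∫⁻ x, Y x ∂expLaw n μ := by
    rw [show ∫⁻ x, X x ∂expLaw n μ = _ from key hZm]
    refine lintegral_mono_ae ?_
    filter_upwards [ae_validInput (n := n) hμ ha u] with x hv
    rw [hYeq]
    refine lintegral_mono fun t => ?_
    rw [hinner x t]
    have := S.numActive_le hv (ENNReal.ofReal t)
    split_ifs
    · gcongr
    · gcongr
    · exact le_rfl
  refine ⟨?_, fun hS => ?_⟩
  · have h1 : ∫⁻ x, A x ∂expLaw n μ + ∫⁻ x, X x ∂expLaw n μ ≤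
        ∫⁻ x, D x ∂expLaw n μ + ∫⁻ x, X x ∂expLaw n μ := by
      rw [← hbal]; gcongr
    exact (ENNReal.add_le_add_iff_right hXfin).1 h1
  · have hXY' : ∫⁻ x, X x ∂expLaw n μ = ∫⁻ x, Y x ∂expLaw n μ := by
      rw [show ∫⁻ x, X x ∂expLaw n μ = _ from key hZm]
      refine lintegral_congr_ae ?_
      filter_upwards [hact hS] with x hv
      rw [hYeq]
      refine lintegral_congr_ae ?_
      -- Full activity is only known strictly before the delivery; the instant of delivery itself is
      -- null.
      filter_upwards [Measure.ae_ne volume (T x).toReal] with t ht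
      rw [hinner x t]
      by_cases h2 : R x < ENNReal.ofReal t ∧ ENNReal.ofReal t ≤ min (T x) (c (H x) (R x))
      · have h3 : ENNReal.ofReal t < T x := by
          refine lt_of_le_of_ne (h2.2.trans (min_le_left _ _)) fun h => ht ?_
          rw [← h, ENNReal.toReal_ofReal]
          exact (ENNReal.ofReal_pos.1 (lt_of_le_of_lt bot_le h2.1)).le
        rw [hv _ h3 h2.1.le]
      · simp only [h2, if_false, mul_zero]
    rw [← hXY'] at hbal
    exact (ENNReal.add_left_inj hXfin).1 hbal

end Survival

end OnlineScheme

/-! ### Stochastic order on `[0, ∞]` -/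

theorem lintegral_indicator_lt (z : ℝ≥0∞) :
    ∫⁻ s in Set.Ioi (0 : ℝ), {s : ℝ | ENNReal.ofReal s < z}.indicator 1 s = z := by
  have hm : MeasurableSet {s : ℝ | ENNReal.ofReal s < z} :=
    measurableSet_lt ENNReal.measurable_ofReal measurable_const
  rw [lintegral_indicator_one hm, Measure.restrict_apply hm]
  rcases eq_or_ne z ⊤ with rfl | hz
  · have : {s : ℝ | ENNReal.ofReal s < ⊤} ∩ Set.Ioi 0 = Set.Ioi 0 := by
      ext s; simp
    rw [this, Real.volume_Ioi]
  · have : {s : ℝ | ENNReal.ofReal s < z} ∩ Set.Ioi 0 = Set.Ioo 0 z.toReal := by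
      ext s
      simp only [Set.mem_inter_iff, Set.mem_ofPred_eq, Set.mem_Ioi, Set.mem_Ioo]
      constructor
      · rintro ⟨h1, h2⟩
        exact ⟨h2, (ENNReal.ofReal_lt_iff_lt_toReal h2.le hz).1 h1⟩
      · rintro ⟨h1, h2⟩
        exact ⟨(ENNReal.ofReal_lt_iff_lt_toReal h1.le hz).2 h2, h1⟩
    rw [this, Real.volume_Ioo, sub_zero, ENNReal.ofReal_toReal hz]

theorem lintegral_eq_lintegral_measure_lt {Ω : Type*} [MeasurableSpace Ω] (α : Measure Ω)
    [SFinite α] {F : Ω → ℝ≥0∞} (hF : Measurable F) :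
    ∫⁻ z, F z ∂α = ∫⁻ s in Set.Ioi (0 : ℝ), α {z | ENNReal.ofReal s < F z} := by
  have h1 : ∀ z, F z = ∫⁻ s in Set.Ioi (0 : ℝ), {s : ℝ | ENNReal.ofReal s < F z}.indicator 1 s :=
    fun z => (lintegral_indicator_lt _).symm
  have hm : MeasurableSet {q : Ω × ℝ | ENNReal.ofReal q.2 < F q.1} :=
    measurableSet_lt (ENNReal.measurable_ofReal.comp measurable_snd) (hF.comp measurable_fst)
  calc ∫⁻ z, F z ∂α = ∫⁻ z, (∫⁻ s in Set.Ioi (0 : ℝ),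
        {s : ℝ | ENNReal.ofReal s < F z}.indicator 1 s) ∂α := lintegral_congr h1
    _ = ∫⁻ s in Set.Ioi (0 : ℝ), ∫⁻ z, {s : ℝ | ENNReal.ofReal s < F z}.indicator 1 s ∂α := by
        refine lintegral_lintegral_swap (Measurable.aemeasurable ?_)
        exact (measurable_const : Measurable fun _ : Ω × ℝ => (1 : ℝ≥0∞)).indicator hm
    _ = _ := by
        refine lintegral_congr fun s => ?_
        rw [← lintegral_indicator_one (measurableSet_lt measurable_const hF)]
        rfl

/-- An upper set of a linear order with infima is a closed or an open ray; a closed ray from a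
positive point is a decreasing intersection of open ones. -/
theorem measure_upperSet_le {α β : Measure ℝ≥0∞} [IsProbabilityMeasure α] [IsProbabilityMeasure β]
    (h : ∀ c, α (Set.Ioi c) ≤ β (Set.Ioi c)) {U : Set ℝ≥0∞} (hU : IsUpperSet U) : α U ≤ β U := by
  rcases U.eq_empty_or_nonempty with rfl | hne
  · simp
  by_cases hc : sInf U ∈ U
  · have hUc : U = Set.Ici (sInf U) :=
      Set.Subset.antisymm (fun z hz => sInf_le hz) fun z hz => hU hz hc
    rcases eq_or_ne (sInf U) 0 with h0 | h0
    · have : U = Set.univ := by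
        rw [hUc, h0]
        ext z; simp
      rw [this, measure_univ, measure_univ]
    · obtain ⟨v, hv, hvlt, hvt⟩ := exists_seq_strictMono_tendsto' (pos_iff_ne_zero.2 h0)
      have hint : U = ⋂ i, Set.Ioi (v i) := by
        rw [hUc]
        ext z
        simp only [Set.mem_Ici, Set.mem_iInter, Set.mem_Ioi]
        exact ⟨fun hz i => (hvlt i).2.trans_le hz, fun hz => le_of_tendsto' hvt fun i => (hz i).le⟩
      have hanti : Antitone fun i => Set.Ioi (v i) := fun i j hij =>
        Set.Ioi_subset_Ioi (hv.monotone hij)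
      have hα := tendsto_measure_iInter_atTop (μ := α)
        (fun i => (measurableSet_Ioi (a := v i)).nullMeasurableSet) hanti ⟨0, measure_ne_top _ _⟩
      have hβ := tendsto_measure_iInter_atTop (μ := β)
        (fun i => (measurableSet_Ioi (a := v i)).nullMeasurableSet) hanti ⟨0, measure_ne_top _ _⟩
      rw [← hint] at hα hβ
      exact le_of_tendsto_of_tendsto' hα hβ fun i => h (v i)
  · have hUc : U = Set.Ioi (sInf U) := by
      refine Set.Subset.antisymm (fun z hz => lt_of_le_of_ne (sInf_le hz) fun he => hc (he ▸ hz)) ?_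
      intro z hz
      obtain ⟨w, hw, hwz⟩ := sInf_lt_iff.1 (show sInf U < z from hz)
      exact hU hwz.le hw
    rw [hUc]
    exact h _

/-- By the layer-cake formula it suffices to compare superlevel sets, which are upper sets for
monotone `F`. -/
theorem lintegral_le_of_tail_le {α β : Measure ℝ≥0∞} [IsProbabilityMeasure α]
    [IsProbabilityMeasure β] (h : ∀ c, α (Set.Ioi c) ≤ β (Set.Ioi c)) {F : ℝ≥0∞ → ℝ≥0∞}
    (hF : Monotone F) : ∫⁻ z, F z ∂α ≤ ∫⁻ z, F z ∂β := by
  rw [lintegral_eq_lintegral_measure_lt α hF.measurable,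
    lintegral_eq_lintegral_measure_lt β hF.measurable]
  exact lintegral_mono fun s => measure_upperSet_le h fun z w hzw hz => lt_of_lt_of_le hz (hF hzw)

/-! ### The Lindley recursion -/

/-- Delivery times when the successive service durations are `y 0, y 1, …`. -/
noncomputable def lindley (k : ℕ) (a : ℕ → ℝ) (y : ℕ → ℝ) : ℕ → ℝ≥0∞
  | 0 => ENNReal.ofReal (a 0) + ENNReal.ofReal (y 0)
  | l + 1 => max (lindley k a y l) (ENNReal.ofReal (a ((l + 1) / k))) + ENNReal.ofReal (y (l + 1))

theorem measurable_lindley (k l : ℕ) :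
    Measurable fun z : (ℕ → ℝ) × (ℕ → ℝ) => lindley k z.1 z.2 l := by
  induction l with
  | zero =>
    exact ((measurable_pi_apply 0).comp measurable_fst).ennreal_ofReal.add
      ((measurable_pi_apply 0).comp measurable_snd).ennreal_ofReal
  | succ l ih =>
    exact (ih.max ((measurable_pi_apply _).comp measurable_fst).ennreal_ofReal).add
      ((measurable_pi_apply _).comp measurable_snd).ennreal_ofReal

theorem lindley_update {k : ℕ} {a y : ℕ → ℝ} {l m : ℕ} (h : l < m) (v : ℝ) :
    lindley k a (Function.update y m v) l = lindley k a y l := by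
  induction l with
  | zero => simp [lindley, h.ne]
  | succ l ih => simp [lindley, h.ne, ih (by omega)]

theorem lindley_lt_top (k : ℕ) (a y : ℕ → ℝ) (l : ℕ) : lindley k a y l < ⊤ := by
  induction l with
  | zero => simp [lindley]
  | succ l ih => simp [lindley, ih]

/-- The law of the service durations of the effective chunks. -/
noncomputable abbrev serviceSeqLaw (r : ℝ) : Measure (ℕ → ℝ) :=
  Measure.infinitePi fun _ : ℕ => expMeasure r

theorem expMeasure_lt_add {r : ℝ} (hr : 0 < r) {c s : ℝ≥0∞} (hc : c < ⊤) :
    expMeasure r {v | c < s + ENNReal.ofReal v} = if s < c then expSurvival r c s else 1 := by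
  have := isProbabilityMeasure_expMeasure hr
  split_ifs with h
  · have hset : {v : ℝ | c < s + ENNReal.ofReal v} = Set.Ioi (c - s).toReal := by
      ext v
      have hs : s ≠ ⊤ := (h.trans hc).ne
      have h1 : c - s ≠ ⊤ := (lt_of_le_of_lt tsub_le_self hc).ne
      simp only [Set.mem_ofPred_eq, Set.mem_Ioi]
      rw [← ENNReal.lt_ofReal_iff_toReal_lt h1, ENNReal.sub_lt_iff_lt_left hs h.le]
    rw [hset, expMeasure_Ioi hr ENNReal.toReal_nonneg, expSurvival]
  · have hm : MeasurableSet {v : ℝ | c < s + ENNReal.ofReal v} :=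
      measurableSet_lt measurable_const (measurable_const.add ENNReal.measurable_ofReal)
    rw [← mem_ae_iff_prob_eq_one hm]
    filter_upwards [ae_pos_expMeasure hr] with v hv
    rcases eq_or_ne s ⊤ with rfl | hs
    · simpa using hc
    · exact (not_lt.1 h).trans_lt (ENNReal.lt_add_right hs (by simpa using hv))

/-! ### Delivery times of any scheme dominate the Lindley recursion -/

namespace OnlineScheme

variable {L k n : ℕ} (S : OnlineScheme L k n)

theorem measurable_nthTime_del (hk : 0 < k) (a : ℕ → ℝ) (u : unitInterval) (m : ℕ) :
    Measurable fun x : ℕ × Fin n → ℝ => nthTime (S.del (a, x, u)) m :=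
  (measurable_nthTime m).comp ((S.measurable_del hk).comp
    (measurable_const.prodMk (measurable_id.prodMk measurable_const)))

theorem measurable_readyTime_del (hk : 0 < k) (a : ℕ → ℝ) (u : unitInterval) (m : ℕ) :
    Measurable fun x : ℕ × Fin n → ℝ => readyTime k a (S.del (a, x, u)) m :=
  (measurable_readyTime k m).comp (measurable_const.prodMk ((S.measurable_del hk).comp
    (measurable_const.prodMk (measurable_id.prodMk measurable_const))))

theorem measurable_history_del (hk : 0 < k) (a : ℕ → ℝ) (u : unitInterval) (m : ℕ) :
    Measurable fun x : ℕ × Fin n → ℝ => history (S.del (a, x, u)) m :=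
  (measurable_history m).comp ((S.measurable_del hk).comp
    (measurable_const.prodMk (measurable_id.prodMk measurable_const)))

theorem ae_readyTime_lt (hk : 0 < k) {μ : ℝ} (hμ : 0 < μ) {a : ℕ → ℝ} (ha : ValidArrivals a)
    (u : unitInterval) (m : ℕ) : ∀ᵐ x ∂expLaw n μ, nthTime (S.del (a, x, u)) m ≠ ⊤ →
      readyTime k a (S.del (a, x, u)) m < nthTime (S.del (a, x, u)) m := by
  filter_upwards [S.ae_noTies hk hμ ha u, ae_validInput (n := n) hμ ha u] with x hx hv h
  exact (S.isPath hv).readyTime_lt hk hx (lt_top_iff_ne_top.2 h)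

/-- Under any scheme, the next delivery takes at least an exponential time with rate `L μ`. -/
theorem lintegral_le_measure_lt_nthTime (hL : 0 < L) (hk : 0 < k) {μ : ℝ} (hμ : 0 < μ) {a : ℕ → ℝ}
    (ha : ValidArrivals a) (u : unitInterval) (m : ℕ) {c : ℝ≥0∞} (hc : c < ⊤) :
    ∫⁻ x, expMeasure (L * μ) {v | c < readyTime k a (S.del (a, x, u)) m + ENNReal.ofReal v}
        ∂expLaw n μ ≤ expLaw n μ {x | c < nthTime (S.del (a, x, u)) m} := by
  classical
  have hlam : 0 < (L : ℝ) * μ := mul_pos (by exact_mod_cast hL) hμ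
  have hT := S.measurable_nthTime_del hk a u m
  have hR := S.measurable_readyTime_del hk a u m
  have h1 := (S.lintegral_survival_aux hL hk hμ ha u m (f := fun _ _ => 1) (c := fun _ _ => c)
    measurable_const measurable_const (fun _ _ => le_rfl) (fun _ _ _ => hc)).1
  simp only [one_mul] at h1
  -- If the ready time is at or past `c`, the delivery exceeds `c` almost surely; otherwise the
  -- survival inequality applies.
  have hsplit : ∀ x, expMeasure (L * μ)
      {v | c < readyTime k a (S.del (a, x, u)) m + ENNReal.ofReal v} =
      (if readyTime k a (S.del (a, x, u)) m < c then
        expSurvival (L * μ) c (readyTime k a (S.del (a, x, u)) m) else 0) +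
      {x | c ≤ readyTime k a (S.del (a, x, u)) m}.indicator 1 x := by
    intro x
    rw [expMeasure_lt_add hlam hc]
    by_cases h : readyTime k a (S.del (a, x, u)) m < c
    · simp [h]
    · simp [h, not_lt.1 h]
  simp only [hsplit]
  have hle : MeasurableSet {x | c ≤ readyTime k a (S.del (a, x, u)) m} :=
    measurableSet_le measurable_const hR
  rw [lintegral_add_right _ (measurable_one.indicator hle)]
  have hlt : MeasurableSet {x | c < nthTime (S.del (a, x, u)) m} :=
    measurableSet_lt measurable_const hT
  rw [← lintegral_indicator_one hlt]
  refine (add_le_add_left h1 _).trans ?_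
  rw [← lintegral_add_right _ (measurable_one.indicator hle)]
  refine lintegral_mono_ae ?_
  filter_upwards [S.ae_readyTime_lt hk hμ ha u m] with x hx
  by_cases h : readyTime k a (S.del (a, x, u)) m < c
  · simp [h, Set.indicator_apply]
  · have : c < nthTime (S.del (a, x, u)) m := by
      by_cases hT : nthTime (S.del (a, x, u)) m = ⊤
      · rw [hT]; exact hc
      · exact (not_lt.1 h).trans_lt (hx hT)
    simp [h, not_lt.1 h, this]

/-- The last service duration is resampled; the recursion up to `l` does not involve it. -/
theorem lintegral_add_eq_of_update {r : ℝ} (hr : 0 < r) {a : ℕ → ℝ} (l : ℕ) (c : ℝ≥0∞) :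
    serviceSeqLaw r {y | c < lindley k a y (l + 1)} =
      ∫⁻ y, expMeasure r {v | c < max (lindley k a y l) (ENNReal.ofReal (a ((l + 1) / k))) +
        ENNReal.ofReal v} ∂serviceSeqLaw r := by
  have := isProbabilityMeasure_expMeasure hr
  have hm : MeasurableSet {y | c < lindley k a y (l + 1)} :=
    measurableSet_lt measurable_const
      ((measurable_lindley k (l + 1)).comp (measurable_const.prodMk measurable_id))
  rw [← lintegral_indicator_one hm, lintegral_infinitePi_update (l + 1)
    (measurable_one.indicator hm)]
  refine lintegral_congr fun y => ?_
  have hm' : MeasurableSet {v : ℝ | c < max (lindley k a y l)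
      (ENNReal.ofReal (a ((l + 1) / k))) + ENNReal.ofReal v} :=
    measurableSet_lt measurable_const (measurable_const.add ENNReal.measurable_ofReal)
  rw [← lintegral_indicator_one hm']
  refine lintegral_congr fun v => ?_
  simp only [Set.indicator_apply, Set.mem_ofPred_eq, lindley,
    lindley_update (Nat.lt_succ_self l), Function.update_self, Pi.one_apply]

/-- The delivery times under any scheme stochastically dominate the Lindley recursion with service
rate `L μ`. -/
theorem measure_lt_lindley_le (hL : 0 < L) (hk : 0 < k) {μ : ℝ} (hμ : 0 < μ) {a : ℕ → ℝ}
    (ha : ValidArrivals a) (u : unitInterval) (m : ℕ) (c : ℝ≥0∞) :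
    serviceSeqLaw (L * μ) {y | c < lindley k a y m} ≤
      expLaw n μ {x | c < nthTime (S.del (a, x, u)) m} := by
  have hlam : 0 < (L : ℝ) * μ := mul_pos (by exact_mod_cast hL) hμ
  have i1 := isProbabilityMeasure_expMeasure hlam
  have i2 := isProbabilityMeasure_expMeasure hμ
  induction m generalizing c with
  | zero =>
    rcases eq_or_ne c ⊤ with rfl | hc
    · simp
    refine le_trans (le_of_eq ?_)
      (S.lintegral_le_measure_lt_nthTime hL hk hμ ha u 0 (lt_top_iff_ne_top.2 hc))
    simp only [readyTime, lintegral_const, measure_univ, mul_one]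
    have h := (measurePreserving_eval_infinitePi (fun _ : ℕ => expMeasure (L * μ)) 0).measure_preimage
      (measurableSet_lt (f := fun _ : ℝ => c) (g := fun v : ℝ => ENNReal.ofReal (a 0) +
        ENNReal.ofReal v) measurable_const
        (measurable_const.add ENNReal.measurable_ofReal)).nullMeasurableSet
    exact h
  | succ m ih =>
    rcases eq_or_ne c ⊤ with rfl | hc
    · simp
    refine le_trans ?_
      (S.lintegral_le_measure_lt_nthTime hL hk hμ ha u (m + 1) (lt_top_iff_ne_top.2 hc))
    rw [lintegral_add_eq_of_update hlam]
    simp only [readyTime]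
    have hml : Measurable fun y => lindley k a y m :=
      (measurable_lindley k m).comp (measurable_const.prodMk measurable_id)
    have hmT := S.measurable_nthTime_del hk a u m
    -- The chance of passing `c` with one more exponential duration increases with the previous
    -- delivery time, so the stochastic order passes from `m` to `m + 1` without any coupling.
    set F : ℝ≥0∞ → ℝ≥0∞ := fun z => expMeasure (L * μ)
      {v | c < max z (ENNReal.ofReal (a ((m + 1) / k))) + ENNReal.ofReal v} with hF
    have hFm : Monotone F := by
      intro z w hzw
      refine measure_mono fun v hv => ?_
      have hv' : c < max z (ENNReal.ofReal (a ((m + 1) / k))) + ENNReal.ofReal v := hv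
      have : c < max w (ENNReal.ofReal (a ((m + 1) / k))) + ENNReal.ofReal v :=
        hv'.trans_le (by gcongr)
      exact this
    have j1 : IsProbabilityMeasure ((serviceSeqLaw (L * μ)).map fun y => lindley k a y m) :=
      Measure.isProbabilityMeasure_map hml.aemeasurable
    have j2 : IsProbabilityMeasure ((expLaw n μ).map fun x => nthTime (S.del (a, x, u)) m) :=
      Measure.isProbabilityMeasure_map hmT.aemeasurable
    have := lintegral_le_of_tail_le
      (α := (serviceSeqLaw (L * μ)).map fun y => lindley k a y m)
      (β := (expLaw n μ).map fun x => nthTime (S.del (a, x, u)) m) (fun c => by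
        rw [Measure.map_apply hml measurableSet_Ioi, Measure.map_apply hmT measurableSet_Ioi]
        exact ih c) hFm
    rwa [lintegral_map hFm.measurable hml, lintegral_map hFm.measurable hmT] at this

theorem lintegral_lindley_le (hL : 0 < L) (hk : 0 < k) {μ : ℝ} (hμ : 0 < μ) {a : ℕ → ℝ}
    (ha : ValidArrivals a) (u : unitInterval) (m : ℕ) {F : ℝ≥0∞ → ℝ≥0∞} (hF : Monotone F) :
    ∫⁻ y, F (lindley k a y m) ∂serviceSeqLaw (L * μ) ≤
      ∫⁻ x, F (nthTime (S.del (a, x, u)) m) ∂expLaw n μ := by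
  have hlam : 0 < (L : ℝ) * μ := mul_pos (by exact_mod_cast hL) hμ
  have i1 := isProbabilityMeasure_expMeasure hlam
  have i2 := isProbabilityMeasure_expMeasure hμ
  have hml : Measurable fun y => lindley k a y m :=
    (measurable_lindley k m).comp (measurable_const.prodMk measurable_id)
  have hmT := S.measurable_nthTime_del hk a u m
  have j1 : IsProbabilityMeasure ((serviceSeqLaw (L * μ)).map fun y => lindley k a y m) :=
    Measure.isProbabilityMeasure_map hml.aemeasurable
  have j2 : IsProbabilityMeasure ((expLaw n μ).map fun x => nthTime (S.del (a, x, u)) m) :=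
    Measure.isProbabilityMeasure_map hmT.aemeasurable
  have := lintegral_le_of_tail_le
    (α := (serviceSeqLaw (L * μ)).map fun y => lindley k a y m)
    (β := (expLaw n μ).map fun x => nthTime (S.del (a, x, u)) m) (fun c => by
      rw [Measure.map_apply hml measurableSet_Ioi, Measure.map_apply hmT measurableSet_Ioi]
      exact S.measure_lt_lindley_le hL hk hμ ha u m c) hF
  rwa [lintegral_map hF.measurable hml, lintegral_map hF.measurable hmT] at this

/-! ### The service durations of a work-conserving scheme -/

/-- The service duration of the `m`-th delivery. -/
noncomputable def svc (w : Input n) (m : ℕ) : ℝ :=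
  (nthTime (S.del w) m - readyTime k w.1 (S.del w) m).toReal

theorem serviceDuration_eq (w : Input n) :
    serviceDuration k w.1 (S.start w) w.2.1 = S.svc w := by
  ext m
  cases m <;> rfl

section WC

variable {S}

/-- The survival identity with the threshold at a fixed distance `t` after the ready time, on an
event of the past: whatever has happened, the chance of lasting longer than `t` is the same
exponential. -/
theorem WorkConserving.measure_survival (hS : S.WorkConserving) (hL : 0 < L) (hk : 0 < k) {μ : ℝ}
    (hμ : 0 < μ) {a : ℕ → ℝ} (ha : ValidArrivals a) (u : unitInterval) (m : ℕ)
    {B : Set (ℕ → ℝ≥0∞)} (hB : MeasurableSet B) {t : ℝ} (ht : 0 < t) :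
    ENNReal.ofReal (Real.exp (-(L * μ * t))) * expLaw n μ {x | history (S.del (a, x, u)) m ∈ B ∧
        readyTime k a (S.del (a, x, u)) m < ⊤} =
      expLaw n μ {x | history (S.del (a, x, u)) m ∈ B ∧ readyTime k a (S.del (a, x, u)) m < ⊤ ∧
        readyTime k a (S.del (a, x, u)) m + ENNReal.ofReal t < nthTime (S.del (a, x, u)) m} := by
  classical
  have hT := S.measurable_nthTime_del hk a u m
  have hR := S.measurable_readyTime_del hk a u m
  have hH := S.measurable_history_del hk a u m
  have h1 := (S.lintegral_survival_aux hL hk hμ ha u m (f := fun h _ => B.indicator 1 h)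
    (c := fun _ r => r + ENNReal.ofReal t)
    ((measurable_one.indicator hB).comp measurable_fst) (measurable_snd.add measurable_const)
    (fun h _ => Set.indicator_le_self' (fun _ _ => zero_le) h |>.trans le_rfl)
    (fun _ r h => ENNReal.add_lt_top.2 ⟨h.trans_le le_top, ENNReal.ofReal_lt_top⟩)).2 hS
  have hiff : ∀ r : ℝ≥0∞, r < r + ENNReal.ofReal t ↔ r < ⊤ := fun r =>
    ⟨fun h => h.trans_le le_top, fun h => ENNReal.lt_add_right h.ne (by simpa using ht)⟩
  simp only [hiff] at h1
  have hE1 : MeasurableSet {x | history (S.del (a, x, u)) m ∈ B ∧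
      readyTime k a (S.del (a, x, u)) m < ⊤} := (hH hB).inter (measurableSet_lt hR measurable_const)
  have hE2 : MeasurableSet {x | history (S.del (a, x, u)) m ∈ B ∧
      readyTime k a (S.del (a, x, u)) m < ⊤ ∧
      readyTime k a (S.del (a, x, u)) m + ENNReal.ofReal t < nthTime (S.del (a, x, u)) m} :=
    (hH hB).inter ((measurableSet_lt hR measurable_const).inter
      (measurableSet_lt (hR.add measurable_const) hT))
  rw [← lintegral_indicator_one hE1, ← lintegral_indicator_one hE2,
    ← lintegral_const_mul _ (measurable_one.indicator hE1)]
  refine Eq.trans (lintegral_congr fun x => ?_) (h1.trans (lintegral_congr fun x => ?_))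
  · by_cases hx : history (S.del (a, x, u)) m ∈ B
    · by_cases hr : readyTime k a (S.del (a, x, u)) m < ⊤
      · simp [hx, hr, expSurvival, ENNReal.add_sub_cancel_left hr.ne, ENNReal.toReal_ofReal ht.le]
      · simp [hr]
    · simp [hx]
  · by_cases hx : history (S.del (a, x, u)) m ∈ B
    · simp [hx, Set.indicator_apply]
    · simp [hx]

/-- By induction the ready time is finite; a delivery that never comes would survive every
threshold, and the survival probabilities tend to zero. -/
theorem WorkConserving.ae_nthTime_lt_top (hS : S.WorkConserving) (hL : 0 < L) (hk : 0 < k) {μ : ℝ}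
    (hμ : 0 < μ) {a : ℕ → ℝ} (ha : ValidArrivals a) (u : unitInterval) :
    ∀ᵐ x ∂expLaw n μ, ∀ m, nthTime (S.del (a, x, u)) m < ⊤ := by
  have hlam : 0 < (L : ℝ) * μ := mul_pos (by exact_mod_cast hL) hμ
  have i2 := isProbabilityMeasure_expMeasure hμ
  rw [ae_all_iff]
  intro m
  induction m using Nat.strong_induction_on with
  | _ m ih =>
  have hready : ∀ᵐ x ∂expLaw n μ, readyTime k a (S.del (a, x, u)) m < ⊤ := by
    cases m with
    | zero => exact Eventually.of_forall fun x => ENNReal.ofReal_lt_top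
    | succ m =>
      filter_upwards [ih m (Nat.lt_succ_self m)] with x hx
      exact max_lt hx ENNReal.ofReal_lt_top
  rw [ae_iff]
  have hbound : ∀ N : ℕ, expLaw n μ {x | ¬ nthTime (S.del (a, x, u)) m < ⊤} ≤
      ENNReal.ofReal (Real.exp (-(L * μ * (N + 1 : ℝ)))) := by
    intro N
    have h := hS.measure_survival hL hk hμ ha u m (B := Set.univ) MeasurableSet.univ
      (t := (N + 1 : ℝ)) (by positivity)
    simp only [Set.mem_univ, true_and] at h
    have h2 : expLaw n μ {x | ¬ nthTime (S.del (a, x, u)) m < ⊤} ≤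
        expLaw n μ {x | readyTime k a (S.del (a, x, u)) m < ⊤ ∧
          readyTime k a (S.del (a, x, u)) m + ENNReal.ofReal (N + 1) <
            nthTime (S.del (a, x, u)) m} := by
      refine measure_mono_ae ?_
      filter_upwards [hready] with x hx hT
      refine ⟨hx, ?_⟩
      have hT' : nthTime (S.del (a, x, u)) m = ⊤ := not_lt_top_iff.1 hT
      rw [hT']
      exact ENNReal.add_lt_top.2 ⟨hx, ENNReal.ofReal_lt_top⟩
    refine h2.trans (h.symm.le.trans ?_)
    exact mul_le_of_le_one_right' prob_le_one
  have hlim : Tendsto (fun N : ℕ => ENNReal.ofReal (Real.exp (-(L * μ * (N + 1 : ℝ))))) atTop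
      (𝓝 0) := by
    rw [← ENNReal.ofReal_zero]
    refine ENNReal.tendsto_ofReal (Real.tendsto_exp_neg_atTop_nhds_zero.comp ?_)
    exact (tendsto_atTop_add_const_right _ _ tendsto_natCast_atTop_atTop).const_mul_atTop hlam
  exact le_antisymm (ge_of_tendsto' hlim hbound) zero_le

theorem WorkConserving.ae_readyTime_lt_nthTime (hS : S.WorkConserving) (hL : 0 < L) (hk : 0 < k)
    {μ : ℝ} (hμ : 0 < μ) {a : ℕ → ℝ} (ha : ValidArrivals a) (u : unitInterval) :
    ∀ᵐ x ∂expLaw n μ, ∀ m, nthTime (S.del (a, x, u)) m < ⊤ ∧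
      readyTime k a (S.del (a, x, u)) m < nthTime (S.del (a, x, u)) m := by
  filter_upwards [hS.ae_nthTime_lt_top hL hk hμ ha u,
    ae_all_iff.2 (S.ae_readyTime_lt hk hμ ha u)] with x h1 h2 m
  exact ⟨h1 m, h2 m (h1 m).ne⟩

/-- The service duration as a function of the delivery times. -/
noncomputable def svcOf (k : ℕ) (a : ℕ → ℝ) (T : ℕ → ℝ≥0∞) : ℕ → ℝ
  | 0 => (T 0 - ENNReal.ofReal (a 0)).toReal
  | m + 1 => (T (m + 1) - max (T m) (ENNReal.ofReal (a ((m + 1) / k)))).toReal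

theorem measurable_svcOf (k : ℕ) (m : ℕ) :
    Measurable fun z : (ℕ → ℝ) × (ℕ → ℝ≥0∞) => svcOf k z.1 z.2 m := by
  cases m with
  | zero =>
    exact (((measurable_pi_apply 0).comp measurable_snd).sub
      ((measurable_pi_apply 0).comp measurable_fst).ennreal_ofReal).ennreal_toReal
  | succ m =>
    exact (((measurable_pi_apply (m + 1)).comp measurable_snd).sub
      (((measurable_pi_apply m).comp measurable_snd).max
        ((measurable_pi_apply _).comp measurable_fst).ennreal_ofReal)).ennreal_toReal

/-- Earlier durations are functions of the history, so independence from the history gives mutual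
independence. -/
theorem svcOf_history (w : Input n) {l m : ℕ} (h : l < m) :
    svcOf k w.1 (history (S.del w) m) l = S.svc w l := by
  cases l with
  | zero => simp [svcOf, svc, history, h, readyTime]
  | succ l => simp [svcOf, svc, history, h, readyTime, (Nat.lt_succ_self l).trans h]

theorem measurable_svc (hk : 0 < k) (m : ℕ) : Measurable fun w : Input n => S.svc w m := by
  have hd := S.measurable_del hk
  exact (((measurable_nthTime m).comp hd).sub
    ((measurable_readyTime k m).comp (measurable_fst.prodMk hd))).ennreal_toReal

/-- The service durations of a work-conserving scheme are i.i.d. exponential with rate `L μ`. -/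
theorem WorkConserving.map_svc (hS : S.WorkConserving) (hL : 0 < L) (hk : 0 < k)
    {μ : ℝ} (hμ : 0 < μ) {a : ℕ → ℝ} (ha : ValidArrivals a) (u : unitInterval) :
    (expLaw n μ).map (fun x => S.svc (a, x, u)) = serviceSeqLaw (L * μ) := by
  have hlam : 0 < (L : ℝ) * μ := mul_pos (by exact_mod_cast hL) hμ
  have i1 := isProbabilityMeasure_expMeasure hlam
  have i2 := isProbabilityMeasure_expMeasure hμ
  have hin : Measurable fun x : ℕ × Fin n → ℝ => ((a, x, u) : Input n) :=
    measurable_const.prodMk (measurable_id.prodMk measurable_const)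
  have hsm : ∀ m, Measurable fun x : ℕ × Fin n → ℝ => S.svc (a, x, u) m := fun m =>
    (measurable_svc hk m).comp hin
  have hR := hS.ae_readyTime_lt_nthTime hL hk hμ ha u
  -- The `m`-th duration is exponential and independent of the history. The survival identity gives
  -- this on half-lines, and a finite measure on the line is determined by them.
  have hstep : ∀ (m : ℕ) (B : Set (ℕ → ℝ≥0∞)), MeasurableSet B → ∀ C : Set ℝ, MeasurableSet C →
      expLaw n μ {x | history (S.del (a, x, u)) m ∈ B ∧ S.svc (a, x, u) m ∈ C} =
        expLaw n μ {x | history (S.del (a, x, u)) m ∈ B} * expMeasure (L * μ) C := by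
    intro m B hB
    have hEB : MeasurableSet {x | history (S.del (a, x, u)) m ∈ B} :=
      S.measurable_history_del hk a u m hB
    have htail : ∀ t : ℝ, expLaw n μ {x | history (S.del (a, x, u)) m ∈ B ∧
        t < S.svc (a, x, u) m} = expLaw n μ {x | history (S.del (a, x, u)) m ∈ B} *
        expMeasure (L * μ) (Set.Ioi t) := by
      intro t
      rcases lt_trichotomy t 0 with ht | rfl | ht
      · have h1 : expMeasure (L * μ) (Set.Ioi t) = 1 := by
          rw [← mem_ae_iff_prob_eq_one measurableSet_Ioi]
          filter_upwards [ae_pos_expMeasure hlam] with v hv using ht.trans hv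
        rw [h1, mul_one]
        congr 1
        ext x
        have : 0 ≤ S.svc (a, x, u) m := ENNReal.toReal_nonneg
        simp only [Set.mem_ofPred_eq, and_iff_left_iff_imp]
        intro; linarith
      · rw [expMeasure_Ioi hlam le_rfl]
        simp only [mul_zero, neg_zero, Real.exp_zero, ENNReal.ofReal_one, mul_one]
        refine measure_congr ?_
        filter_upwards [hR] with x hx
        refine propext (and_iff_left ?_)
        exact ENNReal.toReal_pos (tsub_pos_of_lt (hx m).2).ne'
          (lt_of_le_of_lt tsub_le_self (hx m).1).ne
      · rw [expMeasure_Ioi hlam ht.le, mul_comm]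
        have h := hS.measure_survival hL hk hμ ha u m hB ht
        have e1 : expLaw n μ {x | history (S.del (a, x, u)) m ∈ B ∧
            readyTime k a (S.del (a, x, u)) m < ⊤} =
            expLaw n μ {x | history (S.del (a, x, u)) m ∈ B} := by
          refine measure_congr ?_
          filter_upwards [hR] with x hx
          exact propext (and_iff_left ((hx m).2.trans (hx m).1))
        rw [e1] at h
        rw [h]
        refine measure_congr ?_
        filter_upwards [hR] with x hx
        refine propext (and_congr_right fun _ => ?_)
        have hr := (hx m).2.trans (hx m).1
        change t < (nthTime (S.del (a, x, u)) m - readyTime k a (S.del (a, x, u)) m).toReal ↔ _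
        rw [← ENNReal.ofReal_lt_iff_lt_toReal ht.le (lt_of_le_of_lt tsub_le_self (hx m).1).ne,
          lt_tsub_iff_left]
        exact ⟨fun h => ⟨hr, h⟩, fun h => h.2⟩
    set κ : Measure ℝ := ((expLaw n μ).restrict {x | history (S.del (a, x, u)) m ∈ B}).map
      fun x => S.svc (a, x, u) m with hκ
    have hκa : ∀ C, MeasurableSet C → κ C =
        expLaw n μ {x | history (S.del (a, x, u)) m ∈ B ∧ S.svc (a, x, u) m ∈ C} := by
      intro C hC
      rw [hκ, Measure.map_apply (hsm m) hC, Measure.restrict_apply ((hsm m) hC)]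
      congr 1
      ext x
      exact and_comm
    have hκf : IsFiniteMeasure κ := by rw [hκ]; infer_instance
    have hκeq : κ = expLaw n μ {x | history (S.del (a, x, u)) m ∈ B} • expMeasure (L * μ) := by
      have hu : κ Set.univ = expLaw n μ {x | history (S.del (a, x, u)) m ∈ B} := by
        rw [hκa _ MeasurableSet.univ]; simp
      refine Measure.ext_of_Iic _ _ fun t => ?_
      have h1 : κ (Set.Iic t) = κ Set.univ - κ (Set.Ioi t) := by
        rw [← Set.compl_Ioi, measure_compl measurableSet_Ioi (measure_ne_top _ _)]
      have h2 : expMeasure (L * μ) (Set.Iic t) = 1 - expMeasure (L * μ) (Set.Ioi t) := by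
        rw [← Set.compl_Ioi, prob_compl_eq_one_sub measurableSet_Ioi]
      have h3 : κ (Set.Ioi t) = _ := (hκa _ measurableSet_Ioi).trans (htail t)
      rw [h1, hu, h3, Measure.smul_apply, smul_eq_mul, h2, ENNReal.mul_sub, mul_one]
      intros
      exact measure_ne_top _ _
    intro C hC
    rw [← hκa C hC, hκeq, Measure.smul_apply, smul_eq_mul]
  have hprod : ∀ (B : ℕ → Set ℝ), (∀ l, MeasurableSet (B l)) → ∀ m,
      expLaw n μ {x | ∀ l < m, S.svc (a, x, u) l ∈ B l} =
        ∏ l ∈ Finset.range m, expMeasure (L * μ) (B l) := by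
    intro B hB m
    induction m with
    | zero => simp
    | succ m ih =>
      have hBm : MeasurableSet {h : ℕ → ℝ≥0∞ | ∀ l < m, svcOf k a h l ∈ B l} := by
        have : {h : ℕ → ℝ≥0∞ | ∀ l < m, svcOf k a h l ∈ B l} =
            ⋂ l ∈ {l | l < m}, {h : ℕ → ℝ≥0∞ | svcOf k a h l ∈ B l} := by
          ext h; simp
        rw [this]
        refine MeasurableSet.biInter (Set.to_countable _) fun l _ => ?_
        exact ((measurable_svcOf k l).comp (measurable_const.prodMk measurable_id)) (hB l)
      have h1 := hstep m _ hBm (B m) (hB m)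
      have h2 : {x | history (S.del (a, x, u)) m ∈
          {h : ℕ → ℝ≥0∞ | ∀ l < m, svcOf k a h l ∈ B l}} =
          {x | ∀ l < m, S.svc (a, x, u) l ∈ B l} := by
        ext x
        refine forall_congr' fun l => forall_congr' fun hl => ?_
        rw [← svcOf_history (S := S) (a, x, u) hl]
      have h3 : {x | ∀ l < m + 1, S.svc (a, x, u) l ∈ B l} =
          {x | history (S.del (a, x, u)) m ∈
          {h : ℕ → ℝ≥0∞ | ∀ l < m, svcOf k a h l ∈ B l} ∧ S.svc (a, x, u) m ∈ B m} := by
        ext x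
        have h4 : history (S.del (a, x, u)) m ∈
          {h : ℕ → ℝ≥0∞ | ∀ l < m, svcOf k a h l ∈ B l} ↔ ∀ l < m, S.svc (a, x, u) l ∈ B l := by
          have := Set.ext_iff.1 h2 x
          exact this
        simp only [Set.mem_ofPred_eq (p := fun x => _ ∧ _)]
        rw [h4]
        constructor
        · exact fun h => ⟨fun l hl => h l (by omega), h m (Nat.lt_succ_self m)⟩
        · rintro ⟨h5, h6⟩ l hl
          rcases Nat.lt_succ_iff_lt_or_eq.1 hl with h7 | rfl
          · exact h5 l h7
          · exact h6
      rw [h3, h1, h2, ih, Finset.prod_range_succ]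
  refine Measure.eq_infinitePi _ fun s t ht => ?_
  classical
  have hsvcm : Measurable fun x : ℕ × Fin n → ℝ => S.svc (a, x, u) := measurable_pi_lambda _ hsm
  rw [Measure.map_apply hsvcm (MeasurableSet.pi s.countable_toSet fun i _ => ht i)]
  obtain ⟨M, hM⟩ := s.exists_nat_subset_range
  have h := hprod (fun l => if l ∈ s then t l else Set.univ)
    (fun l => by split_ifs; exacts [ht l, MeasurableSet.univ]) M
  have hset : (fun x => S.svc (a, x, u)) ⁻¹' Set.pi (s : Set ℕ) t =
      {x | ∀ l < M, S.svc (a, x, u) l ∈ if l ∈ s then t l else Set.univ} := by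
    ext x
    simp only [Set.mem_preimage, Set.mem_pi, Finset.mem_coe, Set.mem_ofPred_eq]
    constructor
    · intro h l _
      split_ifs with hl
      · exact h l hl
      · exact Set.mem_univ _
    · intro h l hl
      have := h l (Finset.mem_range.1 (hM hl))
      rwa [if_pos hl] at this
  rw [hset, h]
  rw [← Finset.prod_subset hM]
  · exact Finset.prod_congr rfl fun l hl => by rw [if_pos hl]
  · intro l _ hl
    rw [if_neg hl, measure_univ]

end WC

end OnlineScheme

/-! ### Delays and the Lindley recursion -/

-- Delays and waiting times become time integrals of indicators, so that they can be compared by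
-- counting at each instant.
open Classical in
theorem lintegral_interval (z₁ z₂ : ℝ≥0∞) (h₁ : z₁ < ⊤) :
    ∫⁻ t in Set.Ioi (0 : ℝ), (if z₁ ≤ ENNReal.ofReal t ∧ ENNReal.ofReal t < z₂ then 1 else 0) =
      z₂ - z₁ := by
  rcases le_or_gt z₁ z₂ with h | h
  · refine ENNReal.eq_sub_of_add_eq h₁.ne ?_
    rw [add_comm]
    have hm : ∀ z : ℝ≥0∞, MeasurableSet {s : ℝ | ENNReal.ofReal s < z} := fun z =>
      measurableSet_lt ENNReal.measurable_ofReal measurable_const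
    have e1 := lintegral_indicator_lt z₁
    have e2 := lintegral_indicator_lt z₂
    calc _ = (∫⁻ s in Set.Ioi (0 : ℝ), {s : ℝ | ENNReal.ofReal s < z₁}.indicator 1 s) +
        ∫⁻ t in Set.Ioi (0 : ℝ),
          (if z₁ ≤ ENNReal.ofReal t ∧ ENNReal.ofReal t < z₂ then 1 else 0) := by rw [e1]
      _ = _ := (lintegral_add_left (measurable_one.indicator (hm _)) _).symm
      _ = ∫⁻ s in Set.Ioi (0 : ℝ), {s : ℝ | ENNReal.ofReal s < z₂}.indicator 1 s := ?_
      _ = z₂ := e2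
    refine lintegral_congr fun t => ?_
    simp only [Set.indicator_apply, Set.mem_ofPred_eq, Pi.one_apply]
    by_cases h1 : ENNReal.ofReal t < z₁
    · simp [h1, h1.trans_le h, not_le.2 h1]
    · by_cases h2 : ENNReal.ofReal t < z₂
      · simp [h1, h2, not_lt.1 h1]
      · simp [h1, h2]
  · rw [tsub_eq_zero_of_le h.le]
    have : ∀ t : ℝ, ¬(z₁ ≤ ENNReal.ofReal t ∧ ENNReal.ofReal t < z₂) := fun t ht =>
      absurd (ht.1.trans_lt ht.2) (not_lt.2 h.le)
    simp [this]

/-- The Lindley recursion for a server that does not wait for any request from number `M` on. -/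
noncomputable def lindleyCut (k M : ℕ) (a : ℕ → ℝ) (y : ℕ → ℝ) : ℕ → ℝ≥0∞
  | 0 => ENNReal.ofReal (a 0) + ENNReal.ofReal (y 0)
  | l + 1 => (if l + 1 < k * M then
      max (lindleyCut k M a y l) (ENNReal.ofReal (a ((l + 1) / k))) else lindleyCut k M a y l) +
        ENNReal.ofReal (y (l + 1))

theorem lindleyCut_mono (k M : ℕ) (a y : ℕ → ℝ) : Monotone (lindleyCut k M a y) := by
  refine monotone_nat_of_le_succ fun l => ?_
  rw [lindleyCut]
  refine le_trans ?_ le_self_add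
  split_ifs
  · exact le_max_left _ _
  · exact le_rfl

theorem measurable_lindleyCut (k M l : ℕ) :
    Measurable fun z : (ℕ → ℝ) × (ℕ → ℝ) => lindleyCut k M z.1 z.2 l := by
  induction l with
  | zero =>
    exact ((measurable_pi_apply 0).comp measurable_fst).ennreal_ofReal.add
      ((measurable_pi_apply 0).comp measurable_snd).ennreal_ofReal
  | succ l ih =>
    refine Measurable.add ?_ ((measurable_pi_apply _).comp measurable_snd).ennreal_ofReal
    split_ifs
    · exact ih.max ((measurable_pi_apply _).comp measurable_fst).ennreal_ofReal
    · exact ih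

theorem arrival_le_lindleyCut {k M l : ℕ} (hl : l < k * M) (a y : ℕ → ℝ) :
    ENNReal.ofReal (a (l / k)) ≤ lindleyCut k M a y l := by
  cases l with
  | zero => simp [lindleyCut]
  | succ l =>
    rw [lindleyCut, if_pos hl]
    exact (le_max_right _ _).trans le_self_add

/-- The Lindley recursion is a maximum over the starts of a busy period. -/
theorem exists_lindleyCut_eq {k M : ℕ} (hk : 0 < k) (hM : 0 < M) {a y : ℕ → ℝ}
    (ha : ValidArrivals a) (hy : ∀ l, 0 ≤ y l) (l : ℕ) :
    ∃ i < M, k * i ≤ l ∧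
      lindleyCut k M a y l = ENNReal.ofReal (a i + ∑ q ∈ Finset.Ico (k * i) (l + 1), y q) := by
  induction l with
  | zero => exact ⟨0, hM, by simp, by simp [lindleyCut, ENNReal.ofReal_add (ha.1 0) (hy 0)]⟩
  | succ l ih =>
    obtain ⟨i, hi, hil, he⟩ := ih
    have hsame : lindleyCut k M a y l + ENNReal.ofReal (y (l + 1)) =
        ENNReal.ofReal (a i + ∑ q ∈ Finset.Ico (k * i) (l + 1 + 1), y q) := by
      rw [he, Finset.sum_Ico_succ_top (show k * i ≤ l + 1 by omega), ← add_assoc,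
        ENNReal.ofReal_add _ (hy _)]
      exact add_nonneg (ha.1 _) (Finset.sum_nonneg fun q _ => hy q)
    rw [lindleyCut]
    split_ifs with hlt
    · by_cases hmax : ENNReal.ofReal (a ((l + 1) / k)) ≤ lindleyCut k M a y l
      · exact ⟨i, hi, by omega, by rw [max_eq_left hmax, hsame]⟩
      · have hdvd : k ∣ l + 1 := by
          by_contra hnd
          have : (l + 1) / k = l / k := Nat.succ_div_of_not_dvd hnd
          rw [this] at hmax
          exact hmax (arrival_le_lindleyCut (by omega) a y)
        obtain ⟨j, hj⟩ := hdvd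
        have hjk : (l + 1) / k = j := by rw [hj]; exact Nat.mul_div_cancel_left j hk
        refine ⟨j, ?_, hj.ge, ?_⟩
        · rw [hj] at hlt
          exact Nat.lt_of_mul_lt_mul_left hlt
        · rw [max_eq_right (not_le.1 hmax).le, hjk, ← hj]
          simp [ENNReal.ofReal_add (ha.1 j) (hy _)]
    · exact ⟨i, hi, by omega, hsame⟩

/-- Unrolling the recursion from the first chunk of request `i`: every possible start of the busy
period gives a lower bound, and `exists_lindleyCut_eq` shows that some start attains the value. -/
theorem le_lindley {k : ℕ} (hk : 0 < k) {a y : ℕ → ℝ} {i l : ℕ}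
    (hil : k * i ≤ l) :
    ENNReal.ofReal (a i + ∑ q ∈ Finset.Ico (k * i) (l + 1), y q) ≤ lindley k a y l := by
  have harr : ENNReal.ofReal (a i) + ENNReal.ofReal (y (k * i)) ≤ lindley k a y (k * i) := by
    rcases Nat.eq_zero_or_pos i with rfl | hi
    · simp [lindley]
    · obtain ⟨j, hj⟩ : ∃ j, k * i = j + 1 :=
        ⟨k * i - 1, (Nat.succ_pred_eq_of_pos (Nat.mul_pos hk hi)).symm⟩
      have : (j + 1) / k = i := by rw [← hj]; exact Nat.mul_div_cancel_left i hk
      rw [hj, lindley, this]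
      gcongr
      exact le_max_right _ _
  induction l, hil using Nat.le_induction with
  | base =>
    simp only [Nat.Ico_succ_singleton, Finset.sum_singleton]
    exact ENNReal.ofReal_add_le.trans harr
  | succ l hl ih =>
    rw [Finset.sum_Ico_succ_top (by omega), ← add_assoc, lindley]
    refine ENNReal.ofReal_add_le.trans ?_
    gcongr
    exact ih.trans (le_max_left _ _)

/-! ### Pathwise comparison of total delays with waiting times of chunks -/

namespace OnlineScheme

variable {L k n : ℕ} {S : OnlineScheme L k n}

theorem nthTime_eq_lindley {w : Input n}
    (hw : ∀ m, nthTime (S.del w) m < ⊤ ∧ readyTime k w.1 (S.del w) m < nthTime (S.del w) m)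
    (m : ℕ) : nthTime (S.del w) m = lindley k w.1 (S.svc w) m := by
  have hstep : ∀ m, nthTime (S.del w) m =
      readyTime k w.1 (S.del w) m + ENNReal.ofReal (S.svc w m) := by
    intro m
    have h1 := (lt_of_le_of_lt (tsub_le_self (b := readyTime k w.1 (S.del w) m)) (hw m).1).ne
    rw [svc, ENNReal.ofReal_toReal h1, add_tsub_cancel_of_le (hw m).2.le]
  induction m with
  | zero => rw [hstep]; rfl
  | succ m ih => rw [hstep, lindley, ← ih]; rfl

/-- While one of the first `M` requests is still in the system, the server has not waited for a
request from number `M` on. At the moment of such a wait all chunks of all arrived requests would be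
delivered and the system empty, yet that early request had arrived and would depart only later. -/
theorem lindleyCut_eq {w : Input n} (hk : 0 < k) (hv : ValidInput w) (hd : NoTies (S.del w))
    (hw : ∀ m, nthTime (S.del w) m < ⊤ ∧ readyTime k w.1 (S.del w) m < nthTime (S.del w) m)
    {M i : ℕ} (hi : i < M) {t : ℝ≥0∞} (ht : t < ⊤) (hin : InSystem k w.1 (S.start w) w.2.1 t i)
    {l : ℕ} (hl : l ≤ countUpTo (S.del w) t) :
    lindleyCut k M w.1 (S.svc w) l = nthTime (S.del w) l := by
  have hP := S.isPath hv
  have hloc : LocFinite (S.del w) := hP.locFinite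
  rw [nthTime_eq_lindley hw]
  induction l with
  | zero => rfl
  | succ l ih =>
    rw [lindleyCut, lindley, ih (by omega)]
    split_ifs with hlt
    · rfl
    · congr 1
      refine (max_eq_left ?_).symm
      rw [← nthTime_eq_lindley hw]
      by_contra! hgt
      have hTl := (hw l).1
      have hcount : countUpTo (S.del w) (nthTime (S.del w) l) = l + 1 :=
        hd.countUpTo_nthTime hloc hTl
      have hTt : nthTime (S.del w) l ≤ t := (hloc.lt_nthTime_iff ht).2 (by omega)
      have harr : arrivalCount w.1 (nthTime (S.del w) l) ≤ (l + 1) / k := by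
        by_contra! hc
        exact absurd ((hP.valid.lt_arrivalCount_iff hTl _).1 hc) (not_le.2 hgt)
      have h1 := hP.card_inSystem_add_le hk hd hTl
      have h1' : {i | InSystem k w.1 (S.start w) w.2.1 (nthTime (S.del w) l) i}.ncard + (l + 1) ≤
          k * arrivalCount w.1 (nthTime (S.del w) l) := by
        rw [← hcount]; exact h1
      have h2 : k * arrivalCount w.1 (nthTime (S.del w) l) ≤ l + 1 :=
        (Nat.mul_le_mul_left k harr).trans (Nat.mul_div_le _ _)
      have h3 : {i | InSystem k w.1 (S.start w) w.2.1 (nthTime (S.del w) l) i}.ncard = 0 := by omega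
      rw [Set.ncard_eq_zero (hP.finite_inSystem hTl)] at h3
      have h4 : i < arrivalCount w.1 (nthTime (S.del w) l) := by
        have : k * M ≤ k * arrivalCount w.1 (nthTime (S.del w) l) := by omega
        exact hi.trans_le (Nat.le_of_mul_le_mul_left this hk)
      refine Set.eq_empty_iff_forall_notMem.1 h3 i ⟨?_, hTt.trans_lt hin.2⟩
      exact (hP.valid.lt_arrivalCount_iff hTl i).1 h4

/-- The total delay of the first `M` requests of a work-conserving scheme. -/
theorem sum_delay_le {w : Input n} (hk : 0 < k) (hv : ValidInput w)
    (hd : NoTies (S.del w))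
    (hw : ∀ m, nthTime (S.del w) m < ⊤ ∧ readyTime k w.1 (S.del w) m < nthTime (S.del w) m)
    (M : ℕ) : ∑ i ∈ Finset.range M, S.delay w i ≤
      ∑' l, (lindleyCut k M w.1 (S.svc w) l - ENNReal.ofReal (w.1 (l / k))) := by
  classical
  have hP := S.isPath hv
  have hloc : LocFinite (S.del w) := hP.locFinite
  have hm : ∀ z₁ z₂ : ℝ≥0∞, Measurable fun t : ℝ =>
      (if z₁ ≤ ENNReal.ofReal t ∧ ENNReal.ofReal t < z₂ then (1 : ℝ≥0∞) else 0) := fun z₁ z₂ =>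
    Measurable.ite ((measurableSet_le measurable_const ENNReal.measurable_ofReal).inter
      (measurableSet_lt ENNReal.measurable_ofReal measurable_const)) measurable_const
      measurable_const
  have hl : ∑ i ∈ Finset.range M, S.delay w i = ∫⁻ t in Set.Ioi (0 : ℝ),
      ∑ i ∈ Finset.range M, (if ENNReal.ofReal (w.1 i) ≤ ENNReal.ofReal t ∧
        ENNReal.ofReal t < departureTime k (S.start w) w.2.1 i then (1 : ℝ≥0∞) else 0) := by
    rw [lintegral_finsetSum _ fun i _ => hm _ _]
    exact Finset.sum_congr rfl fun i _ => (lintegral_interval _ _ ENNReal.ofReal_lt_top).symm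
  have hr : ∑' l, (lindleyCut k M w.1 (S.svc w) l - ENNReal.ofReal (w.1 (l / k))) =
      ∫⁻ t in Set.Ioi (0 : ℝ), ∑' l, (if ENNReal.ofReal (w.1 (l / k)) ≤ ENNReal.ofReal t ∧
        ENNReal.ofReal t < lindleyCut k M w.1 (S.svc w) l then (1 : ℝ≥0∞) else 0) := by
    rw [lintegral_tsum fun l => (hm _ _).aemeasurable]
    exact tsum_congr fun l => (lintegral_interval _ _ ENNReal.ofReal_lt_top).symm
  rw [hl, hr]
  refine lintegral_mono fun t => ?_
  have htt : ENNReal.ofReal t < ⊤ := ENNReal.ofReal_lt_top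
  set τ := ENNReal.ofReal t
  by_cases hex : ∃ i < M, InSystem k w.1 (S.start w) w.2.1 τ i
  swap
  · rw [Finset.sum_eq_zero]
    · exact zero_le
    · intro i hi
      exact if_neg fun h => hex ⟨i, Finset.mem_range.1 hi, h⟩
  obtain ⟨i, hi, hin⟩ := hex
  set q := countUpTo (S.del w) τ
  -- After `q` deliveries the next one is still to come; up to that index the cut recursion gives
  -- the true delivery times, and by monotonicity all later indices are pending as well.
  have hq : τ < lindleyCut k M w.1 (S.svc w) q := by
    rw [lindleyCut_eq hk hv hd hw hi htt hin le_rfl]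
    by_contra! hc
    exact lt_irrefl _ ((hloc.lt_nthTime_iff htt).1 hc)
  have h1 := hP.card_inSystem_add_le hk hd htt
  have h2 : ((Finset.range M).filter fun i => ENNReal.ofReal (w.1 i) ≤ τ ∧
      τ < departureTime k (S.start w) w.2.1 i).card ≤
      {i | InSystem k w.1 (S.start w) w.2.1 τ i}.ncard := by
    rw [← Set.ncard_coe_finset]
    refine Set.ncard_le_ncard ?_ (hP.finite_inSystem htt)
    intro j hj
    exact (Finset.mem_filter.1 hj).2
  -- Each request in the system lacks at least one chunk, and the missing chunks are indexed from
  -- `q` to `k` times the number of arrivals. The indices beyond `k * M` are kept, since the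
  -- deliveries so far may have gone to later requests.
  have h3 : ((Finset.range M).filter fun i => ENNReal.ofReal (w.1 i) ≤ τ ∧
      τ < departureTime k (S.start w) w.2.1 i).card ≤
      (Finset.Ico q (k * arrivalCount w.1 τ)).card := by
    rw [Nat.card_Ico]
    have : {i | InSystem k w.1 (S.start w) w.2.1 τ i}.ncard + q ≤ k * arrivalCount w.1 τ := h1
    omega
  rw [← Finset.natCast_card_filter]
  calc (((Finset.range M).filter fun i => ENNReal.ofReal (w.1 i) ≤ τ ∧
      τ < departureTime k (S.start w) w.2.1 i).card : ℝ≥0∞)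
      ≤ ((Finset.Ico q (k * arrivalCount w.1 τ)).card : ℝ≥0∞) := by exact_mod_cast h3
    _ = ∑ l ∈ Finset.Ico q (k * arrivalCount w.1 τ), (1 : ℝ≥0∞) := by simp
    _ ≤ ∑ l ∈ Finset.Ico q (k * arrivalCount w.1 τ),
        (if ENNReal.ofReal (w.1 (l / k)) ≤ τ ∧
          τ < lindleyCut k M w.1 (S.svc w) l then (1 : ℝ≥0∞) else 0) := by
        refine Finset.sum_le_sum fun l hl => ?_
        obtain ⟨hl1, hl2⟩ := Finset.mem_Ico.1 hl
        rw [if_pos]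
        refine ⟨?_, hq.trans_le (lindleyCut_mono _ _ _ _ hl1)⟩
        rw [← hP.valid.lt_arrivalCount_iff htt]
        exact Nat.div_lt_of_lt_mul hl2
    _ ≤ _ := ENNReal.sum_le_tsum _

/-- The total delay of the first `M` requests of any scheme. -/
theorem le_sum_delay {w : Input n} (hk : 0 < k) (hv : ValidInput w) (M : ℕ) :
    ∑ l ∈ Finset.range (k * M), (nthTime (S.del w) l - ENNReal.ofReal (w.1 (l / k))) ≤
      k * ∑ i ∈ Finset.range M, S.delay w i := by
  classical
  have hP := S.isPath hv
  have hloc : LocFinite (S.del w) := hP.locFinite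
  have hm : ∀ z₁ z₂ : ℝ≥0∞, Measurable fun t : ℝ =>
      (if z₁ ≤ ENNReal.ofReal t ∧ ENNReal.ofReal t < z₂ then (1 : ℝ≥0∞) else 0) := fun z₁ z₂ =>
    Measurable.ite ((measurableSet_le measurable_const ENNReal.measurable_ofReal).inter
      (measurableSet_lt ENNReal.measurable_ofReal measurable_const)) measurable_const
      measurable_const
  have hl : ∑ i ∈ Finset.range M, S.delay w i = ∫⁻ t in Set.Ioi (0 : ℝ),
      ∑ i ∈ Finset.range M, (if ENNReal.ofReal (w.1 i) ≤ ENNReal.ofReal t ∧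
        ENNReal.ofReal t < departureTime k (S.start w) w.2.1 i then (1 : ℝ≥0∞) else 0) := by
    rw [lintegral_finsetSum _ fun i _ => hm _ _]
    exact Finset.sum_congr rfl fun i _ => (lintegral_interval _ _ ENNReal.ofReal_lt_top).symm
  have hr : ∑ l ∈ Finset.range (k * M), (nthTime (S.del w) l - ENNReal.ofReal (w.1 (l / k))) =
      ∫⁻ t in Set.Ioi (0 : ℝ), ∑ l ∈ Finset.range (k * M),
        (if ENNReal.ofReal (w.1 (l / k)) ≤ ENNReal.ofReal t ∧
        ENNReal.ofReal t < nthTime (S.del w) l then (1 : ℝ≥0∞) else 0) := by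
    rw [lintegral_finsetSum _ fun i _ => hm _ _]
    exact Finset.sum_congr rfl fun i _ => (lintegral_interval _ _ ENNReal.ofReal_lt_top).symm
  rw [hl, hr, ← lintegral_const_mul _ (Finset.measurable_sum _ fun i _ => hm _ _)]
  refine lintegral_mono fun t => ?_
  have htt : ENNReal.ofReal t < ⊤ := ENNReal.ofReal_lt_top
  set τ := ENNReal.ofReal t
  rw [← Finset.natCast_card_filter, ← Finset.natCast_card_filter]
  set A := arrivalCount w.1 τ
  set q := countUpTo (S.del w) τ with hq
  -- The pending indices lie between the number of deliveries and `k` times the number of arrivals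
  -- among the first `M` requests.
  have h1 : (Finset.range (k * M)).filter (fun l => ENNReal.ofReal (w.1 (l / k)) ≤ τ ∧
      τ < nthTime (S.del w) l) ⊆ Finset.Ico q (k * min M A) := by
    intro l hl
    obtain ⟨hl1, hl2, hl3⟩ := Finset.mem_filter.1 hl
    rw [Finset.mem_Ico]
    constructor
    · by_contra! hc
      exact absurd ((hloc.lt_nthTime_iff htt).2 hc) (not_le.2 hl3)
    · have h2 : l / k < min M A := lt_min (Nat.div_lt_of_lt_mul (Finset.mem_range.1 hl1))
        ((hP.valid.lt_arrivalCount_iff htt _).2 hl2)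
      rw [Nat.div_lt_iff_lt_mul hk, mul_comm] at h2
      exact h2
  have h2 := Finset.card_le_card h1
  rw [Nat.card_Ico] at h2
  set B := (Finset.range M).filter (fun i => ENNReal.ofReal (w.1 i) ≤ τ ∧
      τ < departureTime k (S.start w) w.2.1 i)
  -- An arrived request has either `k` deliveries or is counted in `B`.
  have h3 : k * (min M A) ≤ q + k * B.card := by
    have h4 : q = ∑ i ∈ Finset.range A, reqCount (S.del w) τ i := hP.countUpTo_eq_sum htt
    have h5 : ∑ i ∈ Finset.range (min M A), k ≤
        ∑ i ∈ Finset.range (min M A), (reqCount (S.del w) τ i + if i ∈ B then k else 0) := by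
      refine Finset.sum_le_sum fun i hi => ?_
      obtain ⟨hi1, hi2⟩ := lt_min_iff.1 (Finset.mem_range.1 hi)
      split_ifs with hB
      · omega
      · rw [add_zero]
        refine (le_reqCount_iff hk htt).2 ?_
        by_contra! hc
        exact hB (Finset.mem_filter.2 ⟨Finset.mem_range.2 hi1,
          (hP.valid.lt_arrivalCount_iff htt i).1 hi2, hc⟩)
    rw [Finset.sum_add_distrib] at h5
    have h6 : ∑ i ∈ Finset.range (min M A), reqCount (S.del w) τ i ≤ q := by
      rw [h4]
      exact Finset.sum_le_sum_of_subset (Finset.range_mono (min_le_right _ _))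
    have h7 : ∑ i ∈ Finset.range (min M A), (if i ∈ B then k else 0) ≤ k * B.card := by
      rw [← Finset.sum_filter, Finset.sum_const, smul_eq_mul, mul_comm]
      exact Nat.mul_le_mul_left k (Finset.card_le_card fun i hi => (Finset.mem_filter.1 hi).2)
    rw [Finset.sum_const, Finset.card_range, smul_eq_mul, mul_comm] at h5
    omega
  have h8 : ((Finset.range (k * M)).filter (fun l => ENNReal.ofReal (w.1 (l / k)) ≤ τ ∧
      τ < nthTime (S.del w) l)).card ≤ k * B.card := by omega
  rw [← Nat.cast_mul, Nat.cast_le]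
  convert h8

end OnlineScheme

/-! ### Disintegration of the law of the input -/

theorem isProbabilityMeasure_serviceSeqLaw {r : ℝ} (hr : 0 < r) :
    IsProbabilityMeasure (serviceSeqLaw r) := by
  have := isProbabilityMeasure_expMeasure hr
  infer_instance

theorem isProbabilityMeasure_serviceLaw (n : ℕ) {μ : ℝ} (hμ : 0 < μ) :
    IsProbabilityMeasure (serviceLaw n μ) := by
  have := isProbabilityMeasure_expMeasure hμ
  unfold serviceLaw
  infer_instance

theorem lintegral_serviceLaw {n : ℕ} {μ : ℝ} (hμ : 0 < μ)
    {F : (ℕ × Fin n → ℝ) × unitInterval → ℝ≥0∞} (hF : Measurable F) :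
    ∫⁻ z, F z ∂serviceLaw n μ = ∫⁻ u, (∫⁻ x, F (x, u) ∂expLaw n μ) := by
  have := isProbabilityMeasure_expMeasure hμ
  exact lintegral_prod_symm _ hF.aemeasurable

theorem ae_serviceLaw {n : ℕ} {μ : ℝ} (hμ : 0 < μ) {p : (ℕ × Fin n → ℝ) × unitInterval → Prop}
    (hp : MeasurableSet {z | p z}) (h : ∀ u, ∀ᵐ x ∂expLaw n μ, p (x, u)) :
    ∀ᵐ z ∂serviceLaw n μ, p z := by
  have h1 := lintegral_serviceLaw hμ (F := {z | p z}ᶜ.indicator 1) (measurable_one.indicator hp.compl)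
  rw [lintegral_indicator_one hp.compl] at h1
  rw [ae_iff]
  change serviceLaw n μ {z | p z}ᶜ = 0
  rw [h1, lintegral_eq_zero_of_ae_eq_zero]
  refine Eventually.of_forall fun u => ?_
  refine lintegral_eq_zero_of_ae_eq_zero ?_
  filter_upwards [h u] with x hx
  have : (x, u) ∉ {z | p z}ᶜ := fun h => h hx
  simp [Set.indicator_of_notMem this]

theorem ae_inputLaw {n : ℕ} {μ : ℝ} (hμ : 0 < μ) {ν : Measure (ℕ → ℝ)} [SFinite ν]
    {p : Input n → Prop}
    (hp : MeasurableSet {w | p w}) (h : ∀ᵐ a ∂ν, ∀ u, ∀ᵐ x ∂expLaw n μ, p (a, x, u)) :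
    ∀ᵐ w ∂inputLaw n μ ν, p w := by
  have := isProbabilityMeasure_serviceLaw n hμ
  rw [ae_iff]
  change inputLaw n μ ν {w | p w}ᶜ = 0
  unfold inputLaw
  rw [Measure.measure_prod_null hp.compl]
  filter_upwards [h] with a ha
  have := ae_serviceLaw hμ (p := fun z => p (a, z)) (measurable_prodMk_left hp) ha
  rw [ae_iff] at this
  exact this

theorem ae_inputLaw_validInput {n : ℕ} {μ : ℝ} (hμ : 0 < μ) {ν : Measure (ℕ → ℝ)} [SFinite ν]
    (hν : ∀ᵐ a ∂ν, ValidArrivals a) : ∀ᵐ w ∂inputLaw n μ ν, ValidInput w := by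
  have := isProbabilityMeasure_serviceLaw n hμ
  have h1 : ∀ᵐ w ∂inputLaw n μ ν, ValidArrivals w.1 :=
    Measure.quasiMeasurePreserving_fst.ae hν
  have h2 : ∀ᵐ w ∂inputLaw n μ ν, ∀ p, 0 < w.2.1 p := by
    refine ae_inputLaw hμ ?_ ?_
    · have : {w : Input n | ∀ p, 0 < w.2.1 p} = ⋂ p, {w | 0 < w.2.1 p} := by ext; simp
      rw [this]
      exact MeasurableSet.iInter fun p => measurableSet_lt measurable_const
        ((measurable_pi_apply p).comp (measurable_fst.comp measurable_snd))
    · exact Eventually.of_forall fun a u => ae_pos_infinitePi hμ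
  filter_upwards [h1, h2] with w h3 h4 using ⟨h3, h4⟩

theorem measurableSet_noTies {ι : Type*} [Countable ι] :
    MeasurableSet {d : ι → ℝ≥0∞ | NoTies d} := by
  have : {d : ι → ℝ≥0∞ | NoTies d} = ⋂ p, ⋂ q, {d | p = q} ∪ ({d | d p = d q}ᶜ ∪ {d | d p = ⊤}) := by
    ext d
    simp only [Set.mem_iInter, Set.mem_union, Set.mem_compl_iff, Set.mem_ofPred_eq]
    refine forall_congr' fun p => forall_congr' fun q => ?_
    tauto
  rw [this]
  refine MeasurableSet.iInter fun p => MeasurableSet.iInter fun q => ?_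
  exact (MeasurableSet.const _).union
    ((measurableSet_eq_fun (measurable_pi_apply p) (measurable_pi_apply q)).compl.union
      (measurableSet_eq_fun (measurable_pi_apply p) measurable_const))

/-! ### Regular outcomes, law of the service durations and mean total delays -/

namespace OnlineScheme

variable {L k n : ℕ} {S : OnlineScheme L k n}

theorem measurable_delay (hk : 0 < k) (i : ℕ) : Measurable fun w : Input n => S.delay w i :=
  (S.measurable_dep hk i).sub ((measurable_pi_apply i).comp measurable_fst).ennreal_ofReal

/-- The outcomes in which the deliveries are the successive states of a busy or idle server. -/
def Regular (S : OnlineScheme L k n) (w : Input n) : Prop :=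
  NoTies (S.del w) ∧
    ∀ m, nthTime (S.del w) m < ⊤ ∧ readyTime k w.1 (S.del w) m < nthTime (S.del w) m

theorem measurableSet_regular (hk : 0 < k) : MeasurableSet {w | S.Regular w} := by
  have hd := S.measurable_del hk
  have h1 : MeasurableSet {w : Input n | NoTies (S.del w)} := measurableSet_noTies.preimage hd
  have h2 : MeasurableSet {w : Input n | ∀ m, nthTime (S.del w) m < ⊤ ∧
      readyTime k w.1 (S.del w) m < nthTime (S.del w) m} := by
    have : {w : Input n | ∀ m, nthTime (S.del w) m < ⊤ ∧
        readyTime k w.1 (S.del w) m < nthTime (S.del w) m} =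
        ⋂ m, {w | nthTime (S.del w) m < ⊤} ∩
          {w | readyTime k w.1 (S.del w) m < nthTime (S.del w) m} := by
      ext w
      simp only [Set.mem_iInter, Set.mem_inter_iff, Set.mem_ofPred_eq]
    rw [this]
    refine MeasurableSet.iInter fun m => ?_
    exact (measurableSet_lt ((measurable_nthTime m).comp hd) measurable_const).inter
      (measurableSet_lt ((measurable_readyTime k m).comp (measurable_fst.prodMk hd))
        ((measurable_nthTime m).comp hd))
  exact h1.inter h2

theorem ae_serviceLaw_validInput {μ : ℝ} (hμ : 0 < μ) {a : ℕ → ℝ} (ha : ValidArrivals a) :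
    ∀ᵐ z ∂serviceLaw n μ, ValidInput (a, z) := by
  have h2 : ∀ᵐ z ∂serviceLaw n μ, ∀ p, 0 < z.1 p := by
    refine ae_serviceLaw hμ ?_ fun u => ae_pos_infinitePi hμ
    have : {z : (ℕ × Fin n → ℝ) × unitInterval | ∀ p, 0 < z.1 p} = ⋂ p, {z | 0 < z.1 p} := by
      ext; simp
    rw [this]
    exact MeasurableSet.iInter fun p => measurableSet_lt measurable_const
      ((measurable_pi_apply p).comp measurable_fst)
  filter_upwards [h2] with z hz using ⟨ha, hz⟩

theorem WorkConserving.ae_regular (hS : S.WorkConserving) (hL : 0 < L) (hk : 0 < k) {μ : ℝ}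
    (hμ : 0 < μ) {a : ℕ → ℝ} (ha : ValidArrivals a) (u : unitInterval) :
    ∀ᵐ x ∂expLaw n μ, S.Regular (a, x, u) := by
  filter_upwards [S.ae_noTies hk hμ ha u, hS.ae_readyTime_lt_nthTime hL hk hμ ha u] with x h1 h2
    using ⟨h1, h2⟩

theorem WorkConserving.ae_serviceLaw_regular (hS : S.WorkConserving) (hL : 0 < L) (hk : 0 < k)
    {μ : ℝ} (hμ : 0 < μ) {a : ℕ → ℝ} (ha : ValidArrivals a) :
    ∀ᵐ z ∂serviceLaw n μ, S.Regular (a, z) :=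
  ae_serviceLaw hμ ((measurableSet_regular hk).preimage measurable_prodMk_left)
    (hS.ae_regular hL hk hμ ha)

theorem measurable_svc_pi (hk : 0 < k) : Measurable fun w : Input n => S.svc w :=
  measurable_pi_lambda _ fun m => measurable_svc hk m

theorem measurable_svc_mk (hk : 0 < k) (a : ℕ → ℝ) : Measurable fun z => S.svc (a, z) :=
  (measurable_svc_pi hk).comp measurable_prodMk_left

theorem WorkConserving.map_svc_serviceLaw (hS : S.WorkConserving) (hL : 0 < L) (hk : 0 < k)
    {μ : ℝ} (hμ : 0 < μ) {a : ℕ → ℝ} (ha : ValidArrivals a) :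
    (serviceLaw n μ).map (fun z => S.svc (a, z)) = serviceSeqLaw (L * μ) := by
  have hm := measurable_svc_mk (S := S) hk a
  have hlam : 0 < (L : ℝ) * μ := mul_pos (by exact_mod_cast hL) hμ
  refine Measure.ext_of_lintegral _ fun F hF => ?_
  rw [lintegral_map hF hm]
  refine (lintegral_serviceLaw hμ (F := fun z => F (S.svc (a, z))) (hF.comp hm)).trans ?_
  have : ∀ u, ∫⁻ x, F (S.svc (a, x, u)) ∂expLaw n μ = ∫⁻ y, F y ∂serviceSeqLaw (L * μ) := by
    intro u
    rw [← hS.map_svc hL hk hμ ha u, lintegral_map hF]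
    exact (measurable_svc_pi hk).comp
      (measurable_const.prodMk (measurable_id.prodMk measurable_const))
  simp only [this, lintegral_const, measure_univ, mul_one]

/-- The conditional law of the durations given the arrivals does not depend on them, which is
independence. -/
theorem WorkConserving.map_svc_inputLaw (hS : S.WorkConserving) (hL : 0 < L) (hk : 0 < k)
    {μ : ℝ} (hμ : 0 < μ) {ν : Measure (ℕ → ℝ)} (hν : IsArrivalProcess ν) :
    (inputLaw n μ ν).map (fun w => (w.1, S.svc w)) = ν.prod (serviceSeqLaw (L * μ)) := by
  have hlam : 0 < (L : ℝ) * μ := mul_pos (by exact_mod_cast hL) hμ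
  have i1 := isProbabilityMeasure_serviceLaw n hμ
  have i2 := isProbabilityMeasure_serviceSeqLaw hlam
  have i3 := hν.isProbabilityMeasure
  have hm : Measurable fun w : Input n => (w.1, S.svc w) :=
    measurable_fst.prodMk (measurable_svc_pi hk)
  refine Measure.ext_of_lintegral _ fun F hF => ?_
  have hFm : Measurable fun w : Input n => F (w.1, S.svc w) := hF.comp hm
  rw [lintegral_map hF hm, inputLaw, lintegral_prod _ hFm.aemeasurable,
    lintegral_prod _ hF.aemeasurable]
  refine lintegral_congr_ae ?_
  filter_upwards [hν.ae_valid] with a ha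
  have hFa : Measurable fun y => F (a, y) := hF.comp measurable_prodMk_left
  rw [← hS.map_svc_serviceLaw hL hk hμ ha, lintegral_map hFa (measurable_svc_mk hk a)]

/-- The mean total delay of the first `M` requests of a work-conserving scheme. -/
theorem WorkConserving.sum_lintegral_delay_le (hS : S.WorkConserving) (hL : 0 < L) (hk : 0 < k)
    {μ : ℝ} (hμ : 0 < μ) {a : ℕ → ℝ} (ha : ValidArrivals a) (M : ℕ) :
    ∑ i ∈ Finset.range M, ∫⁻ z, S.delay (a, z) i ∂serviceLaw n μ ≤
      ∑' l, ∫⁻ y, (lindleyCut k M a y l - ENNReal.ofReal (a (l / k))) ∂serviceSeqLaw (L * μ) := by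
  have hm : ∀ l, Measurable fun y => lindleyCut k M a y l - ENNReal.ofReal (a (l / k)) := fun l =>
    ((measurable_lindleyCut k M l).comp measurable_prodMk_left).sub measurable_const
  have hD : ∀ i, Measurable fun z => S.delay (a, z) i := fun i =>
    (measurable_delay hk i).comp measurable_prodMk_left
  rw [← lintegral_finsetSum _ fun i _ => hD i,
    ← lintegral_tsum fun l => (hm l).aemeasurable, ← hS.map_svc_serviceLaw hL hk hμ ha,
    lintegral_map (Measurable.tsum hm) (measurable_svc_mk hk a)]
  refine lintegral_mono_ae ?_
  filter_upwards [hS.ae_serviceLaw_regular hL hk hμ ha, ae_serviceLaw_validInput hμ ha]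
    with z hz hv
  exact sum_delay_le hk hv hz.1 hz.2 M

/-- The mean total delay of the first `M` requests of any scheme. -/
theorem le_sum_lintegral_delay (hL : 0 < L) (hk : 0 < k) {μ : ℝ} (hμ : 0 < μ) {a : ℕ → ℝ}
    (ha : ValidArrivals a) (M : ℕ) :
    ∑ l ∈ Finset.range (k * M), ∫⁻ y, (lindley k a y l - ENNReal.ofReal (a (l / k)))
        ∂serviceSeqLaw (L * μ) ≤
      k * ∑ i ∈ Finset.range M, ∫⁻ z, S.delay (a, z) i ∂serviceLaw n μ := by
  have hT : ∀ l, Measurable fun z => nthTime (S.del (a, z)) l - ENNReal.ofReal (a (l / k)) :=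
    fun l => ((measurable_nthTime l).comp ((S.measurable_del hk).comp measurable_prodMk_left)).sub
      measurable_const
  calc _ ≤ ∑ l ∈ Finset.range (k * M), ∫⁻ z, (nthTime (S.del (a, z)) l -
        ENNReal.ofReal (a (l / k))) ∂serviceLaw n μ := by
        refine Finset.sum_le_sum fun l _ => ?_
        rw [lintegral_serviceLaw hμ (hT l)]
        calc _ = ∫⁻ _ : unitInterval, (∫⁻ y, (lindley k a y l - ENNReal.ofReal (a (l / k)))
            ∂serviceSeqLaw (L * μ)) := by simp
          _ ≤ _ := lintegral_mono fun u => S.lintegral_lindley_le hL hk hμ ha u l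
            (F := fun z => z - ENNReal.ofReal (a (l / k))) fun z w h => tsub_le_tsub_right h _
    _ = ∫⁻ z, ∑ l ∈ Finset.range (k * M), (nthTime (S.del (a, z)) l -
        ENNReal.ofReal (a (l / k))) ∂serviceLaw n μ := (lintegral_finsetSum _ fun l _ => hT l).symm
    _ ≤ ∫⁻ z, k * ∑ i ∈ Finset.range M, S.delay (a, z) i ∂serviceLaw n μ := by
        refine lintegral_mono_ae ?_
        filter_upwards [ae_serviceLaw_validInput hμ ha] with z hv
        exact le_sum_delay hk hv M
    _ = _ := by
        have hD : ∀ i, Measurable fun z => S.delay (a, z) i := fun i =>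
          (measurable_delay hk i).comp measurable_prodMk_left
        rw [lintegral_const_mul _ (Finset.measurable_sum _ fun i _ => hD i),
          lintegral_finsetSum _ fun i _ => hD i]

end OnlineScheme

/-! ### Sums of independent exponential times -/

theorem lintegral_prod_infinitePi (ρ : Measure ℝ) [IsProbabilityMeasure ρ] {f : ℝ → ℝ≥0∞}
    (hf : Measurable f) (s : Finset ℕ) :
    ∫⁻ y, ∏ q ∈ s, f (y q) ∂(Measure.infinitePi fun _ : ℕ => ρ) = (∫⁻ v, f v ∂ρ) ^ s.card := by
  rw [lintegral_prod_eq_prod_lintegral_of_indepFun s (fun q (y : ℕ → ℝ) => f (y q))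
    (iIndepFun_infinitePi (X := fun _ => f) fun _ => hf) fun q => hf.comp (measurable_pi_apply q)]
  have : ∀ q, ∫⁻ y, f (y q) ∂(Measure.infinitePi fun _ : ℕ => ρ) = ∫⁻ v, f v ∂ρ := fun q =>
    (measurePreserving_eval_infinitePi (fun _ : ℕ => ρ) q).lintegral_comp hf
  simp [this]

theorem lintegral_exp_infinitePi (ρ : Measure ℝ) [IsProbabilityMeasure ρ] (θ : ℝ) (s : Finset ℕ) :
    ∫⁻ y, ENNReal.ofReal (Real.exp (θ * ∑ q ∈ s, y q)) ∂(Measure.infinitePi fun _ : ℕ => ρ) =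
      (∫⁻ v, ENNReal.ofReal (Real.exp (θ * v)) ∂ρ) ^ s.card := by
  rw [← lintegral_prod_infinitePi ρ (by fun_prop)]
  refine lintegral_congr fun y => ?_
  rw [Finset.mul_sum, Real.exp_sum, ENNReal.ofReal_prod_of_nonneg fun _ _ => (Real.exp_pos _).le]

/-- Tilting the exponential density of rate `r` by `θ` gives a multiple of the one of rate `r - θ`.
-/
theorem lintegral_exp_expMeasure {r θ : ℝ} (hr : 0 < r) (hθ : θ < r) :
    ∫⁻ v, ENNReal.ofReal (Real.exp (θ * v)) ∂expMeasure r = ENNReal.ofReal (r / (r - θ)) := by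
  have h0 : 0 < r - θ := sub_pos.2 hθ
  have := isProbabilityMeasure_expMeasure h0
  have h1 : ∫⁻ _, ENNReal.ofReal (r / (r - θ)) ∂expMeasure (r - θ) = ENNReal.ofReal (r / (r - θ)) := by
    simp
  rw [← h1, lintegral_expMeasure (by fun_prop), lintegral_expMeasure measurable_const]
  refine lintegral_congr fun v => ?_
  rw [← ENNReal.ofReal_mul (by positivity), ← ENNReal.ofReal_mul (by positivity)]
  congr 1
  rw [mul_assoc, ← Real.exp_add]
  have : -((r - θ) * v) = -(r * v) + θ * v := by ring
  rw [this]
  field_simp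

theorem lintegral_id_expMeasure {r : ℝ} (hr : 0 < r) :
    ∫⁻ v, ENNReal.ofReal v ∂expMeasure r = ENNReal.ofReal (1 / r) := by
  have := isProbabilityMeasure_expMeasure hr
  rw [lintegral_eq_lintegral_meas_lt _ ((ae_pos_expMeasure hr).mono fun v hv => hv.le)
    aemeasurable_id]
  calc _ = ∫⁻ t in Set.Ioi (0 : ℝ), ENNReal.ofReal (r * Real.exp (-(r * t))) *
        ENNReal.ofReal (1 / r) := by
        refine setLIntegral_congr_fun measurableSet_Ioi fun t ht => ?_
        have ht' : (0 : ℝ) < t := ht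
        change expMeasure r (Set.Ioi t) = _
        rw [expMeasure_Ioi hr ht'.le, ← ENNReal.ofReal_mul (by positivity)]
        congr 1
        field_simp
    _ = _ := by
        rw [← lintegral_expMeasure measurable_const]
        simp

theorem integrable_id_expMeasure {r : ℝ} (hr : 0 < r) : Integrable (fun v => v) (expMeasure r) := by
  refine ⟨aestronglyMeasurable_id, ?_⟩
  rw [hasFiniteIntegral_iff_ofReal ((ae_pos_expMeasure hr).mono fun v hv => hv.le),
    lintegral_id_expMeasure hr]
  exact ENNReal.ofReal_lt_top

theorem integral_id_expMeasure {r : ℝ} (hr : 0 < r) : ∫ v, v ∂expMeasure r = 1 / r := by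
  rw [integral_eq_lintegral_of_nonneg_ae ((ae_pos_expMeasure hr).mono fun v hv => hv.le)
    aestronglyMeasurable_id, lintegral_id_expMeasure hr, ENNReal.toReal_ofReal (by positivity)]

theorem integrable_eval_infinitePi {ρ : Measure ℝ} [IsProbabilityMeasure ρ]
    (h : Integrable (fun v => v) ρ) (q : ℕ) :
    Integrable (fun y : ℕ → ℝ => y q) (Measure.infinitePi fun _ : ℕ => ρ) :=
  (measurePreserving_eval_infinitePi (fun _ : ℕ => ρ) q).integrable_comp_of_integrable h

theorem integral_eval_infinitePi {ρ : Measure ℝ} [IsProbabilityMeasure ρ] (q : ℕ) :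
    ∫ y : ℕ → ℝ, y q ∂(Measure.infinitePi fun _ : ℕ => ρ) = ∫ v, v ∂ρ := by
  conv_rhs => rw [← Measure.infinitePi_map_eval (fun _ : ℕ => ρ) q]
  rw [integral_map (measurable_pi_apply q).aemeasurable
    (measurable_id : Measurable fun v : ℝ => v).aestronglyMeasurable]

theorem ae_tendsto_average_infinitePi {ρ : Measure ℝ} [IsProbabilityMeasure ρ]
    (h : Integrable (fun v => v) ρ) :
    ∀ᵐ y ∂(Measure.infinitePi fun _ : ℕ => ρ),
      Tendsto (fun m : ℕ => (∑ q ∈ Finset.range m, y q) / (m : ℝ)) atTop (𝓝 (∫ v, v ∂ρ)) := by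
  rw [← integral_eval_infinitePi (ρ := ρ) 0]
  refine strong_law_ae_real (fun (q : ℕ) (y : ℕ → ℝ) => y q) (integrable_eval_infinitePi h 0) ?_ ?_
  · intro q q' hq
    exact (iIndepFun_infinitePi (X := fun (_ : ℕ) (v : ℝ) => v) fun _ => measurable_id).indepFun hq
  · intro q
    refine ⟨(measurable_pi_apply q).aemeasurable, (measurable_pi_apply 0).aemeasurable, ?_⟩
    have h1 := Measure.infinitePi_map_eval (fun _ : ℕ => ρ) q
    have h2 := Measure.infinitePi_map_eval (fun _ : ℕ => ρ) 0
    exact h1.trans h2.symm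

theorem integral_expMeasure {r : ℝ} (hr : 0 < r) (f : ℝ → ℂ) :
    ∫ v, f v ∂expMeasure r = ∫ v in Set.Ioi (0 : ℝ), (r * Real.exp (-(r * v))) • f v := by
  have h1 : expMeasure r = volume.withDensity (exponentialPDF r) := rfl
  have hm : Measurable (exponentialPDF r) := by
    unfold exponentialPDF
    exact (measurable_exponentialPDFReal r).ennreal_ofReal
  rw [h1, integral_withDensity_eq_integral_toReal_smul hm (Eventually.of_forall fun v => by
    unfold exponentialPDF; exact ENNReal.ofReal_lt_top), ← integral_indicator measurableSet_Ioi]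
  refine integral_congr_ae ?_
  have h0 : ∀ᵐ v : ℝ, v ≠ 0 := by simp [ae_iff]
  filter_upwards [h0] with v hv
  rcases lt_or_gt_of_ne hv with h | h
  · rw [exponentialPDF_of_neg h, Set.indicator_of_notMem (by simpa using h.le)]
    simp
  · rw [exponentialPDF_of_nonneg h.le, Set.indicator_of_mem (by simpa using h),
      ENNReal.toReal_ofReal (by positivity)]

/-- The transform is `r / (r - i s)`. Strictness makes the powers in `le_integral_abs_sum_sub`
vanish, which is how growing fluctuations are detected. -/
theorem norm_charFun_expMeasure_lt_one {r s : ℝ} (hr : 0 < r) (hs : s ≠ 0) :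
    ‖charFun (expMeasure r) s‖ < 1 := by
  rw [charFun_apply_real, integral_expMeasure hr]
  have h1 : ∀ v : ℝ, (r * Real.exp (-(r * v))) • Complex.exp (s * v * Complex.I) =
      r * Complex.exp ((-r + s * Complex.I) * v) := by
    intro v
    rw [Complex.real_smul]
    push_cast
    rw [mul_assoc, ← Complex.exp_add]
    congr 2
    ring
  simp only [h1]
  rw [integral_const_mul, integral_exp_mul_complex_Ioi (by simpa using hr)]
  simp only [Complex.ofReal_zero, mul_zero, Complex.exp_zero, norm_mul, norm_div, norm_neg,
    Complex.norm_real, norm_one, Real.norm_eq_abs, abs_of_pos hr]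
  rw [mul_one_div, div_lt_one]
  · have h2 : r ^ 2 < ‖(-r + s * Complex.I : ℂ)‖ ^ 2 := by
      rw [← Complex.normSq_eq_norm_sq, Complex.normSq_apply]
      have : 0 < s ^ 2 := by positivity
      simp
      nlinarith
    exact lt_of_pow_lt_pow_left₀ 2 (norm_nonneg _) h2
  · rw [norm_pos_iff]
    intro h
    have := congrArg Complex.re h
    simp at this
    exact hr.ne' this

/-- A Chernoff bound: the positive part is estimated by an exponential, whose mean is a product over
the independent terms. -/
theorem exists_lintegral_sum_sub_le {r κ : ℝ} (hr : 0 < r) (hκ : 1 < κ) :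
    ∃ C q : ℝ, 0 ≤ C ∧ 0 ≤ q ∧ q < 1 ∧ ∀ s : Finset ℕ,
      ∫⁻ y, ENNReal.ofReal (∑ j ∈ s, y j - κ * s.card / r) ∂serviceSeqLaw r ≤
        ENNReal.ofReal (C * q ^ s.card) := by
  have i1 := isProbabilityMeasure_expMeasure hr
  -- The tilt is `u * r`. The factor per term is below one when `exp (u * κ) * (1 - u) > 1`, and `(1
  -- + u * κ) * (1 - u) > 1` holds as long as `u < (κ - 1) / κ`; half of this bound is taken.
  set u : ℝ := (κ - 1) / (2 * κ) with hu
  have hu0 : 0 < u := by rw [hu]; apply div_pos <;> linarith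
  have huκ : u * κ = (κ - 1) / 2 := by rw [hu]; field_simp
  have hu1 : u < 1 := by
    rw [hu, div_lt_one (by linarith)]; linarith
  have h1 : 1 < Real.exp (u * κ) * (1 - u) := by
    have h2 : u * κ + 1 ≤ Real.exp (u * κ) := Real.add_one_le_exp _
    nlinarith
  refine ⟨1 / (u * r), Real.exp (-(u * κ)) / (1 - u), by positivity,
    div_nonneg (Real.exp_pos _).le (by linarith), ?_, fun s => ?_⟩
  · rw [div_lt_one (by linarith), Real.exp_neg, inv_lt_iff_one_lt_mul₀ (Real.exp_pos _)]
    linarith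
  calc _ ≤ ∫⁻ y, ENNReal.ofReal (1 / (u * r) * Real.exp (-(u * κ)) ^ s.card) *
        ENNReal.ofReal (Real.exp (u * r * ∑ j ∈ s, y j)) ∂serviceSeqLaw r := by
        refine lintegral_mono fun y => ?_
        rw [← ENNReal.ofReal_mul (by positivity)]
        refine ENNReal.ofReal_le_ofReal ?_
        have h3 : u * r * (∑ j ∈ s, y j - κ * s.card / r) ≤
            Real.exp (u * r * (∑ j ∈ s, y j - κ * s.card / r)) := by
          linarith [Real.add_one_le_exp (u * r * (∑ j ∈ s, y j - κ * s.card / r))]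
        have h4 : Real.exp (-(u * κ)) ^ s.card * Real.exp (u * r * ∑ j ∈ s, y j) =
            Real.exp (u * r * (∑ j ∈ s, y j - κ * s.card / r)) := by
          rw [← Real.exp_nat_mul, ← Real.exp_add]
          congr 1
          field_simp
          ring
        rw [mul_assoc, h4, one_div, ← div_eq_inv_mul, le_div_iff₀ (by positivity)]
        linarith
    _ = _ := by
        rw [lintegral_const_mul _ (by fun_prop), lintegral_exp_infinitePi,
          lintegral_exp_expMeasure hr (by nlinarith), ← ENNReal.ofReal_pow (by
            apply div_nonneg hr.le; nlinarith), ← ENNReal.ofReal_mul (by positivity), mul_assoc,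
            ← mul_pow]
        congr 3
        have : (1 : ℝ) - u ≠ 0 := by linarith
        have : r - u * r = r * (1 - u) := by ring
        rw [this]
        field_simp

theorem exists_measure_sum_le {r κ : ℝ} (hr : 0 < r) (hκ : 1 < κ) :
    ∃ q : ℝ, 0 ≤ q ∧ q < 1 ∧ ∀ s : Finset ℕ,
      serviceSeqLaw r {y | ∑ j ∈ s, y j ≤ s.card / (κ * r)} ≤ ENNReal.ofReal (q ^ s.card) := by
  have i1 := isProbabilityMeasure_expMeasure hr
  -- Tilting by `-(u * r)` needs `(1 + u) * exp (-(u / κ)) > 1`, which follows from `(1 + u) * (1 -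
  -- u / κ) > 1`, valid for `u < κ - 1`.
  set u : ℝ := (κ - 1) / 2 with hu
  have hu0 : 0 < u := by rw [hu]; linarith
  have hu1 : κ = 2 * u + 1 := by rw [hu]; ring
  have h1 : 1 < (1 + u) * Real.exp (-(u / κ)) := by
    have h2 : -(u / κ) + 1 ≤ Real.exp (-(u / κ)) := Real.add_one_le_exp _
    have h3 : 1 < (1 + u) * (-(u / κ) + 1) := by
      rw [hu1]
      field_simp
      nlinarith
    nlinarith
  refine ⟨Real.exp (u / κ) / (1 + u), by positivity, ?_, fun s => ?_⟩
  · rw [div_lt_one (by linarith)]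
    rw [Real.exp_neg] at h1
    rwa [← div_eq_mul_inv, one_lt_div (Real.exp_pos _)] at h1
  calc _ ≤ ∫⁻ y, ENNReal.ofReal (Real.exp (u / κ) ^ s.card) *
        ENNReal.ofReal (Real.exp (-(u * r) * ∑ j ∈ s, y j)) ∂serviceSeqLaw r := by
        rw [← lintegral_indicator_one (measurableSet_le (by fun_prop) measurable_const)]
        refine lintegral_mono fun y => ?_
        rw [← ENNReal.ofReal_mul (by positivity)]
        by_cases hy : y ∈ {y : ℕ → ℝ | ∑ j ∈ s, y j ≤ s.card / (κ * r)}
        swap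
        · rw [Set.indicator_of_notMem hy]
          exact zero_le
        rw [Set.indicator_of_mem hy]
        have hy' : ∑ j ∈ s, y j ≤ s.card / (κ * r) := hy
        have h4 : Real.exp (u / κ) ^ s.card * Real.exp (-(u * r) * ∑ j ∈ s, y j) =
            Real.exp (u * r * (s.card / (κ * r) - ∑ j ∈ s, y j)) := by
          rw [← Real.exp_nat_mul, ← Real.exp_add]
          congr 1
          field_simp
          ring
        rw [h4, Pi.one_apply, ENNReal.one_le_ofReal]
        refine Real.one_le_exp (mul_nonneg (by positivity) (by linarith))
    _ = _ := by
        rw [lintegral_const_mul _ (by fun_prop), lintegral_exp_infinitePi,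
          lintegral_exp_expMeasure hr (by nlinarith), ← ENNReal.ofReal_pow (by
            apply div_nonneg hr.le; nlinarith), ← ENNReal.ofReal_mul (by positivity), ← mul_pow]
        congr 2
        have : r - -(u * r) = r * (1 + u) := by ring
        rw [this]
        field_simp

/-! ### Long-run averages and counting functions -/

theorem exists_abs_sub_le_of_tendsto_div {f : ℕ → ℝ} {b : ℝ}
    (h : Tendsto (fun m : ℕ => f m / m) atTop (𝓝 b)) {ε : ℝ} (hε : 0 < ε) :
    ∃ C, 0 ≤ C ∧ ∀ m : ℕ, |f m - b * m| ≤ ε * m + C := by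
  obtain ⟨m₀, hm₀⟩ := Metric.tendsto_atTop.1 h ε hε
  refine ⟨∑ m ∈ Finset.range (m₀ + 1), |f m - b * m|,
    Finset.sum_nonneg fun _ _ => abs_nonneg _, fun m => ?_⟩
  by_cases hm : m < m₀ + 1
  · have := Finset.single_le_sum (f := fun m : ℕ => |f m - b * m|) (fun _ _ => abs_nonneg _)
      (Finset.mem_range.2 hm)
    have : 0 ≤ ε * m := by positivity
    linarith
  · have h1 := hm₀ m (by omega)
    have hmpos : (0 : ℝ) < m := by exact_mod_cast (show 0 < m by omega)
    rw [Real.dist_eq] at h1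
    have h2 : f m - b * m = (f m / m - b) * m := by field_simp
    have h3 : (0 : ℝ) ≤ ∑ m ∈ Finset.range (m₀ + 1), |f m - b * m| :=
      Finset.sum_nonneg fun _ _ => abs_nonneg _
    rw [h2, abs_mul, abs_of_pos hmpos]
    nlinarith

theorem tendsto_div_of_abs_sub_le {f : ℕ → ℝ} {b : ℝ}
    (h : ∀ ε > 0, ∃ C, ∀ m : ℕ, |f m - b * (m + 1)| ≤ ε * (m + 1) + C) :
    Tendsto (fun m : ℕ => f m / (m + 1)) atTop (𝓝 b) := by
  rw [Metric.tendsto_atTop]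
  intro ε hε
  obtain ⟨C, hC⟩ := h (ε / 2) (by positivity)
  obtain ⟨m₀, hm₀⟩ := exists_nat_gt (2 * C / ε)
  refine ⟨m₀, fun m hm => ?_⟩
  have h1 : (0 : ℝ) < m + 1 := by positivity
  have h2 : f m / (m + 1) - b = (f m - b * (m + 1)) / (m + 1) := by field_simp
  rw [Real.dist_eq, h2, abs_div, abs_of_pos h1, div_lt_iff₀ h1]
  refine (hC m).trans_lt ?_
  have h3 : (m₀ : ℝ) ≤ m := by exact_mod_cast hm
  have h4 : 2 * C < ε * m₀ := by
    rw [div_lt_iff₀ hε] at hm₀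
    linarith
  nlinarith

/-- If the `m`-th event takes place at about time `β m`, events take place at rate `1 / β`. -/
theorem tendsto_count_div {T : ℕ → ℝ} {N : ℝ → ℕ} {β : ℝ} (hβ : 0 < β)
    (hN : ∀ t, 0 ≤ t → ∀ m, m < N t ↔ T m ≤ t)
    (hT : Tendsto (fun m : ℕ => T m / (m + 1)) atTop (𝓝 β)) :
    Tendsto (fun t : ℝ => (N t : ℝ) / t) atTop (𝓝 β⁻¹) := by
  have hNt : Tendsto N atTop atTop := by
    rw [tendsto_atTop]
    intro m
    filter_upwards [eventually_ge_atTop (0 : ℝ), eventually_ge_atTop (T m)] with t h0 h1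
    exact ((hN t h0 m).2 h1).le
  have hu : Tendsto (fun m : ℕ => T (m - 1) / m) atTop (𝓝 β) := by
    rw [← tendsto_add_atTop_iff_nat 1]
    simpa using hT
  have hv : Tendsto (fun m : ℕ => T m / m) atTop (𝓝 β) := by
    have h1 : Tendsto (fun m : ℕ => ((m : ℝ) + 1) / m) atTop (𝓝 1) := by
      have h2 : Tendsto (fun m : ℕ => 1 + 1 / (m : ℝ)) atTop (𝓝 (1 + 0)) :=
        tendsto_const_nhds.add tendsto_one_div_atTop_nhds_zero_nat
      rw [add_zero] at h2
      refine h2.congr' ?_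
      filter_upwards [eventually_gt_atTop 0] with m hm
      have : (0 : ℝ) < m := by exact_mod_cast hm
      field_simp
    have h3 := hT.mul h1
    rw [mul_one] at h3
    refine h3.congr' ?_
    filter_upwards [eventually_gt_atTop 0] with m hm
    have : (0 : ℝ) < m := by exact_mod_cast hm
    field_simp
  have key : Tendsto (fun t : ℝ => t / N t) atTop (𝓝 β) := by
    refine tendsto_of_tendsto_of_tendsto_of_le_of_le' (hu.comp hNt) (hv.comp hNt) ?_ ?_
    · filter_upwards [eventually_ge_atTop (0 : ℝ), hNt.eventually_ge_atTop 1] with t h0 h1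
      have : T (N t - 1) ≤ t := (hN t h0 _).1 (by omega)
      simp only [Function.comp_apply]
      gcongr
    · filter_upwards [eventually_ge_atTop (0 : ℝ)] with t h0
      have : t ≤ T (N t) := by
        by_contra! h
        exact lt_irrefl _ ((hN t h0 (N t)).2 h.le)
      simp only [Function.comp_apply]
      gcongr
  refine (key.inv₀ hβ.ne').congr fun t => ?_
  rw [inv_div]

theorem tendsto_arrival_div {a : ℕ → ℝ} {r : ℝ} (hr : 0 < r)
    (h : Tendsto (fun i : ℕ => (i : ℝ) / a i) atTop (𝓝 r)) :
    Tendsto (fun i : ℕ => a i / i) atTop (𝓝 (1 / r)) := by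
  rw [one_div]
  refine (h.inv₀ hr.ne').congr fun i => ?_
  rw [inv_div]

/-! ### Linear growth of the Lindley recursion -/

theorem lindleyCut_eq_lindley {k M : ℕ} {a y : ℕ → ℝ} {l : ℕ} (hl : l < k * M) :
    lindleyCut k M a y l = lindley k a y l := by
  induction l with
  | zero => rfl
  | succ l ih => rw [lindleyCut, lindley, if_pos hl, ih (by omega)]

theorem exists_lindley_eq {k : ℕ} (hk : 0 < k) {a y : ℕ → ℝ}
    (ha : ValidArrivals a) (hy : ∀ l, 0 ≤ y l) (l : ℕ) :
    ∃ i, k * i ≤ l ∧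
      lindley k a y l = ENNReal.ofReal (a i + ∑ q ∈ Finset.Ico (k * i) (l + 1), y q) := by
  obtain ⟨i, -, h1, h2⟩ := exists_lindleyCut_eq hk (M := l + 1) (Nat.succ_pos l) ha hy l
  rw [lindleyCut_eq_lindley (by nlinarith)] at h2
  exact ⟨i, h1, h2⟩

/-- To first order the recursion is the maximum over `i` of `i / r + (l + 1 - k i) / lam`. This is
affine in `i`, so the larger slope wins: the server is limited either by arrivals or by service. -/
theorem tendsto_lindley_div {k : ℕ} (hk : 0 < k) {a y : ℕ → ℝ} {r lam : ℝ} (hr : 0 < r)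
    (ha : ValidArrivals a) (hy : ∀ l, 0 ≤ y l)
    (hS : Tendsto (fun m : ℕ => (∑ q ∈ Finset.range m, y q) / (m : ℝ)) atTop (𝓝 (1 / lam)))
    (hA : Tendsto (fun i : ℕ => (i : ℝ) / a i) atTop (𝓝 r)) :
    Tendsto (fun m : ℕ => (lindley k a y m).toReal / (m + 1)) atTop
      (𝓝 (max (1 / (k * r)) (1 / lam))) := by
  have hk' : (0 : ℝ) < k := by exact_mod_cast hk
  set β := max (1 / (k * r)) (1 / lam) with hβ
  have hβ1 : 1 / (k * r) ≤ β := le_max_left _ _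
  have hβ2 : 1 / lam ≤ β := le_max_right _ _
  refine tendsto_div_of_abs_sub_le fun ε hε => ?_
  obtain ⟨C₁, hC₁, h1⟩ := exists_abs_sub_le_of_tendsto_div hS (show 0 < ε / 3 by positivity)
  obtain ⟨C₂, hC₂, h2⟩ := exists_abs_sub_le_of_tendsto_div (tendsto_arrival_div hr hA)
    (show 0 < ε / 3 by positivity)
  refine ⟨2 * C₁ + C₂ + 1 / r, fun l => ?_⟩
  have hrinv : 0 < 1 / r := by positivity
  have hl0 : (0 : ℝ) ≤ l := Nat.cast_nonneg l
  have hS1 := abs_le.1 (h1 (l + 1))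
  push_cast at hS1
  have hnn : ∀ i l', 0 ≤ a i + ∑ q ∈ Finset.Ico (k * i) l', y q := fun i l' =>
    add_nonneg (ha.1 i) (Finset.sum_nonneg fun q _ => hy q)
  have htop := (lindley_lt_top k a y l).ne
  rw [abs_le]
  constructor
  · have hlow1 : ∑ q ∈ Finset.range (l + 1), y q ≤ (lindley k a y l).toReal := by
      rw [← ENNReal.ofReal_le_iff_le_toReal htop]
      refine le_trans (ENNReal.ofReal_le_ofReal ?_) (le_lindley hk (i := 0) (by simp))
      rw [mul_zero, ← Finset.range_eq_Ico]
      linarith [ha.1 0]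
    have hlow2 : a (l / k) ≤ (lindley k a y l).toReal := by
      rw [← ENNReal.ofReal_le_iff_le_toReal htop]
      refine le_trans (ENNReal.ofReal_le_ofReal ?_) (le_lindley hk (Nat.mul_div_le l k))
      linarith [Finset.sum_nonneg fun q (_ : q ∈ Finset.Ico (k * (l / k)) (l + 1)) => hy q]
    have hA1 := abs_le.1 (h2 (l / k))
    have hdiv1 : ((l / k : ℕ) : ℝ) ≤ l + 1 := by
      have : l / k ≤ l := Nat.div_le_self l k
      have : ((l / k : ℕ) : ℝ) ≤ l := by exact_mod_cast this
      linarith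
    have hdiv2 : (l + 1 : ℝ) ≤ k * ((l / k : ℕ) : ℝ) + k := by
      have : l + 1 ≤ k * (l / k) + k := by
        have := Nat.div_add_mod l k
        have := Nat.mod_lt l hk
        omega
      exact_mod_cast this
    have e1 : 1 / (k * r) * (l + 1) ≤ 1 / r * ((l / k : ℕ) : ℝ) + 1 / r := by
      have : 1 / (k * r) * (k * ((l / k : ℕ) : ℝ) + k) = 1 / r * ((l / k : ℕ) : ℝ) + 1 / r := by
        field_simp
      rw [← this]
      gcongr
    have e2 : ε / 3 * ((l / k : ℕ) : ℝ) ≤ ε / 3 * (l + 1) := by gcongr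
    rcases max_choice (1 / (k * r)) (1 / lam) with h | h
    · rw [hβ, h]
      nlinarith
    · rw [hβ, h]
      nlinarith
  · obtain ⟨i, hi, he⟩ := exists_lindley_eq hk ha hy l
    rw [he, ENNReal.toReal_ofReal (hnn _ _), Finset.sum_Ico_eq_sub _ (by omega)]
    have hA1 := abs_le.1 (h2 i)
    have hS2 := abs_le.1 (h1 (k * i))
    push_cast at hS2
    have hi1 : (k * i : ℝ) ≤ l + 1 := by
      have : k * i ≤ l + 1 := by omega
      exact_mod_cast this
    have hi2 : (i : ℝ) ≤ l + 1 := by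
      have : i ≤ k * i := Nat.le_mul_of_pos_left i hk
      have : (i : ℝ) ≤ k * i := by exact_mod_cast this
      linarith
    have e1 : 1 / r * i = 1 / (k * r) * (k * i) := by field_simp
    have e2 : 1 / (k * r) * (k * i) ≤ β * (k * i) := by gcongr
    have e3 : 1 / lam * (l + 1 - k * i) ≤ β * (l + 1 - k * i) := by
      gcongr
    have e4 : ε / 3 * i ≤ ε / 3 * (l + 1) := by gcongr
    have e5 : ε / 3 * (k * i) ≤ ε / 3 * (l + 1) := by gcongr
    nlinarith

/-! ### Upper bound on the departure rate of every scheme -/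

namespace OnlineScheme

variable {L k n : ℕ} {S : OnlineScheme L k n}

theorem measure_inputLaw_le {μ : ℝ} (hμ : 0 < μ) {ν : Measure (ℕ → ℝ)}
    [IsProbabilityMeasure ν] {p : Input n → Prop} (hp : MeasurableSet {w | p w}) {C : ℝ≥0∞}
    (h : ∀ᵐ a ∂ν, ∀ u, expLaw n μ {x | p (a, x, u)} ≤ C) : inputLaw n μ ν {w | p w} ≤ C := by
  have i1 := isProbabilityMeasure_serviceLaw n hμ
  unfold inputLaw
  rw [Measure.prod_apply hp]
  calc _ ≤ ∫⁻ _, C ∂ν := by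
        refine lintegral_mono_ae ?_
        filter_upwards [h] with a ha
        have hpa : MeasurableSet {z | p (a, z)} := measurable_prodMk_left hp
        change serviceLaw n μ {z | p (a, z)} ≤ C
        rw [← lintegral_indicator_one hpa, lintegral_serviceLaw hμ (measurable_one.indicator hpa)]
        calc _ ≤ ∫⁻ _ : unitInterval, C := by
              refine lintegral_mono fun u => ?_
              have hpu : MeasurableSet {x : ℕ × Fin n → ℝ | p (a, x, u)} :=
                (measurable_id.prodMk measurable_const) hpa
              refine le_trans (le_of_eq ?_) (ha u)
              rw [← lintegral_indicator_one hpu]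
              rfl
          _ = C := by simp
    _ = C := by simp

/-- No scheme lets requests depart faster than at rate `L μ / k`. -/
theorem ae_eventually_departed_le (hL : 0 < L) (hk : 0 < k) {μ : ℝ} (hμ : 0 < μ)
    {ν : Measure (ℕ → ℝ)} (hν : IsArrivalProcess ν) (S : OnlineScheme L k n) {c : ℝ}
    (hc : L * μ / k < c) :
    ∀ᵐ w ∂inputLaw n μ ν, ∀ᶠ t : ℝ in atTop, (S.departed w t : ℝ) ≤ c * t := by
  have hlam : 0 < (L : ℝ) * μ := mul_pos (by exact_mod_cast hL) hμ
  have hk' : (0 : ℝ) < k := by exact_mod_cast hk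
  have i1 := hν.isProbabilityMeasure
  have i2 := isProbabilityMeasure_serviceSeqLaw hlam
  have i3 := isProbabilityMeasure_expMeasure hμ
  rw [div_lt_iff₀ hk'] at hc
  -- A chunk rate strictly between `L * μ` and `k * c`. That the `l`-th delivery comes by `(l + 1) /
  -- v` is a lower large deviation of a sum of durations, of geometrically small probability;
  -- Borel–Cantelli excludes it eventually.
  obtain ⟨v, hv1, hv2⟩ := exists_between hc
  have hv0 : 0 < v := hlam.trans hv1
  obtain ⟨q, hq0, hq1, hq⟩ := exists_measure_sum_le hlam (κ := v / (L * μ))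
    (by rwa [one_lt_div hlam])
  have hvv : v / (L * μ) * (L * μ) = v := div_mul_cancel₀ _ hlam.ne'
  rw [hvv] at hq
  have hm : ∀ l : ℕ, MeasurableSet {w | nthTime (S.del w) l ≤ ENNReal.ofReal ((l + 1) / v)} :=
    fun l => measurableSet_le ((measurable_nthTime l).comp (S.measurable_del hk)) measurable_const
  have hE : ∀ l : ℕ, inputLaw n μ ν {w | nthTime (S.del w) l ≤ ENNReal.ofReal ((l + 1) / v)} ≤
      ENNReal.ofReal (q ^ (l + 1)) := by
    intro l
    refine measure_inputLaw_le hμ (hm l) ?_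
    filter_upwards [hν.ae_valid] with a ha u
    have hml : Measurable fun y => lindley k a y l :=
      (measurable_lindley k l).comp measurable_prodMk_left
    calc expLaw n μ {x | nthTime (S.del (a, x, u)) l ≤ ENNReal.ofReal ((l + 1) / v)}
        = 1 - expLaw n μ {x | ENNReal.ofReal ((l + 1) / v) < nthTime (S.del (a, x, u)) l} := by
          rw [← prob_compl_eq_one_sub
            (measurableSet_lt measurable_const (S.measurable_nthTime_del hk a u l))]
          congr 1
          ext x
          simp
      _ ≤ 1 - serviceSeqLaw (L * μ) {y | ENNReal.ofReal ((l + 1) / v) < lindley k a y l} :=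
          tsub_le_tsub_left (S.measure_lt_lindley_le hL hk hμ ha u l _) _
      _ = serviceSeqLaw (L * μ) {y | lindley k a y l ≤ ENNReal.ofReal ((l + 1) / v)} := by
          rw [← prob_compl_eq_one_sub (measurableSet_lt measurable_const hml)]
          congr 1
          ext x
          simp
      _ ≤ serviceSeqLaw (L * μ) {y | ∑ j ∈ Finset.range (l + 1), y j ≤
          (Finset.range (l + 1)).card / v} := by
          refine measure_mono fun y hy => ?_
          have hy' : lindley k a y l ≤ ENNReal.ofReal ((l + 1) / v) := hy
          have h1 := (le_lindley hk (a := a) (y := y) (i := 0) (l := l) (by simp)).trans hy'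
          rw [mul_zero, ← Finset.range_eq_Ico, ENNReal.ofReal_le_ofReal_iff (by positivity)] at h1
          have h2 : ∑ j ∈ Finset.range (l + 1), y j ≤ (Finset.range (l + 1)).card / v := by
            rw [Finset.card_range]
            push_cast
            linarith [ha.1 0]
          exact h2
      _ ≤ _ := by
          have := hq (Finset.range (l + 1))
          simp only [Finset.card_range] at this ⊢
          exact this
  have hsum : ∑' l : ℕ, inputLaw n μ ν {w | nthTime (S.del w) l ≤
      ENNReal.ofReal ((l + 1) / v)} ≠ ⊤ := by
    refine ne_top_of_le_ne_top ?_ (ENNReal.tsum_le_tsum hE)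
    have hs : Summable fun l : ℕ => q ^ (l + 1) :=
      (summable_nat_add_iff 1).2 (summable_geometric_of_lt_one hq0 hq1)
    rw [← ENNReal.ofReal_tsum_of_nonneg (fun l => by positivity) hs]
    exact ENNReal.ofReal_ne_top
  filter_upwards [ae_eventually_notMem hsum, ae_inputLaw_validInput hμ hν.ae_valid] with w hw hval
  obtain ⟨l₀, hl₀⟩ := eventually_atTop.1 hw
  have hP := S.isPath hval
  have hloc : LocFinite (S.del w) := hP.locFinite
  filter_upwards [eventually_ge_atTop 0, eventually_ge_atTop (l₀ / v)] with t ht0 ht1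
  have htt : ENNReal.ofReal t < ⊤ := ENNReal.ofReal_lt_top
  have h1 : k * S.departed w t ≤ countUpTo (S.del w) (ENNReal.ofReal t) :=
    hP.mul_numDeparted_le hk htt
  have h2 : (countUpTo (S.del w) (ENNReal.ofReal t) : ℝ) ≤ v * t := by
    by_cases hN : countUpTo (S.del w) (ENNReal.ofReal t) ≤ l₀
    · have : (countUpTo (S.del w) (ENNReal.ofReal t) : ℝ) ≤ l₀ := by exact_mod_cast hN
      rw [div_le_iff₀ hv0] at ht1
      linarith
    · obtain ⟨l, hl⟩ : ∃ l, countUpTo (S.del w) (ENNReal.ofReal t) = l + 1 :=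
        ⟨_, (Nat.succ_pred_eq_of_pos (by omega)).symm⟩
      have h3 : nthTime (S.del w) l ≤ ENNReal.ofReal t := (hloc.lt_nthTime_iff htt).2 (by omega)
      have h4 : ¬ nthTime (S.del w) l ≤ ENNReal.ofReal ((l + 1) / v) := hl₀ l (by omega)
      have h5 := (not_le.1 h4).trans_le h3
      rw [ENNReal.ofReal_lt_ofReal_iff_of_nonneg (by positivity), div_lt_iff₀ hv0] at h5
      rw [hl]
      push_cast
      linarith
  have h3 : (k : ℝ) * S.departed w t ≤ countUpTo (S.del w) (ENNReal.ofReal t) := by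
    exact_mod_cast h1
  have h4 : (k : ℝ) * S.departed w t ≤ k * (c * t) := by nlinarith
  exact le_of_mul_le_mul_left h4 hk'

end OnlineScheme

namespace OnlineScheme

variable {L k n : ℕ} {S : OnlineScheme L k n}

/-! ### Long-run rates of a work-conserving scheme -/

theorem arrivalCount_le (hk : 0 < k) {w : Input n} (hv : ValidInput w) {t : ℝ≥0∞} (ht : t < ⊤) :
    arrivalCount w.1 t ≤ numDeparted k (S.start w) w.2.1 t +
      {i | InSystem k w.1 (S.start w) w.2.1 t i}.ncard := by
  have hP := S.isPath hv
  have hfin : {i | departureTime k (S.start w) w.2.1 i ≤ t}.Finite := by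
    refine (hP.valid.finite ht).subset fun i hi => ?_
    have h1 := (hP.valid.lt_arrivalCount_iff ht i).1 (hP.departure_iff ht hk hi)
    exact h1
  unfold arrivalCount numDeparted
  refine le_trans (Set.ncard_le_ncard ?_ (hfin.union (hP.finite_inSystem ht)))
    (Set.ncard_union_le _ _)
  intro i hi
  rcases le_or_gt (departureTime k (S.start w) w.2.1 i) t with h | h
  · exact Or.inl h
  · exact Or.inr ⟨hi, h⟩

/-- Departures are squeezed between two expressions in arrivals and deliveries. They number at most
`1 / k` of the deliveries, and at least the arrivals minus the missing chunks. In the underloaded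
case deliveries come at rate `k * r`, so missing chunks are negligible and both bounds tend to `r`.
-/
theorem tendsto_rates (hk : 0 < k) {w : Input n} (hv : ValidInput w) (hw : S.Regular w)
    {r lam : ℝ} (hr : 0 < r) (hlam : 0 < lam)
    (hS : Tendsto (fun m : ℕ => (∑ q ∈ Finset.range m, S.svc w q) / (m : ℝ)) atTop (𝓝 (1 / lam)))
    (hA : Tendsto (fun i : ℕ => (i : ℝ) / w.1 i) atTop (𝓝 r)) :
    Tendsto (fun t : ℝ => (S.delivered w t : ℝ) / t) atTop (𝓝 (min (k * r) lam)) ∧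
      (r ≤ lam / k → Tendsto (fun t : ℝ => (S.departed w t : ℝ) / t) atTop (𝓝 r)) := by
  have hk' : (0 : ℝ) < k := by exact_mod_cast hk
  have hP := S.isPath hv
  have hloc : LocFinite (S.del w) := hP.locFinite
  have hdel : Tendsto (fun t : ℝ => (S.delivered w t : ℝ) / t) atTop (𝓝 (min (k * r) lam)) := by
    have h1 := tendsto_lindley_div hk hr hP.valid (y := S.svc w)
      (fun l => ENNReal.toReal_nonneg) hS hA
    have hβ : 0 < max (1 / (k * r)) (1 / lam) := lt_max_of_lt_right (by positivity)
    have h2 := tendsto_count_div (N := fun t => S.delivered w t) hβ (fun t ht m => ?_) h1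
    · convert h2 using 2
      rcases le_total (k * r) lam with h | h
      · rw [min_eq_left h, max_eq_left (one_div_le_one_div_of_le (by positivity) h)]
        simp
      · rw [min_eq_right h, max_eq_right (one_div_le_one_div_of_le (by positivity) h)]
        simp
    · rw [← nthTime_eq_lindley hw.2, ← ENNReal.le_ofReal_iff_toReal_le (hw.2 m).1.ne ht,
        hloc.lt_nthTime_iff ENNReal.ofReal_lt_top]
      rfl
  refine ⟨hdel, fun hle => ?_⟩
  have hmin : min (k * r) lam = k * r := by
    rw [le_div_iff₀ hk'] at hle
    exact min_eq_left (by linarith)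
  rw [hmin] at hdel
  have harr : Tendsto (fun t : ℝ => (arrivalCount w.1 (ENNReal.ofReal t) : ℝ) / t) atTop (𝓝 r) := by
    have h1 : Tendsto (fun i : ℕ => w.1 i / ((i : ℝ) + 1)) atTop (𝓝 (1 / r)) := by
      refine tendsto_div_of_abs_sub_le fun ε hε => ?_
      obtain ⟨C, hC, h⟩ := exists_abs_sub_le_of_tendsto_div (tendsto_arrival_div hr hA) hε
      refine ⟨C + 1 / r, fun i => ?_⟩
      have := abs_le.1 (h i)
      have h3 : 0 < 1 / r := by positivity
      rw [abs_le]
      constructor <;> nlinarith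
    have h2 := tendsto_count_div (N := fun t => arrivalCount w.1 (ENNReal.ofReal t))
      (show 0 < 1 / r by positivity) (fun t ht i => ?_) h1
    · simpa using h2
    · rw [hP.valid.lt_arrivalCount_iff ENNReal.ofReal_lt_top, ENNReal.ofReal_le_ofReal_iff ht]
  have hlow : Tendsto (fun t : ℝ => (arrivalCount w.1 (ENNReal.ofReal t) : ℝ) / t -
      k * ((arrivalCount w.1 (ENNReal.ofReal t) : ℝ) / t) + (S.delivered w t : ℝ) / t) atTop
      (𝓝 r) := by
    have := (harr.sub (harr.const_mul (k : ℝ))).add hdel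
    simpa using this
  have hup : Tendsto (fun t : ℝ => (S.delivered w t : ℝ) / t / k) atTop (𝓝 r) := by
    have := hdel.div_const (k : ℝ)
    rwa [mul_div_cancel_left₀ _ hk'.ne'] at this
  refine tendsto_of_tendsto_of_tendsto_of_le_of_le' hlow hup ?_ ?_
  · filter_upwards [eventually_gt_atTop 0] with t ht
    have htt : ENNReal.ofReal t < ⊤ := ENNReal.ofReal_lt_top
    have h1 := hP.card_inSystem_add_le hk hw.1 htt
    have h2 := arrivalCount_le (S := S) hk hv htt
    have h3 : arrivalCount w.1 (ENNReal.ofReal t) + S.delivered w t ≤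
        S.departed w t + k * arrivalCount w.1 (ENNReal.ofReal t) := by
      unfold delivered departed
      rw [numDelivered_eq]
      omega
    have h4 : (arrivalCount w.1 (ENNReal.ofReal t) : ℝ) + S.delivered w t ≤
        S.departed w t + k * arrivalCount w.1 (ENNReal.ofReal t) := by exact_mod_cast h3
    rw [le_div_iff₀ ht]
    field_simp
    linarith
  · filter_upwards [eventually_gt_atTop 0] with t ht
    have htt : ENNReal.ofReal t < ⊤ := ENNReal.ofReal_lt_top
    have h1 : k * S.departed w t ≤ S.delivered w t := hP.mul_numDeparted_le hk htt
    have h2 : (k : ℝ) * S.departed w t ≤ S.delivered w t := by exact_mod_cast h1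
    rw [div_div, div_le_div_iff₀ ht (by positivity)]
    nlinarith

theorem WorkConserving.ae_tendsto_rates (hS : S.WorkConserving) (hL : 0 < L) (hk : 0 < k) {μ : ℝ}
    (hμ : 0 < μ) {ν : Measure (ℕ → ℝ)} (hν : IsArrivalProcess ν) {r : ℝ} (hr : 0 < r)
    (hA : HasRate ν r) :
    ∀ᵐ w ∂inputLaw n μ ν,
      Tendsto (fun t : ℝ => (S.delivered w t : ℝ) / t) atTop (𝓝 (min (k * r) (L * μ))) ∧
      (r ≤ L * μ / k → Tendsto (fun t : ℝ => (S.departed w t : ℝ) / t) atTop (𝓝 r)) := by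
  have hlam : 0 < (L : ℝ) * μ := mul_pos (by exact_mod_cast hL) hμ
  have i1 := hν.isProbabilityMeasure
  have i2 := isProbabilityMeasure_serviceSeqLaw hlam
  have i3 := isProbabilityMeasure_expMeasure hlam
  have i4 := isProbabilityMeasure_serviceLaw n hμ
  have h1 : ∀ᵐ w ∂inputLaw n μ ν, Tendsto (fun i : ℕ => (i : ℝ) / w.1 i) atTop (𝓝 r) :=
    Measure.quasiMeasurePreserving_fst.ae hA
  have h2 : ∀ᵐ w ∂inputLaw n μ ν,
      Tendsto (fun m : ℕ => (∑ q ∈ Finset.range m, S.svc w q) / (m : ℝ)) atTop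
        (𝓝 (1 / (L * μ))) := by
    have h3 := ae_tendsto_average_infinitePi (integrable_id_expMeasure hlam)
    rw [integral_id_expMeasure hlam] at h3
    have h4 : ∀ᵐ z ∂ν.prod (serviceSeqLaw (L * μ)),
        Tendsto (fun m : ℕ => (∑ q ∈ Finset.range m, z.2 q) / (m : ℝ)) atTop
          (𝓝 (1 / (L * μ))) := Measure.quasiMeasurePreserving_snd.ae h3
    rw [← hS.map_svc_inputLaw hL hk hμ hν] at h4
    exact ae_of_ae_map (measurable_fst.prodMk (measurable_svc_pi hk)).aemeasurable h4
  have h3 : ∀ᵐ w ∂inputLaw n μ ν, S.Regular w := by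
    refine ae_inputLaw hμ (measurableSet_regular hk) ?_
    filter_upwards [hν.ae_valid] with a ha u using hS.ae_regular hL hk hμ ha u
  filter_upwards [h1, h2, h3, ae_inputLaw_validInput hμ hν.ae_valid] with w w1 w2 w3 w4
  exact tendsto_rates hk w4 w3 hr hlam w2 w1

end OnlineScheme

/-! ### Fluctuations of sums of exponential times -/

theorem lintegral_infinitePi_shift {ρ : Measure ℝ} [IsProbabilityMeasure ρ] (m : ℕ)
    {F : (ℕ → ℝ) → ℝ≥0∞} (hF : Measurable F) :
    ∫⁻ y, F (fun q => y (m + q)) ∂(Measure.infinitePi fun _ : ℕ => ρ) =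
      ∫⁻ y, F y ∂(Measure.infinitePi fun _ : ℕ => ρ) := by
  have h := Measure.map_infinitePi_infinitePi_of_inj (P := fun _ : ℕ => ρ)
    (f := fun q => m + q) (add_right_injective m)
  conv_rhs => rw [← h]
  rw [lintegral_map hF (by fun_prop)]

theorem integrable_sum_sub {r : ℝ} (hr : 0 < r) (s : Finset ℕ) (c : ℝ) :
    Integrable (fun y => ∑ q ∈ s, y q - c) (serviceSeqLaw r) := by
  have i1 := isProbabilityMeasure_expMeasure hr
  exact (integrable_finsetSum s fun q _ =>
    integrable_eval_infinitePi (integrable_id_expMeasure hr) q).sub (integrable_const c)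

theorem integral_sum_sub {r : ℝ} (hr : 0 < r) (s : Finset ℕ) (c : ℝ) :
    ∫ y, (∑ q ∈ s, y q - c) ∂serviceSeqLaw r = s.card / r - c := by
  have i1 := isProbabilityMeasure_expMeasure hr
  have h1 : ∀ q ∈ s, Integrable (fun y : ℕ → ℝ => y q) (serviceSeqLaw r) := fun q _ =>
    integrable_eval_infinitePi (integrable_id_expMeasure hr) q
  rw [integral_sub (integrable_finsetSum s h1) (integrable_const c), integral_finsetSum s h1]
  simp [integral_eval_infinitePi, integral_id_expMeasure hr, div_eq_mul_inv]

/-- A sum concentrated near its mean would have a characteristic function of modulus near one, as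
`exp (i t x)` varies by at most `|t| |x - x'|`; for independent terms the modulus is a power. -/
theorem le_integral_abs_sum_sub {r : ℝ} (hr : 0 < r) (s : Finset ℕ) (t : ℝ) :
    1 - ‖charFun (expMeasure r) t‖ ^ s.card ≤
      |t| * ∫ y, |∑ q ∈ s, y q - s.card / r| ∂serviceSeqLaw r := by
  have i1 := isProbabilityMeasure_expMeasure hr
  set c : ℝ := s.card / r
  have hchar : ∫ y, Complex.exp (t * ((∑ q ∈ s, y q : ℝ) : ℂ) * Complex.I) ∂serviceSeqLaw r =
      charFun (expMeasure r) t ^ s.card := by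
    have h1 := iIndepFun.charFun_map_fun_finsetSum_eq_prod (s := s) (P := serviceSeqLaw r)
      (X := fun (q : ℕ) (y : ℕ → ℝ) => y q) (fun q _ => (measurable_pi_apply q).aemeasurable)
      ((iIndepFun_infinitePi (X := fun (_ : ℕ) (v : ℝ) => v) fun _ => measurable_id).restrict s)
    have h2 := congrFun h1 t
    rw [charFun_apply_real, integral_map (by fun_prop) (by fun_prop)] at h2
    rw [h2, Finset.prod_apply]
    have h3 : ∀ q, (serviceSeqLaw r).map (fun y : ℕ → ℝ => y q) = expMeasure r := fun q =>
      Measure.infinitePi_map_eval (fun _ : ℕ => expMeasure r) q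
    simp [h3]
  have hint : Integrable (fun y : ℕ → ℝ => Complex.exp (t * ((∑ q ∈ s, y q : ℝ) : ℂ) * Complex.I))
      (serviceSeqLaw r) := by
    refine Integrable.of_bound (by fun_prop) 1 (Eventually.of_forall fun y => ?_)
    have h := Complex.norm_exp_ofReal_mul_I (t * ∑ q ∈ s, y q)
    push_cast at h ⊢
    exact h.le
  have hc : ‖Complex.exp (t * (c : ℂ) * Complex.I)‖ = 1 := by
    have h := Complex.norm_exp_ofReal_mul_I (t * c)
    push_cast at h
    exact h
  calc 1 - ‖charFun (expMeasure r) t‖ ^ s.card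
      ≤ ‖charFun (expMeasure r) t ^ s.card - Complex.exp (t * (c : ℂ) * Complex.I)‖ := by
        rw [← norm_pow, norm_sub_rev, ← hc]
        exact norm_sub_norm_le _ _
    _ = ‖∫ y, (Complex.exp (t * ((∑ q ∈ s, y q : ℝ) : ℂ) * Complex.I) -
        Complex.exp (t * (c : ℂ) * Complex.I)) ∂serviceSeqLaw r‖ := by
        rw [integral_sub hint (integrable_const _), hchar]
        simp
    _ ≤ ∫ y, ‖Complex.exp (t * ((∑ q ∈ s, y q : ℝ) : ℂ) * Complex.I) -
        Complex.exp (t * (c : ℂ) * Complex.I)‖ ∂serviceSeqLaw r := norm_integral_le_integral_norm _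
    _ ≤ ∫ y, |t| * |∑ q ∈ s, y q - c| ∂serviceSeqLaw r := by
        refine integral_mono_of_nonneg (Eventually.of_forall fun y => norm_nonneg _)
          ((integrable_sum_sub hr s c).abs.const_mul _) (Eventually.of_forall fun y => ?_)
        have h1 : Complex.exp (t * ((∑ q ∈ s, y q : ℝ) : ℂ) * Complex.I) -
            Complex.exp (t * (c : ℂ) * Complex.I) = Complex.exp (t * (c : ℂ) * Complex.I) *
            (Complex.exp (Complex.I * ((t * (∑ q ∈ s, y q - c) : ℝ) : ℂ)) - 1) := by
          rw [mul_sub, ← Complex.exp_add, mul_one]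
          congr 2
          push_cast
          ring
        have h2 := Real.norm_exp_I_mul_ofReal_sub_one_le (x := t * (∑ q ∈ s, y q - c))
        change ‖_ - _‖ ≤ _
        rw [h1, norm_mul, hc, one_mul]
        exact h2.trans (abs_mul _ _).le
    _ = _ := integral_const_mul _ _

/-- The mean absolute deviation exceeds any bound for long sums, and for a centred variable the
positive part carries half of it. No second-moment or limit theorem is needed. -/
theorem exists_le_integral_posPart {r : ℝ} (hr : 0 < r) (B : ℝ) :
    ∃ K₀ : ℕ, ∀ s : Finset ℕ, K₀ ≤ s.card →
      B ≤ ∫ y, max (∑ q ∈ s, y q - s.card / r) 0 ∂serviceSeqLaw r := by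
  have i1 := isProbabilityMeasure_expMeasure hr
  -- Once the power of the characteristic function is below `1 / 2`, the mean absolute deviation is
  -- at least `1 / (2 * t) = 2 * (|B| + 1)`.
  set t : ℝ := 1 / (4 * (|B| + 1)) with ht
  have ht0 : 0 < t := by positivity
  have hφ := norm_charFun_expMeasure_lt_one hr ht0.ne'
  obtain ⟨K₀, hK₀⟩ := eventually_atTop.1 ((tendsto_pow_atTop_nhds_zero_of_lt_one (norm_nonneg _)
    hφ).eventually_lt_const (show (0 : ℝ) < 1 / 2 by norm_num))
  refine ⟨K₀, fun s hs => ?_⟩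
  have h1 := le_integral_abs_sum_sub hr s t
  have h2 := hK₀ s.card hs
  have h3 := integral_sum_sub hr s (s.card / r)
  have hi := integrable_sum_sub hr s (s.card / r)
  have h4 : ∫ y, max (∑ q ∈ s, y q - s.card / r) 0 ∂serviceSeqLaw r =
      ∫ y, (1 / 2) * |∑ q ∈ s, y q - s.card / r| + (1 / 2) * (∑ q ∈ s, y q - s.card / r)
        ∂serviceSeqLaw r := by
    refine integral_congr_ae (Eventually.of_forall fun y => ?_)
    change max _ _ = _ * |_| + _
    rcases le_total 0 (∑ q ∈ s, y q - s.card / r) with h | h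
    · rw [max_eq_left h, abs_of_nonneg h]; ring
    · rw [max_eq_right h, abs_of_nonpos h]; ring
  rw [h4, integral_add (hi.abs.const_mul _) (hi.const_mul _), integral_const_mul,
    integral_const_mul, h3, sub_self, mul_zero, add_zero]
  rw [abs_of_pos ht0] at h1
  have h5 : 1 / 2 ≤ t * ∫ y, |∑ q ∈ s, y q - s.card / r| ∂serviceSeqLaw r := by linarith
  rw [ht, div_mul_eq_mul_div, one_mul, le_div_iff₀ (by positivity)] at h5
  linarith [le_abs_self B]

/-- Here `p` is the probability that the sum exceeds its mean; on that event alone the positive part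
is bounded below by an expression affine in `b`. Since `p` does not depend on `b`, the bound can be
averaged over irregularly spaced arrivals. -/
theorem exists_le_lintegral_sum_sub {r : ℝ} (hr : 0 < r) {B : ℝ} {s : Finset ℕ}
    (hs : B ≤ ∫ y, max (∑ q ∈ s, y q - s.card / r) 0 ∂serviceSeqLaw r) :
    ∃ p : ℝ, 0 ≤ p ∧ p ≤ 1 ∧ ∀ b : ℝ, ENNReal.ofReal (B + p * (s.card / r - b)) ≤
      ∫⁻ y, ENNReal.ofReal (∑ q ∈ s, y q - b) ∂serviceSeqLaw r := by
  have i1 := isProbabilityMeasure_expMeasure hr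
  have hmeas : MeasurableSet {y : ℕ → ℝ | s.card / r < ∑ q ∈ s, y q} :=
    measurableSet_lt measurable_const (by fun_prop)
  refine ⟨(serviceSeqLaw r).real {y | s.card / r < ∑ q ∈ s, y q}, measureReal_nonneg,
    measureReal_le_one, fun b => ?_⟩
  have hi : ∀ c, Integrable (fun y => max (∑ q ∈ s, y q - c) 0) (serviceSeqLaw r) := fun c =>
    (integrable_sum_sub hr s c).pos_part
  have hind : Integrable ({y : ℕ → ℝ | s.card / r < ∑ q ∈ s, y q}.indicator fun _ => s.card / r - b)
      (serviceSeqLaw r) := (integrable_const _).indicator hmeas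
  have h1 : ∫⁻ y, ENNReal.ofReal (∑ q ∈ s, y q - b) ∂serviceSeqLaw r =
      ENNReal.ofReal (∫ y, max (∑ q ∈ s, y q - b) 0 ∂serviceSeqLaw r) := by
    rw [ofReal_integral_eq_lintegral_ofReal (hi b) (Eventually.of_forall fun y => le_max_right _ _)]
    refine lintegral_congr fun y => ?_
    rw [ENNReal.ofReal_max]
    simp
  rw [h1]
  refine ENNReal.ofReal_le_ofReal ?_
  calc _ ≤ ∫ y, max (∑ q ∈ s, y q - s.card / r) 0 ∂serviceSeqLaw r +
        (serviceSeqLaw r).real {y | s.card / r < ∑ q ∈ s, y q} * (s.card / r - b) := by linarith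
    _ = ∫ y, (max (∑ q ∈ s, y q - s.card / r) 0 +
        {y : ℕ → ℝ | s.card / r < ∑ q ∈ s, y q}.indicator (fun _ => s.card / r - b) y)
          ∂serviceSeqLaw r := by
        rw [integral_add (hi _) hind, integral_indicator_const _ hmeas, smul_eq_mul]
    _ ≤ _ := by
        refine integral_mono ((hi _).add hind) (hi b) fun y => ?_
        by_cases hy : s.card / r < ∑ q ∈ s, y q
        · have hy' : y ∈ {y : ℕ → ℝ | s.card / r < ∑ q ∈ s, y q} := hy
          simp only [Set.indicator_of_mem hy']
          rw [max_eq_left (by linarith)]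
          refine le_trans (le_of_eq ?_) (le_max_left _ _)
          ring
        · have hy' : y ∉ {y : ℕ → ℝ | s.card / r < ∑ q ∈ s, y q} := hy
          simp only [Set.indicator_of_notMem hy']
          rw [max_eq_right (by linarith), add_zero]
          exact le_max_right _ _

/-! ### Instability at and above the critical rate -/

/-- The sum telescopes, leaving `W` terms at each end. -/
theorem sum_sub_shift_le {a : ℕ → ℝ} (ha : ValidArrivals a) (W N : ℕ) :
    ∑ j ∈ Finset.range N, (a (W + j) - a j) ≤ W * a (N + W) := by
  have h1 := Finset.sum_range_add a W N
  have h2 := Finset.sum_range_add a N W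
  rw [add_comm W N] at h1
  rw [Finset.sum_sub_distrib]
  have h3 : ∑ x ∈ Finset.range W, a (N + x) ≤ W * a (N + W) := by
    have : ∑ x ∈ Finset.range W, a (N + x) ≤ ∑ _x ∈ Finset.range W, a (N + W) :=
      Finset.sum_le_sum fun x hx => ha.2.1 (by have := Finset.mem_range.1 hx; omega)
    simpa using this
  have h4 : 0 ≤ ∑ x ∈ Finset.range W, a x := Finset.sum_nonneg fun i _ => ha.1 i
  linarith

theorem ofReal_sum_le {ι : Type*} (s : Finset ι) (f : ι → ℝ) :
    ENNReal.ofReal (∑ i ∈ s, f i) ≤ ∑ i ∈ s, ENNReal.ofReal (f i) := by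
  classical
  induction s using Finset.induction_on with
  | empty => simp
  | insert i s hi ih =>
    rw [Finset.sum_insert hi, Finset.sum_insert hi]
    exact ENNReal.ofReal_add_le.trans (by gcongr)

/-- The mean waiting time for a chunk, bounded below by looking back at `W` earlier requests. -/
theorem lintegral_window_le {k : ℕ} (hk : 0 < k) {r : ℝ} (hr : 0 < r) {a : ℕ → ℝ}
    (ha : ValidArrivals a) (W j : ℕ) :
    ∫⁻ y, ENNReal.ofReal (∑ q ∈ Finset.range (k * (W + 1)), y q - (a (W + j) - a j))
        ∂serviceSeqLaw r ≤
      ∫⁻ y, (lindley k a y (k * (W + j) + (k - 1)) - ENNReal.ofReal (a (W + j)))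
        ∂serviceSeqLaw r := by
  have i1 := isProbabilityMeasure_expMeasure hr
  rw [← lintegral_infinitePi_shift (k * j) (by fun_prop)]
  refine lintegral_mono fun y => ?_
  have h1 := le_lindley hk (a := a) (y := y) (i := j) (l := k * (W + j) + (k - 1))
    (by rw [mul_add]; omega)
  refine le_trans ?_ (tsub_le_tsub_right h1 _)
  rw [← ENNReal.ofReal_sub _ (ha.1 _)]
  refine ENNReal.ofReal_le_ofReal ?_
  have h2 : k * (W + j) + (k - 1) + 1 = k * j + k * (W + 1) := by
    rw [mul_add, mul_add]; omega
  rw [h2, Finset.sum_Ico_eq_sum_range, Nat.add_sub_cancel_left]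
  linarith

namespace OnlineScheme

variable {L k n : ℕ} {S : OnlineScheme L k n}

/-- At arrival rates `L μ / k` and above, the mean delays are unbounded under any scheme. -/
theorem tendsto_average_delay_top (hL : 0 < L) (hk : 0 < k) {μ : ℝ} (hμ : 0 < μ)
    (S : OnlineScheme L k n) {a : ℕ → ℝ} (ha : ValidArrivals a) {r : ℝ} (hr : 0 < r)
    (hA : Tendsto (fun i : ℕ => (i : ℝ) / a i) atTop (𝓝 r)) (hle : L * μ / k ≤ r) :
    Tendsto (fun m : ℕ => (∑ i ∈ Finset.range m, ∫⁻ z, S.delay (a, z) i ∂serviceLaw n μ) /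
      (m : ℝ≥0∞)) atTop (𝓝 ⊤) := by
  rw [ENNReal.tendsto_nhds_top_iff_nat]
  intro B
  have hlam : 0 < (L : ℝ) * μ := mul_pos (by exact_mod_cast hL) hμ
  have hk' : (0 : ℝ) < k := by exact_mod_cast hk
  set lam : ℝ := L * μ with hlamdef
  -- The target for the average delay is `B + 1`; the factor `k` comes from `le_sum_delay`, and the
  -- extra one absorbs the boundary terms once `N + W ≥ M₀`.
  obtain ⟨K₀, hK₀⟩ := exists_le_integral_posPart hlam (k * (B + 1) + 1)
  set W := K₀ with hW
  set K := k * (W + 1) with hK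
  obtain ⟨p, hp0, hp1, hp⟩ := exists_le_lintegral_sum_sub hlam (hK₀ (Finset.range K) (by
    rw [Finset.card_range]; nlinarith))
  rw [Finset.card_range] at hp
  -- The window contains the chunks of `W + 1` requests but only `W` interarrival gaps. The
  -- tolerance is chosen so that the spare request pays for the error in the arrival rate, even at
  -- the critical rate.
  obtain ⟨C, hC0, hC⟩ := exists_abs_sub_le_of_tendsto_div (tendsto_arrival_div hr hA)
    (show 0 < k / (lam * (W + 1)) by positivity)
  set e : ℝ := k * (B + 1) + 1 with he
  have he0 : 0 < e := by positivity
  obtain ⟨M₀, hM₀⟩ := exists_nat_ge (W * (e + K / lam) + W * C)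
  have hKc : (K : ℝ) / lam = k / lam * W + k / lam := by
    rw [hK]; push_cast; field_simp
  have hrk : 1 / r ≤ k / lam := by
    rw [div_le_div_iff₀ hr hlam]
    rw [div_le_iff₀ hk'] at hle
    linarith
  have key : ∀ N : ℕ, M₀ ≤ N + W → ENNReal.ofReal ((N + W) * (k * (B + 1))) ≤
      k * ∑ i ∈ Finset.range (N + W), ∫⁻ z, S.delay (a, z) i ∂serviceLaw n μ := by
    intro N hN
    have hN' : (M₀ : ℝ) ≤ N + W := by exact_mod_cast hN
    refine le_trans ?_ (le_sum_lintegral_delay hL hk hμ ha (N + W))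
    calc ENNReal.ofReal ((N + W) * (k * (B + 1)))
        ≤ ENNReal.ofReal (∑ j ∈ Finset.range N, (e + p * (K / lam - (a (W + j) - a j)))) := by
          refine ENNReal.ofReal_le_ofReal ?_
          have h1 := sum_sub_shift_le ha W N
          have h2 := (abs_le.1 (hC (N + W))).2
          push_cast at h2
          have h3 : ∑ j ∈ Finset.range N, (e + p * (K / lam - (a (W + j) - a j))) =
              N * (e + p * (K / lam)) - p * ∑ j ∈ Finset.range N, (a (W + j) - a j) := by
            rw [Finset.mul_sum, Finset.sum_congr rfl fun j _ =>
              show e + p * (K / lam - (a (W + j) - a j)) =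
                (e + p * (K / lam)) - p * (a (W + j) - a j) by ring, Finset.sum_sub_distrib]
            simp only [Finset.sum_const, Finset.card_range, nsmul_eq_mul]
          rw [h3]
          have h4 : a (N + W) ≤ k / lam * (N + W) + k / (lam * (W + 1)) * (N + W) + C := by
            have : 1 / r * (N + W : ℝ) ≤ k / lam * (N + W) := by gcongr
            linarith
          have h5 : W * a (N + W) ≤ W * (k / lam * (N + W)) + k / lam * (N + W) + W * C := by
            have h6 : (W : ℝ) * (k / (lam * (W + 1)) * (N + W)) ≤ k / lam * (N + W) := by
              have : (W : ℝ) * (k / (lam * (W + 1)) * (N + W)) =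
                  W / (W + 1) * (k / lam * (N + W)) := by field_simp
              rw [this]
              refine mul_le_of_le_one_left (by positivity) ?_
              rw [div_le_one (by positivity)]
              linarith
            have : (W : ℝ) * a (N + W) ≤ W * (k / lam * (N + W) +
              k / (lam * (W + 1)) * (N + W) + C) := by gcongr
            linarith
          have h7 : p * ∑ j ∈ Finset.range N, (a (W + j) - a j) ≤
              p * ((N + W) * (K / lam) + W * C) := by
            refine mul_le_mul_of_nonneg_left (h1.trans (h5.trans (le_of_eq ?_))) hp0
            rw [hKc]; ring
          have h8 : p * (W * (K / lam) + W * C) ≤ W * (K / lam) + W * C :=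
            mul_le_of_le_one_left (by positivity) hp1
          rw [he] at hM₀ ⊢
          nlinarith
      _ ≤ ∑ j ∈ Finset.range N, ENNReal.ofReal (e + p * (K / lam - (a (W + j) - a j))) :=
          ofReal_sum_le _ _
      _ ≤ ∑ j ∈ Finset.range N, ∫⁻ y, (lindley k a y (k * (W + j) + (k - 1)) -
          ENNReal.ofReal (a ((k * (W + j) + (k - 1)) / k))) ∂serviceSeqLaw lam := by
          refine Finset.sum_le_sum fun j _ => (hp _).trans ?_
          -- The index is that of the last chunk of request `W + j`.
          have : (k * (W + j) + (k - 1)) / k = W + j := by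
            rw [Nat.mul_add_div hk, Nat.div_eq_of_lt (by omega), add_zero]
          rw [this]
          exact lintegral_window_le hk hlam ha W j
      _ = ∑ l ∈ (Finset.range N).image fun j => k * (W + j) + (k - 1), ∫⁻ y, (lindley k a y l -
          ENNReal.ofReal (a (l / k))) ∂serviceSeqLaw lam := by
          rw [Finset.sum_image]
          intro j _ j' _ h
          have h' : k * (W + j) + (k - 1) = k * (W + j') + (k - 1) := h
          have := Nat.eq_of_mul_eq_mul_left hk (Nat.add_right_cancel h')
          omega
      _ ≤ _ := by
          refine Finset.sum_le_sum_of_subset fun l hl => ?_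
          obtain ⟨j, hj, rfl⟩ := Finset.mem_image.1 hl
          have hj' := Finset.mem_range.1 hj
          rw [Finset.mem_range]
          calc k * (W + j) + (k - 1) < k * (W + j) + k := by omega
            _ = k * (W + j + 1) := by ring
            _ ≤ k * (N + W) := Nat.mul_le_mul_left _ (by omega)
  filter_upwards [eventually_ge_atTop (max M₀ (W + 1))] with m hm
  obtain ⟨N, rfl⟩ : ∃ N, m = N + W := ⟨m - W, by
    have := (le_max_right M₀ (W + 1)).trans hm; omega⟩
  have h1 := key N ((le_max_left _ _).trans hm)
  have hpos : 0 < N + W := by have := (le_max_right M₀ (W + 1)).trans hm; omega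
  have h2 : ENNReal.ofReal ((N + W) * (k * (B + 1))) =
      k * (((B + 1 : ℕ) : ℝ≥0∞) * ((N + W : ℕ) : ℝ≥0∞)) := by
    rw [← ENNReal.ofReal_natCast, ← ENNReal.ofReal_natCast (B + 1), ← ENNReal.ofReal_natCast (N + W),
      ← ENNReal.ofReal_mul (by positivity), ← ENNReal.ofReal_mul (by positivity)]
    congr 1
    push_cast
    ring
  rw [h2, ENNReal.mul_le_mul_iff_right (by exact_mod_cast hk.ne') (ENNReal.natCast_ne_top k)] at h1
  refine lt_of_lt_of_le (show (B : ℝ≥0∞) < ((B + 1 : ℕ) : ℝ≥0∞) by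
    exact_mod_cast Nat.lt_succ_self B) ?_
  rw [ENNReal.le_div_iff_mul_le (Or.inl (by exact_mod_cast hpos.ne'))
    (Or.inl (ENNReal.natCast_ne_top _))]
  exact h1

theorem lt_of_stableGivenArrivals (hL : 0 < L) (hk : 0 < k) {μ : ℝ} (hμ : 0 < μ)
    {ν : Measure (ℕ → ℝ)} (hν : IsArrivalProcess ν) {r : ℝ} (hr : 0 < r) (hA : HasRate ν r)
    (h : S.StableGivenArrivals μ ν) : r < L * μ / k := by
  by_contra! hc
  have i1 := hν.isProbabilityMeasure
  obtain ⟨a, h1, h2, h3⟩ := (h.and (hν.ae_valid.and hA)).exists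
  rw [(tendsto_average_delay_top hL hk hμ S h2 hr h3 hc).limsup_eq] at h1
  exact lt_irrefl _ h1

/-- By Fatou's lemma, average delays that tend to infinity for almost all arrivals do so in mean. -/
theorem lt_of_stable (hL : 0 < L) (hk : 0 < k) {μ : ℝ} (hμ : 0 < μ)
    {ν : Measure (ℕ → ℝ)} (hν : IsArrivalProcess ν) {r : ℝ} (hr : 0 < r) (hA : HasRate ν r)
    (h : S.Stable μ ν) : r < L * μ / k := by
  by_contra! hc
  have i1 := hν.isProbabilityMeasure
  have i2 := isProbabilityMeasure_serviceLaw n hμ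
  set f : ℕ → (ℕ → ℝ) → ℝ≥0∞ := fun m a =>
    (∑ i ∈ Finset.range m, ∫⁻ z, S.delay (a, z) i ∂serviceLaw n μ) / (m : ℝ≥0∞) with hf
  have hDm : ∀ i, Measurable fun a => ∫⁻ z, S.delay (a, z) i ∂serviceLaw n μ := fun i =>
    (measurable_delay hk i).lintegral_prod_right'
  have hfm : ∀ m, Measurable (f m) := fun m =>
    (Finset.measurable_sum _ fun i _ => hDm i).div_const _
  have h1 : ∀ m : ℕ, (∑ i ∈ Finset.range m, ∫⁻ w, S.delay w i ∂inputLaw n μ ν) / (m : ℝ≥0∞) =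
      ∫⁻ a, f m a ∂ν := by
    intro m
    simp only [hf, div_eq_mul_inv]
    rw [lintegral_mul_const _ (Finset.measurable_sum _ fun i _ => hDm i),
      lintegral_finsetSum _ fun i _ => hDm i]
    congr 1
    refine Finset.sum_congr rfl fun i _ => ?_
    rw [inputLaw, lintegral_prod _ (measurable_delay hk i).aemeasurable]
  unfold Stable at h
  simp only [h1] at h
  have h2 : ∫⁻ a, liminf (fun m => f m a) atTop ∂ν = ⊤ := by
    have : ∀ᵐ a ∂ν, liminf (fun m => f m a) atTop = ⊤ := by
      filter_upwards [hν.ae_valid, hA] with a h3 h4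
      exact (tendsto_average_delay_top hL hk hμ S h3 hr h4 hc).liminf_eq
    rw [lintegral_congr_ae this]
    simp
  have h3 := lintegral_liminf_le (μ := ν) (u := atTop) hfm
  rw [h2, top_le_iff] at h3
  have h4 := liminf_le_limsup (f := atTop) (u := fun m => ∫⁻ a, f m a ∂ν)
  rw [h3, top_le_iff] at h4
  exact h.ne h4

end OnlineScheme

/-! ### Renewal arrivals -/

theorem measurableSet_validArrivals : MeasurableSet {a : ℕ → ℝ | ValidArrivals a} := by
  have h1 : MeasurableSet {a : ℕ → ℝ | ∀ i, 0 ≤ a i} := by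
    have : {a : ℕ → ℝ | ∀ i, 0 ≤ a i} = ⋂ i, {a | 0 ≤ a i} := by ext; simp
    rw [this]
    exact MeasurableSet.iInter fun i => measurableSet_le measurable_const (measurable_pi_apply i)
  have h2 : MeasurableSet {a : ℕ → ℝ | Monotone a} := by
    have : {a : ℕ → ℝ | Monotone a} = ⋂ i : ℕ, {a | a i ≤ a (i + 1)} := by
      ext a
      rw [Set.mem_iInter]
      exact ⟨fun h i => h (Nat.le_succ i), fun h => monotone_nat_of_le_succ h⟩
    rw [this]
    exact MeasurableSet.iInter fun i =>
      measurableSet_le (measurable_pi_apply i) (measurable_pi_apply (i + 1))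
  have h3 : MeasurableSet {a : ℕ → ℝ | Tendsto a atTop atTop} :=
    measurableSet_tendsto atTop fun i => measurable_pi_apply i
  exact h1.inter (h2.inter h3)

theorem measurableSet_hasRate (r : ℝ) :
    MeasurableSet {a : ℕ → ℝ | Tendsto (fun i : ℕ => (i : ℝ) / a i) atTop (𝓝 r)} :=
  measurableSet_tendsto _ fun i => measurable_const.div (measurable_pi_apply i)

theorem measurable_accelerate (r : ℝ) : Measurable fun (a : ℕ → ℝ) (i : ℕ) => a i / r := by
  fun_prop

theorem ValidArrivals.div {a : ℕ → ℝ} (ha : ValidArrivals a) {r : ℝ} (hr : 0 < r) :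
    ValidArrivals fun i => a i / r :=
  ⟨fun i => div_nonneg (ha.1 i) hr.le, fun _ _ h => div_le_div_of_nonneg_right (ha.2.1 h) hr.le,
    ha.2.2.atTop_div_const hr⟩

theorem IsArrivalProcess.accelerate {ν : Measure (ℕ → ℝ)} (hν : IsArrivalProcess ν) {r : ℝ}
    (hr : 0 < r) : IsArrivalProcess (accelerate r ν) := by
  have := hν.isProbabilityMeasure
  refine ⟨Measure.isProbabilityMeasure_map (measurable_accelerate r).aemeasurable, ?_⟩
  unfold CloudQueue.accelerate
  rw [ae_map_iff (measurable_accelerate r).aemeasurable measurableSet_validArrivals]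
  filter_upwards [hν.ae_valid] with a ha using ha.div hr

theorem HasRate.accelerate {ν : Measure (ℕ → ℝ)} (hν : HasRate ν 1) (r : ℝ) :
    HasRate (accelerate r ν) r := by
  unfold HasRate CloudQueue.accelerate
  rw [ae_map_iff (measurable_accelerate r).aemeasurable (measurableSet_hasRate r)]
  filter_upwards [hν] with a ha
  have := ha.mul_const r
  rw [one_mul] at this
  refine this.congr fun i => ?_
  rw [div_div_eq_mul_div, div_mul_eq_mul_div]

theorem measurable_partialSums :
    Measurable fun (y : ℕ → ℝ) (i : ℕ) => ∑ j ∈ Finset.range (i + 1), y j := by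
  fun_prop

theorem IsUnitInterarrival.ae_valid {ρ : Measure ℝ} (hρ : IsUnitInterarrival ρ) :
    ∀ᵐ y ∂(Measure.infinitePi fun _ : ℕ => ρ),
      ValidArrivals (fun i => ∑ j ∈ Finset.range (i + 1), y j) ∧
      Tendsto (fun i : ℕ => (i : ℝ) / ∑ j ∈ Finset.range (i + 1), y j) atTop (𝓝 1) := by
  have i1 := hρ.isProbabilityMeasure
  have h1 : ∀ᵐ y ∂(Measure.infinitePi fun _ : ℕ => ρ), ∀ j, 0 ≤ y j := ae_all_iff.2 fun j =>
    (measurePreserving_eval_infinitePi (fun _ : ℕ => ρ) j).quasiMeasurePreserving.ae hρ.ae_nonneg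
  have h2 := ae_tendsto_average_infinitePi hρ.integrable
  rw [hρ.mean_eq] at h2
  filter_upwards [h1, h2] with y hy hlim
  have h3 : Tendsto (fun i : ℕ => (∑ j ∈ Finset.range (i + 1), y j) / ((i : ℝ) + 1)) atTop (𝓝 1) := by
    have := (tendsto_add_atTop_iff_nat 1).2 hlim
    simpa using this
  have h4 : Tendsto (fun i : ℕ => ((i : ℝ) + 1)) atTop atTop :=
    tendsto_atTop_add_const_right _ _ tendsto_natCast_atTop_atTop
  refine ⟨⟨fun i => Finset.sum_nonneg fun j _ => hy j, ?_, ?_⟩, ?_⟩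
  · refine monotone_nat_of_le_succ fun i => ?_
    rw [Finset.sum_range_succ _ (i + 1)]
    linarith [hy (i + 1)]
  · refine (h3.pos_mul_atTop one_pos h4).congr fun i => ?_
    exact div_mul_cancel₀ _ (by positivity)
  · have h5 : Tendsto (fun i : ℕ => (i : ℝ) / ((i : ℝ) + 1)) atTop (𝓝 1) :=
      tendsto_natCast_div_add_atTop 1
    have h6 := h5.div h3 one_ne_zero
    rw [div_one] at h6
    refine h6.congr fun i => ?_
    have : (i : ℝ) + 1 ≠ 0 := by positivity
    simp only [Pi.div_apply]
    field_simp

theorem IsUnitInterarrival.isArrivalProcess {ρ : Measure ℝ} (hρ : IsUnitInterarrival ρ) :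
    IsArrivalProcess (renewal ρ) := by
  have i1 := hρ.isProbabilityMeasure
  refine ⟨Measure.isProbabilityMeasure_map measurable_partialSums.aemeasurable, ?_⟩
  unfold renewal
  rw [ae_map_iff measurable_partialSums.aemeasurable measurableSet_validArrivals]
  filter_upwards [hρ.ae_valid] with y hy using hy.1

theorem IsUnitInterarrival.hasRate {ρ : Measure ℝ} (hρ : IsUnitInterarrival ρ) :
    HasRate (renewal ρ) 1 := by
  unfold HasRate renewal
  rw [ae_map_iff measurable_partialSums.aemeasurable (measurableSet_hasRate 1)]
  filter_upwards [hρ.ae_valid] with y hy using hy.2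

theorem lintegral_accelerate_renewal (ρ : Measure ℝ) (r : ℝ) {F : (ℕ → ℝ) → ℝ≥0∞}
    (hF : Measurable F) : ∫⁻ a, F a ∂accelerate r (renewal ρ) =
      ∫⁻ y, F (fun i => (∑ j ∈ Finset.range (i + 1), y j) / r)
        ∂(Measure.infinitePi fun _ : ℕ => ρ) := by
  have hFr : Measurable fun a : ℕ → ℝ => F fun i => a i / r := hF.comp (measurable_accelerate r)
  unfold accelerate renewal
  rw [lintegral_map hF (measurable_accelerate r), lintegral_map hFr measurable_partialSums]

/-! ### Exponential bounds for the waiting times -/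

/-- The waiting time for a chunk is at most the sum of the possible contributions of the requests
that may have started the busy period. -/
theorem lindleyCut_sub_le {k M : ℕ} (hk : 0 < k) (hM : 0 < M) {a y : ℕ → ℝ}
    (ha : ValidArrivals a) (hy : ∀ l, 0 ≤ y l) (l : ℕ) :
    lindleyCut k M a y l - ENNReal.ofReal (a (l / k)) ≤
      ∑ i ∈ Finset.range M, if k * i ≤ l then
        ENNReal.ofReal (∑ q ∈ Finset.Ico (k * i) (l + 1), y q - (a (l / k) - a i)) else 0 := by
  obtain ⟨i, hi, hil, he⟩ := exists_lindleyCut_eq hk hM ha hy l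
  refine le_trans (le_of_eq ?_) (Finset.single_le_sum (f := fun i => if k * i ≤ l then
    ENNReal.ofReal (∑ q ∈ Finset.Ico (k * i) (l + 1), y q - (a (l / k) - a i)) else 0)
    (fun _ _ => zero_le) (Finset.mem_range.2 hi))
  simp only [if_pos hil]
  rw [he, ← ENNReal.ofReal_sub _ (ha.1 _)]
  congr 1
  ring

theorem tsum_ite_le_eq {c : ℕ} (f : ℕ → ℝ≥0∞) :
    ∑' l, (if c ≤ l then f l else 0) = ∑' q, f (c + q) := by
  rw [← (add_right_injective c).tsum_eq]
  · simp
  · intro l hl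
    refine ⟨l - c, Nat.add_sub_cancel' ?_⟩
    by_contra h
    exact hl (if_neg h)

/-- The quotient `(1 - E exp (-t V)) / t` tends to the mean `1` by dominated convergence, so it
exceeds `b` for small `t`. Only the first moment is used. -/
theorem exists_lt_laplace {ρ : Measure ℝ} (hρ : IsUnitInterarrival ρ) {b c : ℝ} (hb : b < 1)
    (hc : 0 < c) :
    ∃ t, 0 < t ∧ t < c ∧ ∫⁻ v, ENNReal.ofReal (Real.exp (-t * v)) ∂ρ ≤ ENNReal.ofReal (1 - b * t) := by
  have i1 := hρ.isProbabilityMeasure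
  have hlim : Tendsto (fun t : ℝ => ∫ v, t⁻¹ * (1 - Real.exp (-t * v)) ∂ρ) (𝓝[>] 0) (𝓝 1) := by
    have hmean := hρ.mean_eq
    suffices h : Tendsto (fun t : ℝ => ∫ v, t⁻¹ * (1 - Real.exp (-t * v)) ∂ρ) (𝓝[>] 0)
        (𝓝 (∫ v, v ∂ρ)) by rwa [hmean] at h
    refine tendsto_integral_filter_of_dominated_convergence (fun v => v)
      (Eventually.of_forall fun t => by fun_prop) ?_ hρ.integrable ?_
    · filter_upwards [self_mem_nhdsWithin] with t ht
      have ht' : 0 < t := ht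
      filter_upwards [hρ.ae_nonneg] with v hv
      have h1 : Real.exp (-t * v) ≤ 1 := Real.exp_le_one_iff.2 (by nlinarith)
      have h2 := Real.add_one_le_exp (-t * v)
      rw [Real.norm_eq_abs, abs_of_nonneg (mul_nonneg (by positivity) (by linarith)),
        inv_mul_le_iff₀ ht']
      linarith
    · refine Eventually.of_forall fun v => ?_
      have h1 : HasDerivAt (fun t : ℝ => -Real.exp (-t * v)) v 0 := by
        have h2 : HasDerivAt (fun t : ℝ => -t * v) (-1 * v) 0 := (hasDerivAt_id 0).neg.mul_const v
        have h3 := h2.exp.fun_neg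
        simpa using h3
      have h4 := h1.tendsto_slope_zero_right
      refine h4.congr fun t => ?_
      simp only [smul_eq_mul, zero_add, neg_zero, zero_mul, Real.exp_zero]
      ring
  have h1 := hlim.eventually_const_lt hb
  have h2 : ∀ᶠ t : ℝ in 𝓝[>] 0, t < c := (eventually_lt_nhds hc).filter_mono nhdsWithin_le_nhds
  obtain ⟨t, ht1, ht2, ht3⟩ := (h1.and (h2.and self_mem_nhdsWithin)).exists
  have ht0 : 0 < t := ht3
  refine ⟨t, ht0, ht2, ?_⟩
  have hint : Integrable (fun v => Real.exp (-t * v)) ρ := by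
    refine Integrable.of_bound (by fun_prop) 1 ?_
    filter_upwards [hρ.ae_nonneg] with v hv
    rw [Real.norm_eq_abs, abs_of_pos (Real.exp_pos _)]
    exact Real.exp_le_one_iff.2 (by nlinarith)
  rw [← ofReal_integral_eq_lintegral_ofReal hint (Eventually.of_forall fun v => (Real.exp_pos _).le)]
  refine ENNReal.ofReal_le_ofReal ?_
  rw [integral_const_mul, integral_sub (integrable_const _) hint] at ht1
  simp only [integral_const, probReal_univ, smul_eq_mul, mul_one] at ht1
  rw [← div_eq_inv_mul, lt_div_iff₀ ht0] at ht1
  linarith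

theorem ae_nonneg_serviceSeqLaw {r : ℝ} (hr : 0 < r) : ∀ᵐ y ∂serviceSeqLaw r, ∀ l, 0 ≤ y l := by
  filter_upwards [ae_pos_infinitePi (ι := ℕ) hr] with y hy l using (hy l).le

/-! ### Stability under renewal arrivals below the critical rate -/

namespace OnlineScheme

variable {L k n : ℕ} {S : OnlineScheme L k n}

/-- The maximum over the starts of the busy period is bounded by a sum. After exchanging the sums,
`i` is the request that opens the busy period and `q` the position of the chunk counted from there.
-/
theorem WorkConserving.sum_lintegral_delay_le_tsum (hS : S.WorkConserving) (hL : 0 < L) (hk : 0 < k)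
    {μ : ℝ} (hμ : 0 < μ) {a : ℕ → ℝ} (ha : ValidArrivals a) (M : ℕ) :
    ∑ i ∈ Finset.range M, ∫⁻ z, S.delay (a, z) i ∂serviceLaw n μ ≤
      ∑ i ∈ Finset.range M, ∑' q : ℕ, ∫⁻ y, ENNReal.ofReal
        (∑ j ∈ Finset.Ico (k * i) (k * i + q + 1), y j - (a (i + q / k) - a i))
          ∂serviceSeqLaw (L * μ) := by
  rcases Nat.eq_zero_or_pos M with rfl | hM
  · simp
  have hlam : 0 < (L : ℝ) * μ := mul_pos (by exact_mod_cast hL) hμ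
  refine (hS.sum_lintegral_delay_le hL hk hμ ha M).trans ?_
  have hm : ∀ (i l : ℕ), Measurable fun y : ℕ → ℝ =>
      ENNReal.ofReal (∑ q ∈ Finset.Ico (k * i) (l + 1), y q - (a (l / k) - a i)) := fun i l => by
    fun_prop
  calc _ ≤ ∑' l, ∑ i ∈ Finset.range M, (if k * i ≤ l then ∫⁻ y, ENNReal.ofReal
        (∑ q ∈ Finset.Ico (k * i) (l + 1), y q - (a (l / k) - a i)) ∂serviceSeqLaw (L * μ)
        else 0) := by
        refine ENNReal.tsum_le_tsum fun l => ?_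
        calc _ ≤ ∫⁻ y, ∑ i ∈ Finset.range M, (if k * i ≤ l then ENNReal.ofReal
              (∑ q ∈ Finset.Ico (k * i) (l + 1), y q - (a (l / k) - a i)) else 0)
                ∂serviceSeqLaw (L * μ) := by
              refine lintegral_mono_ae ?_
              filter_upwards [ae_nonneg_serviceSeqLaw hlam] with y hy
                using lindleyCut_sub_le hk hM ha hy l
          _ = _ := by
              rw [lintegral_finsetSum _ fun i _ => by
                split_ifs
                · exact hm i l
                · exact measurable_const]
              refine Finset.sum_congr rfl fun i _ => ?_
              split_ifs
              · rfl
              · simp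
    _ = ∑ i ∈ Finset.range M, ∑' l, (if k * i ≤ l then ∫⁻ y, ENNReal.ofReal
        (∑ q ∈ Finset.Ico (k * i) (l + 1), y q - (a (l / k) - a i)) ∂serviceSeqLaw (L * μ)
        else 0) := Summable.tsum_finsetSum fun i _ => ENNReal.summable
    _ = _ := by
        refine Finset.sum_congr rfl fun i _ => ?_
        rw [tsum_ite_le_eq]
        simp only [Nat.mul_add_div hk]

/-- The mean waiting time under renewal arrivals decays exponentially in the length of the busy
period. -/
theorem lintegral_renewal_le {lam r θ : ℝ} (hlam : 0 < lam) (hθ : 0 < θ) (hθlam : θ < lam)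
    {ρ : Measure ℝ} [IsProbabilityMeasure ρ] {φ : ℝ} (hφ0 : 0 ≤ φ)
    (hφ : ∫⁻ v, ENNReal.ofReal (Real.exp (-(θ / r) * v)) ∂ρ ≤ ENNReal.ofReal φ) (k i q : ℕ) :
    ∫⁻ a, (∫⁻ y, ENNReal.ofReal
        (∑ j ∈ Finset.Ico (k * i) (k * i + q + 1), y j - (a (i + q / k) - a i))
          ∂serviceSeqLaw lam) ∂accelerate r (renewal ρ) ≤
      ENNReal.ofReal (1 / θ * (lam / (lam - θ)) ^ (q + 1) * φ ^ (q / k)) := by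
  have i1 := isProbabilityMeasure_expMeasure hlam
  have hm : Measurable fun z : (ℕ → ℝ) × (ℕ → ℝ) => ENNReal.ofReal
      (∑ j ∈ Finset.Ico (k * i) (k * i + q + 1), z.2 j - (z.1 (i + q / k) - z.1 i)) := by
    fun_prop
  rw [lintegral_accelerate_renewal ρ r hm.lintegral_prod_right']
  have hlt : 0 < lam - θ := sub_pos.2 hθlam
  calc _ ≤ ∫⁻ x, (∫⁻ y, ENNReal.ofReal (1 / θ) *
        ENNReal.ofReal (Real.exp (-(θ / r) * ∑ j ∈ Finset.Ico (i + 1) (i + q / k + 1), x j)) *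
        ENNReal.ofReal (Real.exp (θ * ∑ j ∈ Finset.Ico (k * i) (k * i + q + 1), y j))
          ∂serviceSeqLaw lam) ∂(Measure.infinitePi fun _ : ℕ => ρ) := by
        refine lintegral_mono fun x => lintegral_mono fun y => ?_
        rw [← ENNReal.ofReal_mul (by positivity), ← ENNReal.ofReal_mul (by positivity)]
        refine ENNReal.ofReal_le_ofReal ?_
        rw [mul_assoc, ← Real.exp_add, one_div, ← div_eq_inv_mul, le_div_iff₀ hθ,
          Finset.sum_Ico_eq_sub x (Nat.succ_le_succ (Nat.le_add_right i (q / k)))]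
        have h1 := Real.add_one_le_exp (-(θ / r) * (∑ j ∈ Finset.range (i + q / k + 1), x j -
          ∑ j ∈ Finset.range (i + 1), x j) +
          θ * ∑ j ∈ Finset.Ico (k * i) (k * i + q + 1), y j)
        refine le_trans (le_of_eq ?_) ((le_add_of_nonneg_right zero_le_one).trans h1)
        simp only
        ring
    _ = ENNReal.ofReal (1 / θ) * (∫⁻ v, ENNReal.ofReal (Real.exp (-(θ / r) * v)) ∂ρ) ^ (q / k) *
        ENNReal.ofReal (lam / (lam - θ)) ^ (q + 1) := by
        have h2 : ∀ x : ℕ → ℝ, ∫⁻ y, ENNReal.ofReal (1 / θ) *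
            ENNReal.ofReal (Real.exp (-(θ / r) * ∑ j ∈ Finset.Ico (i + 1) (i + q / k + 1), x j)) *
            ENNReal.ofReal (Real.exp (θ * ∑ j ∈ Finset.Ico (k * i) (k * i + q + 1), y j))
              ∂serviceSeqLaw lam = ENNReal.ofReal (1 / θ) *
            ENNReal.ofReal (Real.exp (-(θ / r) * ∑ j ∈ Finset.Ico (i + 1) (i + q / k + 1), x j)) *
            ENNReal.ofReal (lam / (lam - θ)) ^ (q + 1) := by
          intro x
          rw [lintegral_const_mul _ (by fun_prop), lintegral_exp_infinitePi,
            lintegral_exp_expMeasure hlam hθlam, Nat.card_Ico]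
          congr 2
          omega
        simp only [h2]
        rw [lintegral_mul_const _ (by fun_prop), lintegral_const_mul _ (by fun_prop),
          lintegral_exp_infinitePi, Nat.card_Ico, Nat.add_sub_add_right, Nat.add_sub_cancel_left]
    _ ≤ ENNReal.ofReal (1 / θ) * ENNReal.ofReal φ ^ (q / k) *
        ENNReal.ofReal (lam / (lam - θ)) ^ (q + 1) := by gcongr
    _ = _ := by
        rw [← ENNReal.ofReal_pow hφ0, ← ENNReal.ofReal_pow (by positivity),
          ← ENNReal.ofReal_mul (by positivity), ← ENNReal.ofReal_mul (by positivity)]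
        congr 1
        ring

/-- One factor `φ` comes with every `k` factors `g`, so a block contributes `g ^ k * φ < 1`.
Bernoulli's inequality supplies a `k`-th root bound below one, and `d'` is taken slightly larger so
as to be positive. -/
theorem pow_mul_pow_div_le {g φ : ℝ} {k : ℕ} (hk : 0 < k) (hg : 1 ≤ g) (hφ0 : 0 ≤ φ)
    (h : g ^ k * φ < 1) :
    ∃ C d : ℝ, 0 ≤ C ∧ 0 ≤ d ∧ d < 1 ∧ ∀ q : ℕ, g ^ (q + 1) * φ ^ (q / k) ≤ C * d ^ q := by
  have hk' : (0 : ℝ) < k := by exact_mod_cast hk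
  set δ := g ^ k * φ with hδ
  have hδ0 : 0 ≤ δ := by positivity
  set d : ℝ := 1 - (1 - δ) / k with hd
  have hk1 : (1 : ℝ) ≤ k := by exact_mod_cast hk
  have hd1 : d < 1 := by
    have : 0 < (1 - δ) / k := div_pos (by linarith) hk'
    linarith
  have hfrac : (1 - δ) / k ≤ 1 - δ := div_le_self (by linarith) hk1
  have hdk : δ ≤ d ^ k := by
    have h1 := one_add_mul_le_pow (a := -((1 - δ) / k)) (by linarith) k
    have h2 : (1 : ℝ) + k * -((1 - δ) / k) = δ := by field_simp; ring
    rw [h2] at h1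
    rwa [hd, sub_eq_add_neg]
  obtain ⟨d', hd'1, hd'2⟩ := exists_between hd1
  have hd0 : 0 ≤ d := by linarith
  have hd'0 : 0 < d' := by linarith
  refine ⟨g ^ k / d' ^ k, d', by positivity, hd'0.le, hd'2, fun q => ?_⟩
  have hq := Nat.div_add_mod q k
  have hqk := Nat.mod_lt q hk
  have h1 : g ^ (q + 1) * φ ^ (q / k) = g ^ (q % k + 1) * δ ^ (q / k) := by
    rw [hδ, mul_pow, ← pow_mul, ← mul_assoc, ← pow_add]
    congr 2
    omega
  have h2 : δ ^ (q / k) * d' ^ k ≤ d' ^ q := by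
    calc δ ^ (q / k) * d' ^ k ≤ (d ^ k) ^ (q / k) * d' ^ k := by gcongr
      _ ≤ (d' ^ k) ^ (q / k) * d' ^ k := by gcongr
      _ = d' ^ (k * (q / k) + k) := by rw [← pow_mul, pow_add]
      _ ≤ d' ^ q := pow_le_pow_of_le_one hd'0.le hd'2.le (by omega)
  rw [h1, div_mul_eq_mul_div, le_div_iff₀ (by positivity), mul_assoc]
  refine mul_le_mul (pow_le_pow_right₀ hg (by omega)) h2 (by positivity) (by positivity)

/-- Below the critical rate, the queue with renewal arrivals is stable. -/
theorem WorkConserving.stable_renewal (hS : S.WorkConserving) (hL : 0 < L) (hk : 0 < k)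
    {μ : ℝ} (hμ : 0 < μ) {ρ : Measure ℝ} (hρ : IsUnitInterarrival ρ) {r : ℝ} (hr : 0 < r)
    (hlt : r < L * μ / k) : S.Stable μ (accelerate r (renewal ρ)) := by
  have hlam : 0 < (L : ℝ) * μ := mul_pos (by exact_mod_cast hL) hμ
  have hk' : (0 : ℝ) < k := by exact_mod_cast hk
  have i1 := hρ.isProbabilityMeasure
  have hν := hρ.isArrivalProcess.accelerate hr
  have i2 := hν.isProbabilityMeasure
  have i3 := isProbabilityMeasure_serviceLaw n hμ
  have i4 := isProbabilityMeasure_serviceSeqLaw hlam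
  set lam : ℝ := L * μ with hlamdef
  rw [lt_div_iff₀ hk'] at hlt
  -- The load `k * r / lam` is below one; `b` lies strictly in between, so that the Laplace
  -- transform of the interarrival time outweighs `k` service durations.
  obtain ⟨b, hb1, hb2⟩ := exists_between (show k * r / lam < 1 by rw [div_lt_one hlam]; linarith)
  have hb0 : 0 < b := lt_of_le_of_lt (by positivity) hb1
  -- Smallness of `t`: below `1` for `1 - b * t ≥ 0`, below the second bound for `θ < lam`.
  obtain ⟨t, ht0, ht1, ht2⟩ := exists_lt_laplace hρ hb2 (c := min 1 (lam / (r * (k + 1))))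
    (lt_min one_pos (by positivity))
  have ht3 : t < 1 := ht1.trans_le (min_le_left _ _)
  have ht4 : t * (r * (k + 1)) < lam := by
    rw [← lt_div_iff₀ (by positivity)]
    exact ht1.trans_le (min_le_right _ _)
  set θ := r * t with hθ
  have hθ0 : 0 < θ := by positivity
  have hθlam : θ < lam := by nlinarith [mul_pos (mul_pos ht0 hr) hk']
  have htr : θ / r = t := by rw [hθ]; field_simp
  have hφ0 : 0 ≤ 1 - b * t := by nlinarith
  have hlt0 : 0 < lam - θ := sub_pos.2 hθlam
  -- By Bernoulli, `(1 - θ / lam) ^ k ≥ 1 - k * θ / lam`, and `k * θ / lam` is the load times `t`,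
  -- hence below `b * t`.
  have hgφ : (lam / (lam - θ)) ^ k * (1 - b * t) < 1 := by
    have h1 : 1 - k * (θ / lam) ≤ (1 - θ / lam) ^ k := by
      have := one_add_mul_le_pow (a := -(θ / lam)) (by
        have : θ / lam < 1 := (div_lt_one hlam).2 hθlam
        linarith) k
      rw [← sub_eq_add_neg] at this
      linarith
    have h2 : 1 - b * t < 1 - k * (θ / lam) := by
      have : k * (θ / lam) = k * r / lam * t := by rw [hθ]; ring
      rw [this]
      nlinarith
    have h3 : (lam / (lam - θ)) ^ k * (1 - θ / lam) ^ k = 1 := by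
      rw [← mul_pow]
      have : lam / (lam - θ) * (1 - θ / lam) = 1 := by field_simp
      rw [this, one_pow]
    rw [← h3]
    have : 0 < (lam / (lam - θ)) ^ k := by positivity
    gcongr
    linarith
  obtain ⟨C, d, hC0, hd0, hd1, hC⟩ := pow_mul_pow_div_le hk
    (g := lam / (lam - θ)) (by rw [one_le_div hlt0]; linarith) hφ0 hgφ
  have hs : Summable fun q : ℕ => 1 / θ * (C * d ^ q) :=
    ((summable_geometric_of_lt_one hd0 hd1).mul_left C).mul_left _
  set T := ∑' q : ℕ, ENNReal.ofReal (1 / θ * (C * d ^ q)) with hT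
  have hTtop : T < ⊤ := by
    rw [hT, ← ENNReal.ofReal_tsum_of_nonneg (fun q => by positivity) hs]
    exact ENNReal.ofReal_lt_top
  have hm : ∀ i q : ℕ, Measurable fun a : ℕ → ℝ => ∫⁻ y, ENNReal.ofReal
        (∑ j ∈ Finset.Ico (k * i) (k * i + q + 1), y j - (a (i + q / k) - a i))
          ∂serviceSeqLaw lam := by
    intro i q
    have : Measurable fun z : (ℕ → ℝ) × (ℕ → ℝ) => ENNReal.ofReal
        (∑ j ∈ Finset.Ico (k * i) (k * i + q + 1), z.2 j - (z.1 (i + q / k) - z.1 i)) := by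
      fun_prop
    exact this.lintegral_prod_right'
  have hDm : ∀ i, Measurable fun a => ∫⁻ z, S.delay (a, z) i ∂serviceLaw n μ := fun i =>
    (measurable_delay hk i).lintegral_prod_right'
  have key : ∀ M : ℕ, ∑ i ∈ Finset.range M, ∫⁻ w, S.delay w i
      ∂inputLaw n μ (accelerate r (renewal ρ)) ≤ T * M := by
    intro M
    calc _ = ∫⁻ a, ∑ i ∈ Finset.range M, (∫⁻ z, S.delay (a, z) i ∂serviceLaw n μ)
          ∂accelerate r (renewal ρ) := by
          rw [lintegral_finsetSum _ fun i _ => hDm i]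
          refine Finset.sum_congr rfl fun i _ => ?_
          rw [inputLaw, lintegral_prod _ (measurable_delay hk i).aemeasurable]
      _ ≤ ∫⁻ a, ∑ i ∈ Finset.range M, ∑' q : ℕ, (∫⁻ y, ENNReal.ofReal
          (∑ j ∈ Finset.Ico (k * i) (k * i + q + 1), y j - (a (i + q / k) - a i))
            ∂serviceSeqLaw lam) ∂accelerate r (renewal ρ) := by
          refine lintegral_mono_ae ?_
          filter_upwards [hν.ae_valid] with a ha
            using hS.sum_lintegral_delay_le_tsum hL hk hμ ha M
      _ = ∑ i ∈ Finset.range M, ∑' q : ℕ, ∫⁻ a, (∫⁻ y, ENNReal.ofReal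
          (∑ j ∈ Finset.Ico (k * i) (k * i + q + 1), y j - (a (i + q / k) - a i))
            ∂serviceSeqLaw lam) ∂accelerate r (renewal ρ) := by
          rw [lintegral_finsetSum _ fun i _ => Measurable.tsum (hm i)]
          refine Finset.sum_congr rfl fun i _ => ?_
          rw [lintegral_tsum fun q => (hm i q).aemeasurable]
      _ ≤ ∑ i ∈ Finset.range M, T := by
          refine Finset.sum_le_sum fun i _ => ENNReal.tsum_le_tsum fun q => ?_
          refine (lintegral_renewal_le hlam hθ0 hθlam hφ0 (by rwa [htr]) k i q).trans
            (ENNReal.ofReal_le_ofReal ?_)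
          rw [mul_assoc]
          exact mul_le_mul_of_nonneg_left (hC q) (by positivity)
      _ = T * M := by simp [mul_comm]
  refine lt_of_le_of_lt (limsup_le_of_le (by isBoundedDefault)
    (Eventually.of_forall fun M => ?_)) hTtop
  exact ENNReal.div_le_of_le_mul (key M)

end OnlineScheme

/-! ### Comparison with a scheme that is stable for accelerated arrivals -/

/-- The mean waiting time of chunk `l` in a queue that serves at rate `lam` without interruption. -/
noncomputable def meanWait (k : ℕ) (lam : ℝ) (b : ℕ → ℝ) (l : ℕ) : ℝ≥0∞ :=
  ∫⁻ y, (lindley k b y l - ENNReal.ofReal (b (l / k))) ∂serviceSeqLaw lam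

/-- The mean waiting time is at least the waiting time in the fluid limit. -/
theorem ofReal_le_meanWait {k : ℕ} (hk : 0 < k) {lam : ℝ} (hlam : 0 < lam) {b : ℕ → ℝ}
    (hb : ValidArrivals b) {i l : ℕ} (hil : k * i ≤ l) :
    ENNReal.ofReal ((l + 1 - k * i) / lam - (b (l / k) - b i)) ≤ meanWait k lam b l := by
  have hint := integrable_sum_sub hlam (Finset.Ico (k * i) (l + 1)) (b (l / k) - b i)
  have h1 := integral_sum_sub hlam (Finset.Ico (k * i) (l + 1)) (b (l / k) - b i)
  rw [Nat.card_Ico, Nat.cast_sub (by omega)] at h1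
  push_cast at h1
  rw [← h1]
  -- Jensen's inequality for the positive part.
  calc _ ≤ ENNReal.ofReal (∫ y, max (∑ q ∈ Finset.Ico (k * i) (l + 1), y q - (b (l / k) - b i)) 0
        ∂serviceSeqLaw lam) :=
        ENNReal.ofReal_le_ofReal (integral_mono hint hint.pos_part fun y => le_max_left _ _)
    _ = ∫⁻ y, ENNReal.ofReal (∑ q ∈ Finset.Ico (k * i) (l + 1), y q - (b (l / k) - b i))
        ∂serviceSeqLaw lam := by
        rw [ofReal_integral_eq_lintegral_ofReal hint.pos_part
          (Eventually.of_forall fun y => le_max_right _ _)]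
        refine lintegral_congr fun y => ?_
        rw [ENNReal.ofReal_max]
        simp
    _ ≤ _ := by
        refine lintegral_mono fun y => ?_
        refine le_trans (le_of_eq ?_) (tsub_le_tsub_right (le_lindley hk hil) _)
        rw [← ENNReal.ofReal_sub _ (hb.1 _)]
        congr 1
        ring

/-- A large fluid backlog that has built up over `K` chunks forces the total waiting time to be of
order `K ^ 2`. -/
theorem sq_le_sum_meanWait {k : ℕ} (hk : 0 < k) {lam : ℝ} (hlam : 0 < lam) {b : ℕ → ℝ}
    (hb : ValidArrivals b) {η : ℝ} (hη : 0 < η) {i l : ℕ} (hil : k * i ≤ l)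
    (h : η * (l + 1 - k * i) < (l + 1 - k * i) / lam - (b (l / k) - b i)) :
    ENNReal.ofReal (lam * η ^ 2 * (l + 1 - k * i) ^ 2 / 4) ≤
      ∑ l' ∈ Finset.range (l + 1), meanWait k lam b l' := by
  obtain ⟨K, rfl⟩ : ∃ K, l = k * i + K := ⟨l - k * i, by omega⟩
  have hKK : ((k * i + K : ℕ) : ℝ) + 1 - k * i = K + 1 := by push_cast; ring
  rw [hKK] at h ⊢
  have hΔ : 0 ≤ b ((k * i + K) / k) - b i := by
    have : i ≤ (k * i + K) / k := by
      rw [Nat.mul_add_div hk]; exact Nat.le_add_right _ _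
    linarith [hb.2.1 this]
  have hηlam : lam * η < 1 := by
    have h1 : η * (K + 1) < (K + 1) / lam := by linarith
    rw [lt_div_iff₀ hlam] at h1
    have : (0 : ℝ) < K + 1 := by positivity
    nlinarith
  obtain ⟨s₀, hs₀⟩ : ∃ s₀ : ℕ, s₀ = ⌊lam * η * (K + 1) / 2⌋₊ := ⟨_, rfl⟩
  have hs1 : (s₀ : ℝ) ≤ lam * η * (K + 1) / 2 := by
    rw [hs₀]; exact Nat.floor_le (by positivity)
  have hs2 : lam * η * (K + 1) / 2 < s₀ + 1 := by
    rw [hs₀]; exact Nat.lt_floor_add_one _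
  have hsK : s₀ ≤ K := by
    have h1 : (0 : ℝ) < K + 1 := by positivity
    have : (s₀ : ℝ) < K + 1 := by nlinarith
    have : s₀ < K + 1 := by exact_mod_cast this
    omega
  calc ENNReal.ofReal (lam * η ^ 2 * (K + 1) ^ 2 / 4)
      ≤ ENNReal.ofReal (∑ s ∈ Finset.range (s₀ + 1), η * (K + 1) / 2) := by
        refine ENNReal.ofReal_le_ofReal ?_
        simp only [Finset.sum_const, Finset.card_range, nsmul_eq_mul]
        push_cast
        have h1 : 0 < η * (K + 1) / 2 := by positivity
        have := mul_le_mul_of_nonneg_right hs2.le h1.le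
        refine le_trans (le_of_eq ?_) this
        ring
    _ ≤ ∑ s ∈ Finset.range (s₀ + 1), ENNReal.ofReal (η * (K + 1) / 2) := ofReal_sum_le _ _
    _ ≤ ∑ s ∈ Finset.range (s₀ + 1), meanWait k lam b (k * i + K - s) := by
        refine Finset.sum_le_sum fun s hs => ?_
        have hs' : s ≤ s₀ := by have := Finset.mem_range.1 hs; omega
        have hsr : (s : ℝ) ≤ s₀ := by exact_mod_cast hs'
        refine le_trans (ENNReal.ofReal_le_ofReal ?_)
          (ofReal_le_meanWait hk hlam hb (i := i) (l := k * i + K - s) (by omega))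
        have hmono : b ((k * i + K - s) / k) ≤ b ((k * i + K) / k) :=
          hb.2.1 (Nat.div_le_div_right (Nat.sub_le _ _))
        rw [Nat.cast_sub (by omega)]
        push_cast
        have h2 : ((k : ℝ) * i + K - s + 1 - k * i) / lam = (K + 1) / lam - s / lam := by
          field_simp; ring
        have h3 : (s : ℝ) / lam ≤ η * (K + 1) / 2 := by
          rw [div_le_iff₀ hlam]
          nlinarith
        rw [h2]
        linarith
    _ = ∑ l' ∈ (Finset.range (s₀ + 1)).image fun s => k * i + K - s, meanWait k lam b l' := by
        rw [Finset.sum_image]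
        intro s hs s' hs' he
        have h1 := Finset.mem_range.1 hs
        have h2 := Finset.mem_range.1 hs'
        have h3 : k * i + K - s = k * i + K - s' := he
        omega
    _ ≤ _ := by
        refine Finset.sum_le_sum_of_subset fun l' hl' => ?_
        obtain ⟨s, -, rfl⟩ := Finset.mem_image.1 hl'
        rw [Finset.mem_range]
        omega

/-- If the mean waiting times grow at most linearly, large fluid backlogs do not last. -/
theorem exists_fluid_le {k : ℕ} (hk : 0 < k) {lam : ℝ} (hlam : 0 < lam) {b : ℕ → ℝ}
    (hb : ValidArrivals b) {η : ℝ} (hη : 0 < η) {C : ℝ} (hC : 0 ≤ C) {M₀ : ℕ}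
    (hsum : ∀ M, M₀ ≤ M → ∑ l ∈ Finset.range (k * M), meanWait k lam b l ≤ ENNReal.ofReal (C * M)) :
    ∃ M₁, ∀ M, M₁ ≤ M → ∀ i < M, ∀ l, k * (2 * M) ≤ l →
      (l + 1 - k * i) / lam - (b (l / k) - b i) ≤ η * (l + 1 - k * i) := by
  obtain ⟨N, hN⟩ := exists_nat_gt (16 * C / (lam * η ^ 2))
  refine ⟨max M₀ N, fun M hM i hi l hl => ?_⟩
  by_contra! hlt
  have hiM : k * i ≤ k * M := Nat.mul_le_mul_left k hi.le
  have hil : k * i ≤ l := by nlinarith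
  have h1 := sq_le_sum_meanWait hk hlam hb hη hil hlt
  have hMl : M ≤ l := by nlinarith
  have hl1 : l + 1 ≤ k * (l + 1) := Nat.le_mul_of_pos_left _ hk
  have h2 := hsum (l + 1) (((le_max_left _ _).trans hM).trans (by omega))
  have h3 := h1.trans ((Finset.sum_le_sum_of_subset (Finset.range_mono hl1)).trans h2)
  rw [ENNReal.ofReal_le_ofReal_iff (by positivity)] at h3
  push_cast at h3
  have h4 : (N : ℝ) ≤ l := by
    have : N ≤ l := ((le_max_right _ _).trans hM).trans hMl
    exact_mod_cast this
  -- The factor two in `k * (2 * M) ≤ l` is used here: the stretch covers at least half of all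
  -- chunks up to `l`, so its quadratic cost beats the linear bound.
  have h5 : (l + 1 : ℝ) / 2 ≤ l + 1 - k * i := by
    have : 2 * (k * i) ≤ l := by nlinarith
    have : (2 : ℝ) * (k * i) ≤ l := by exact_mod_cast this
    linarith
  rw [div_lt_iff₀ (by positivity)] at hN
  have h6 : (0 : ℝ) < l + 1 := by positivity
  have h7 : ((l + 1 : ℝ) / 2) ^ 2 ≤ (l + 1 - k * i) ^ 2 := by gcongr
  have h8 : lam * η ^ 2 * ((l + 1 : ℝ) / 2) ^ 2 / 4 ≤ C * (l + 1) := by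
    refine le_trans ?_ h3
    gcongr
  have h9 : lam * η ^ 2 * (l + 1) ≤ 16 * C := by
    have : lam * η ^ 2 * (l + 1) * (l + 1) ≤ 16 * C * (l + 1) := by nlinarith
    exact le_of_mul_le_mul_right this h6
  have h10 : 0 < lam * η ^ 2 := by positivity
  nlinarith

namespace OnlineScheme

variable {L k n : ℕ} {S : OnlineScheme L k n}

/-- A work-conserving scheme is stable if some scheme is stable for accelerated arrivals. -/
theorem WorkConserving.limsup_lt_top (hS : S.WorkConserving) (hL : 0 < L) (hk : 0 < k) {μ : ℝ}
    (hμ : 0 < μ) (S' : OnlineScheme L k n) {b : ℕ → ℝ} (hb : ValidArrivals b) {ρ : ℝ} (hρ : 1 < ρ)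
    (h : limsup (fun m : ℕ => (∑ i ∈ Finset.range m, ∫⁻ z, S'.delay (b, z) i ∂serviceLaw n μ) /
      (m : ℝ≥0∞)) atTop < ⊤) :
    limsup (fun m : ℕ => (∑ i ∈ Finset.range m,
      ∫⁻ z, S.delay (fun j => ρ * b j, z) i ∂serviceLaw n μ) / (m : ℝ≥0∞)) atTop < ⊤ := by
  have hlam : 0 < (L : ℝ) * μ := mul_pos (by exact_mod_cast hL) hμ
  set lam : ℝ := L * μ with hlamdef
  have hρ0 : 0 < ρ := by linarith
  -- The slack `ρ` is shared: `κ > 1` controls the random fluctuations, and `ρ / κ > 1` the fluid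
  -- backlog.
  obtain ⟨κ, hκ1, hκρ⟩ := exists_between hρ
  obtain ⟨c, hc1, hc2⟩ := exists_between h
  obtain ⟨M₀, hM₀⟩ := eventually_atTop.1 (eventually_lt_of_limsup_lt hc1)
  set C : ℝ := k * c.toReal with hCdef
  have hC : 0 ≤ C := by positivity
  have hsum : ∀ M, M₀ + 1 ≤ M → ∑ l ∈ Finset.range (k * M), meanWait k lam b l ≤
      ENNReal.ofReal (C * M) := by
    intro M hM
    refine (le_sum_lintegral_delay (S := S') hL hk hμ hb M).trans ?_
    have h1 := (hM₀ M (by omega)).le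
    rw [ENNReal.div_le_iff (by exact_mod_cast (show M ≠ 0 by omega)) (ENNReal.natCast_ne_top _)]
      at h1
    rw [hCdef, mul_assoc, ENNReal.ofReal_mul (Nat.cast_nonneg _),
      ENNReal.ofReal_mul ENNReal.toReal_nonneg, ENNReal.ofReal_toReal hc2.ne,
      ENNReal.ofReal_natCast, ENNReal.ofReal_natCast]
    gcongr
  have hη : 0 < (ρ - κ) / (lam * ρ) := div_pos (by linarith) (by positivity)
  obtain ⟨M₁, hM₁⟩ := exists_fluid_le hk hlam hb hη hC hsum
  obtain ⟨C', d, hC'0, hd0, hd1, hC'⟩ := exists_lintegral_sum_sub_le hlam hκ1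
  have hs : Summable fun q : ℕ => C' * d ^ (q + 1) :=
    ((summable_nat_add_iff 1).2 (summable_geometric_of_lt_one hd0 hd1)).mul_left C'
  set T := ∑' q : ℕ, ENNReal.ofReal (C' * d ^ (q + 1)) with hT
  have hTtop : T < ⊤ := by
    rw [hT, ← ENNReal.ofReal_tsum_of_nonneg (fun q => by positivity) hs]
    exact ENNReal.ofReal_lt_top
  have ha : ValidArrivals fun j => ρ * b j :=
    ⟨fun i => mul_nonneg hρ0.le (hb.1 i), fun _ _ hij => mul_le_mul_of_nonneg_left (hb.2.1 hij) hρ0.le,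
      hb.2.2.const_mul_atTop hρ0⟩
  set a : ℕ → ℝ := fun j => ρ * b j with hadef
  have hpath : ∀ M, M₁ + 1 ≤ M → ∀ l, ∀ y : ℕ → ℝ, (∀ j, 0 ≤ y j) →
      lindleyCut k M a y l - ENNReal.ofReal (a (l / k)) ≤
        ∑ i ∈ Finset.range M, (if k * i ≤ l then ENNReal.ofReal
          (∑ q ∈ Finset.Ico (k * i) (l + 1), y q -
            κ * (Finset.Ico (k * i) (l + 1)).card / lam) else 0) +
        (if l < k * (2 * M) then ENNReal.ofReal ρ * meanWait k lam b l else 0) := by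
    intro M hM l y hy
    obtain ⟨i, hi, hil, he⟩ := exists_lindleyCut_eq hk (show 0 < M by omega) ha hy l
    have hcard : ((Finset.Ico (k * i) (l + 1)).card : ℝ) = l + 1 - k * i := by
      rw [Nat.card_Ico, Nat.cast_sub (by omega)]; push_cast; ring
    -- With `K` chunks in the busy period, add and subtract `κ * K / lam`. The second summand is `ρ`
    -- times the fluid backlog of the faster queue less `(ρ - κ) * K / lam`.
    have h1 : lindleyCut k M a y l - ENNReal.ofReal (a (l / k)) ≤
        ENNReal.ofReal (∑ q ∈ Finset.Ico (k * i) (l + 1), y q -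
            κ * (Finset.Ico (k * i) (l + 1)).card / lam) +
        ENNReal.ofReal (ρ * ((l + 1 - k * i) / lam - (b (l / k) - b i)) -
          (ρ - κ) / lam * (l + 1 - k * i)) := by
      rw [he, ← ENNReal.ofReal_sub _ (ha.1 _)]
      refine le_trans (le_of_eq ?_) ENNReal.ofReal_add_le
      congr 1
      rw [hcard]
      simp only [hadef]
      field_simp
      ring
    refine h1.trans (add_le_add ?_ ?_)
    · refine le_trans (le_of_eq ?_) (Finset.single_le_sum (f := fun i => if k * i ≤ l then
        ENNReal.ofReal (∑ q ∈ Finset.Ico (k * i) (l + 1), y q -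
            κ * (Finset.Ico (k * i) (l + 1)).card / lam) else 0)
        (fun _ _ => zero_le) (Finset.mem_range.2 hi))
      simp only [if_pos hil]
    · have hK0 : (0 : ℝ) ≤ l + 1 - k * i := by rw [← hcard]; positivity
      split_ifs with hl
      · refine le_trans ?_ (mul_le_mul_right (ofReal_le_meanWait hk hlam hb hil) _)
        rw [← ENNReal.ofReal_mul hρ0.le]
        refine ENNReal.ofReal_le_ofReal (sub_le_self _ ?_)
        exact mul_nonneg (div_nonneg (by linarith) hlam.le) hK0
      -- For late chunks the backlog is at most `(ρ - κ) / (lam * ρ)` per chunk, so the second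
      -- summand vanishes; hence only finitely many `l` carry a `meanWait` term.
      · have h2 := hM₁ M (by omega) i hi l (not_lt.1 hl)
        rw [ENNReal.ofReal_of_nonpos]
        have h3 := mul_le_mul_of_nonneg_left h2 hρ0.le
        have h4 : ρ * ((ρ - κ) / (lam * ρ) * (l + 1 - k * i)) =
            (ρ - κ) / lam * (l + 1 - k * i) := by field_simp
        linarith
  have key : ∀ M, max (M₀ + 1) (M₁ + 1) ≤ M → ∑ i ∈ Finset.range M,
      ∫⁻ z, S.delay (a, z) i ∂serviceLaw n μ ≤ (T + ENNReal.ofReal (ρ * (C * 2))) * M := by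
    intro M hM
    have hMa := (le_max_left _ _).trans hM
    have hMb := (le_max_right _ _).trans hM
    have hmU : ∀ i l : ℕ, Measurable fun y : ℕ → ℝ => ENNReal.ofReal
        (∑ q ∈ Finset.Ico (k * i) (l + 1), y q -
          κ * (Finset.Ico (k * i) (l + 1)).card / lam) := fun i l => by fun_prop
    calc _ ≤ ∑' l, ∫⁻ y, (lindleyCut k M a y l - ENNReal.ofReal (a (l / k)))
          ∂serviceSeqLaw lam := hS.sum_lintegral_delay_le hL hk hμ ha M
      _ ≤ ∑' l, (∑ i ∈ Finset.range M, (if k * i ≤ l then ∫⁻ y, ENNReal.ofReal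
          (∑ q ∈ Finset.Ico (k * i) (l + 1), y q -
            κ * (Finset.Ico (k * i) (l + 1)).card / lam) ∂serviceSeqLaw lam else 0) +
          (if l < k * (2 * M) then ENNReal.ofReal ρ * meanWait k lam b l else 0)) := by
          refine ENNReal.tsum_le_tsum fun l => ?_
          have i1 := isProbabilityMeasure_serviceSeqLaw hlam
          calc _ ≤ ∫⁻ y, (∑ i ∈ Finset.range M, (if k * i ≤ l then ENNReal.ofReal
                (∑ q ∈ Finset.Ico (k * i) (l + 1), y q -
                  κ * (Finset.Ico (k * i) (l + 1)).card / lam) else 0) +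
                (if l < k * (2 * M) then ENNReal.ofReal ρ * meanWait k lam b l else 0))
                ∂serviceSeqLaw lam := by
                refine lintegral_mono_ae ?_
                filter_upwards [ae_nonneg_serviceSeqLaw hlam] with y hy using hpath M hMb l y hy
            _ = _ := by
                rw [lintegral_add_right _ measurable_const, lintegral_const, measure_univ, mul_one,
                  lintegral_finsetSum _ fun i _ => by
                    split_ifs
                    · exact hmU i l
                    · exact measurable_const]
                congr 1
                refine Finset.sum_congr rfl fun i _ => ?_
                split_ifs
                · rfl
                · simp
      _ = ∑ i ∈ Finset.range M, ∑' l, (if k * i ≤ l then ∫⁻ y, ENNReal.ofReal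
          (∑ q ∈ Finset.Ico (k * i) (l + 1), y q -
            κ * (Finset.Ico (k * i) (l + 1)).card / lam) ∂serviceSeqLaw lam else 0) +
          ∑' l, (if l < k * (2 * M) then ENNReal.ofReal ρ * meanWait k lam b l else 0) := by
          rw [ENNReal.tsum_add, Summable.tsum_finsetSum fun i _ => ENNReal.summable]
      _ ≤ ∑ i ∈ Finset.range M, T + ENNReal.ofReal (ρ * (C * 2)) * M := by
          refine add_le_add (Finset.sum_le_sum fun i _ => ?_) ?_
          · rw [tsum_ite_le_eq]
            refine ENNReal.tsum_le_tsum fun q => ?_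
            have h1 := hC' (Finset.Ico (k * i) (k * i + q + 1))
            have h2 : (Finset.Ico (k * i) (k * i + q + 1)).card = q + 1 := by
              rw [Nat.card_Ico]; omega
            rw [h2] at h1 ⊢
            exact h1
          · rw [tsum_eq_sum (s := Finset.range (k * (2 * M))) fun l hl =>
              if_neg fun h => hl (Finset.mem_range.2 h)]
            rw [Finset.sum_congr rfl fun l hl => if_pos (Finset.mem_range.1 hl), ← Finset.mul_sum]
            refine (mul_le_mul_right (hsum (2 * M) (by omega)) _).trans (le_of_eq ?_)
            rw [← ENNReal.ofReal_mul hρ0.le, ← ENNReal.ofReal_natCast M,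
              ← ENNReal.ofReal_mul (by positivity)]
            congr 1
            push_cast
            ring
      _ = _ := by
          rw [Finset.sum_const, Finset.card_range, nsmul_eq_mul, add_mul, mul_comm T]
  refine lt_of_le_of_lt (limsup_le_of_le (by isBoundedDefault) ?_)
    (ENNReal.add_lt_top.2 ⟨hTtop, ENNReal.ofReal_lt_top⟩ : T + ENNReal.ofReal (ρ * (C * 2)) < ⊤)
  filter_upwards [eventually_ge_atTop (max (M₀ + 1) (M₁ + 1))] with M hM
  exact ENNReal.div_le_of_le_mul (key M hM)

theorem WorkConserving.throughputOptimal_stableGivenArrivals (hS : S.WorkConserving) (hL : 0 < L)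
    (hk : 0 < k) {μ : ℝ} (hμ : 0 < μ) {ν : Measure (ℕ → ℝ)} (hν : IsArrivalProcess ν) :
    ThroughputOptimal (StableGivenArrivals μ) ν S := by
  rintro r hr ⟨ε, hε, -, S', hS'⟩
  have hrε : 0 < r + ε := by positivity
  have i1 := isProbabilityMeasure_serviceLaw n hμ
  have h1 := ae_of_ae_map (measurable_accelerate (r + ε)).aemeasurable hS'
  have hfm : ∀ m : ℕ, Measurable fun a : ℕ → ℝ => (∑ i ∈ Finset.range m,
      ∫⁻ z, S.delay (a, z) i ∂serviceLaw n μ) / (m : ℝ≥0∞) := fun m =>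
    (Finset.measurable_sum _ fun i _ => (measurable_delay hk i).lintegral_prod_right').div_const _
  unfold StableGivenArrivals accelerate
  rw [ae_map_iff (measurable_accelerate r).aemeasurable
    (measurableSet_lt (Measurable.limsup hfm) measurable_const)]
  filter_upwards [h1, hν.ae_valid] with a ha hv
  -- Arrivals at rate `r` are those at rate `r + ε` slowed down by `(r + ε) / r`, realization by
  -- realization.
  have h2 := hS.limsup_lt_top hL hk hμ S' (hv.div hrε) (ρ := (r + ε) / r)
    (by rw [one_lt_div hr]; linarith) ha
  have h3 : (fun j => (r + ε) / r * (a j / (r + ε))) = fun j => a j / r := by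
    ext j
    field_simp
  rwa [h3] at h2

/-- Instability at the critical rate bounds the capacity region by `L * μ / k`, and below that rate
renewal arrivals are stable, so no comparison of schemes is needed. -/
theorem WorkConserving.throughputOptimal_stable (hS : S.WorkConserving) (hL : 0 < L)
    (hk : 0 < k) {μ : ℝ} (hμ : 0 < μ) {ρ : Measure ℝ} (hρ : IsUnitInterarrival ρ) :
    ThroughputOptimal (Stable μ) (renewal ρ) S := by
  rintro r hr ⟨ε, hε, -, S', hS'⟩
  have hrε : 0 < r + ε := by positivity
  have h1 := lt_of_stable hL hk hμ (hρ.isArrivalProcess.accelerate hrε) hrε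
    (hρ.hasRate.accelerate _) hS'
  exact hS.stable_renewal hL hk hμ hρ hr (by linarith)

end OnlineScheme

end CloudQueue

theorem theorem2 (L k n : ℕ) (hL : 0 < L) (hk : 1 < k) (hn : L + k - 1 ≤ n) (μ : ℝ) (hμ : 0 < μ)
    (S : CloudQueue.OnlineScheme L k n) (hS : S.WorkConserving) :
    -- throughput optimality for any arrival process, given the arrivals
    (∀ ν, CloudQueue.IsArrivalProcess ν → CloudQueue.HasRate ν 1 →
      CloudQueue.ThroughputOptimal (CloudQueue.OnlineScheme.StableGivenArrivals μ) ν S) ∧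
    -- throughput optimality for any renewal arrival process
    (∀ ρ, CloudQueue.IsUnitInterarrival ρ →
      CloudQueue.ThroughputOptimal (CloudQueue.OnlineScheme.Stable μ) (CloudQueue.renewal ρ) S) ∧
    -- service durations of effective chunks are i.i.d. exponential with rate `L μ`, independent of
    -- the arrivals
    (∀ ν, CloudQueue.IsArrivalProcess ν →
      (CloudQueue.inputLaw n μ ν).map
          (fun w => (w.1, CloudQueue.serviceDuration k w.1 (S.start w) w.2.1)) =
        ν.prod (Measure.infinitePi fun _ : ℕ => expMeasure (L * μ))) ∧
    -- long-run rates of delivery and departure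
    (∀ ν (r : ℝ), CloudQueue.IsArrivalProcess ν → 0 < r → CloudQueue.HasRate ν r →
      ∀ᵐ w ∂CloudQueue.inputLaw n μ ν,
        Tendsto (fun t : ℝ => (S.delivered w t : ℝ) / t) atTop (𝓝 (min (k * r) (L * μ))) ∧
        (r ≤ L * μ / k → Tendsto (fun t : ℝ => (S.departed w t : ℝ) / t) atTop (𝓝 r))) ∧
    -- no on-line scheme has a larger departure rate
    (∀ ν, CloudQueue.IsArrivalProcess ν → ∀ S' : CloudQueue.OnlineScheme L k n,
      ∀ c : ℝ, L * μ / k < c →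
        ∀ᵐ w ∂CloudQueue.inputLaw n μ ν, ∀ᶠ t : ℝ in atTop, (S'.departed w t : ℝ) ≤ c * t) ∧
    -- under renewal arrivals the queue is stable exactly for arrival rates below `L μ / k`
    (∀ ρ, CloudQueue.IsUnitInterarrival ρ → ∀ r : ℝ, 0 < r →
      (S.Stable μ (CloudQueue.accelerate r (CloudQueue.renewal ρ)) ↔ r < L * μ / k)) ∧
    -- under any arrival process of rate `r`, some on-line scheme is stable only if `r < L μ / k`
    (∀ ν (r : ℝ), CloudQueue.IsArrivalProcess ν → 0 < r → CloudQueue.HasRate ν r →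
      ∀ S' : CloudQueue.OnlineScheme L k n,
        (S'.Stable μ ν → r < L * μ / k) ∧ (S'.StableGivenArrivals μ ν → r < L * μ / k)) := by
  have hk0 : 0 < k := by omega
  refine ⟨fun ν hν _ => hS.throughputOptimal_stableGivenArrivals hL hk0 hμ hν,
    fun ρ hρ => hS.throughputOptimal_stable hL hk0 hμ hρ, fun ν hν => ?_,
    fun ν r hν hr hA => hS.ae_tendsto_rates hL hk0 hμ hν hr hA,
    fun ν hν S' c hc => CloudQueue.OnlineScheme.ae_eventually_departed_le hL hk0 hμ hν S' hc,
    fun ρ hρ r hr => ⟨fun h => ?_, fun h => hS.stable_renewal hL hk0 hμ hρ hr h⟩,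
    fun ν r hν hr hA S' => ⟨fun h => CloudQueue.OnlineScheme.lt_of_stable hL hk0 hμ hν hr hA h,
      fun h => CloudQueue.OnlineScheme.lt_of_stableGivenArrivals hL hk0 hμ hν hr hA h⟩⟩
  · simp only [CloudQueue.OnlineScheme.serviceDuration_eq]
    exact hS.map_svc_inputLaw hL hk0 hμ hν
  · exact CloudQueue.OnlineScheme.lt_of_stable hL hk0 hμ (hρ.isArrivalProcess.accelerate hr) hr
      (hρ.hasRate.accelerate r) h
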